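/- Conventions. Let $M_0$ be a smooth manifold (Hausdorff, second countable, of dimension $d$) and $\mathbb Z^*=\mathbb Z\setminus\{0\}$. For vector bundles $E_k$ of finite rank, $k\in\mathbb Z^*$, sections of $E_k^*$ have degree $-k$, and $\Gamma(\tilde S(\oplus_k E_k^*))$ denotes the sheaf of graded commutative algebras obtained by completing, in each degree, $\Gamma(S(\oplus_k E_k^*))$ with respect to the negative filtration: a section of degree $j$ is a formal sum $\sum_{n\ge 0}s_n$ of smooth sections $s_n$ of the part of $S(\oplus_k E_k^*)$ of degree $j$ and negative degree $n$, where the negative degree is additive on products, sections of $E_k^*$ having negative degree $\max(k,0)$; and $F^n$ consists of the sections with $s_m=0$ for all $m<n$. A $\mathbb Z^*$-graded manifold $(M_0,\mathcal O)$ is a sheaf $\mathcal O=\oplus_j\mathcal O_j$ of $\mathbb Z$-graded commutative $\mathbb R$-algebras on $M_0$, filtered by $\mathcal O=F^0\supset F^1\supset\cdots$, with a projection $\mathcal O\to C^\infty_{M_0}$ (restriction to $M_0$), which is locally isomorphic, with all this structure, to sheaves $\Gamma(\tilde S(\oplus_k V_k^*))$ with $V_k$ of finite rank. Let $I$ be the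 kernel of $\mathcal O\to C^\infty_{M_0}$ and $I^2$ its square, closed for the filtration. The canonical bundles $E_k$, $k\in\mathbb Z^*$, are defined by $\Gamma(E_k^*)=I_{-k}/(I^2)_{-k}$. A $\mathbb Z^*$-graded $Q$-manifold is a $\mathbb Z^*$-graded manifold with a derivation $Q$ of $\mathcal O$ of degree $+1$, continuous in the sense that $Q(F^{n+1})\subset F^n$ for all $n$, such that $[Q,Q]=2Q^2=0$. Its curvature is the section $\kappa\in\Gamma(E_{+1})$ such that $\langle\kappa,[f]\rangle=Q(f)|_{M_0}$ for $f\in\mathcal O_{-1}$. A splitting over an open set $U$ is an isomorphism $\mathcal O|_U\simeq\Gamma(\tilde S(\oplus_k E_k^*))|_U$ of sheaves of graded filtered algebras which induces the identity on smooth functions and on all the bundles $E_k^*$. For a section $e$ of $E_k$, $\mathfrak i_e$ is the contraction, i.e. the derivation of degree $k$ of $\Gamma(\tilde S(\oplus_k E_k^*))$ which is linear over smooth functions, is $\alpha\mapsto\langle e,\alpha\rangle$ on $\Gamma(E_k^*)$ and vanishes on $\Gamma(E_l^*)$, $l\ne k$. Given a splitting over $U$, the brackets and anchors of the associated (dual)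 Lie $\infty$-algebroid are, for homogeneous sections $e_1,\dots,e_n$ of $\oplus_kE_k$, $$\langle \ell_n(e_1,\dots,e_n),\alpha\rangle = \big([\dots[[Q,\mathfrak i_{e_1}],\mathfrak i_{e_2}],\dots,\mathfrak i_{e_n}]\alpha\big)\big|_{M_0},\qquad \rho_n(e_1,\dots,e_n)[f]=\big([\dots[[Q,\mathfrak i_{e_1}],\mathfrak i_{e_2}],\dots,\mathfrak i_{e_n}]f\big)\big|_{M_0},$$ for sections $\alpha$ of $E_k^*$, $k\in\mathbb Z^*$, and smooth functions $f$. Proposition. Let $(M_0,\mathcal O,Q)$ be a $\mathbb Z^*$-graded $Q$-manifold with canonical bundles $(E_k)_{k\in\mathbb Z^*}$ and curvature $\kappa\in\Gamma(E_{+1})$, and let $U\subset M_0$ be an open set such that $\kappa(x)\neq 0$ for every $x\in U$. Then there is a splitting of $\mathcal O$ over $U$ under which $$Q=\mathfrak i_\kappa .$$ Moreover, for this splitting the $0$-ary bracket of the associated Lie $\infty$-algebroid is $\kappa$, and all its brackets $\ell_n$ and anchors $\rho_n$ with $n\ge 1$ are zero. -/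

import Mathlib

open scoped Manifold ContDiff
open TopologicalSpace

namespace GradedQ

/-- The index set `ℤ* = ℤ ∖ {0}`. -/
abbrev ZStar : Type := {k : ℤ // k ≠ 0}

/-! ### The graded symmetric algebra of a family of vector spaces

For real vector spaces `W k`, `k ∈ ℤ*`, thought of as the duals `(E_k)*`, the elements of `W k`
are given degree `-k`. -/

section Sym

universe v
variable (W : ZStar → Type v) [∀ k, AddCommGroup (W k)] [∀ k, Module ℝ (W k)]

/-- Linearity of the generators and the Koszul rule `v w = (-1)^{kl} w v`. -/
inductive GSymRel : FreeAlgebra ℝ (Σ k, W k) → FreeAlgebra ℝ (Σ k, W k) → Prop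
  | add (k : ZStar) (v w : W k) : GSymRel (FreeAlgebra.ι ℝ ⟨k, v + w⟩)
      (FreeAlgebra.ι ℝ ⟨k, v⟩ + FreeAlgebra.ι ℝ ⟨k, w⟩)
  | smul (k : ZStar) (c : ℝ) (v : W k) : GSymRel (FreeAlgebra.ι ℝ ⟨k, c • v⟩)
      (c • FreeAlgebra.ι ℝ ⟨k, v⟩)
  | comm (k l : ZStar) (v : W k) (w : W l) :
      GSymRel (FreeAlgebra.ι ℝ ⟨k, v⟩ * FreeAlgebra.ι ℝ ⟨l, w⟩)
        ((-1 : ℝ) ^ (k.1 * l.1) • (FreeAlgebra.ι ℝ ⟨l, w⟩ * FreeAlgebra.ι ℝ ⟨k, v⟩))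

/-- The graded symmetric algebra `S(⊕ W k)` over `ℝ`. -/
def GSym : Type v := RingQuot (GSymRel W)

noncomputable instance : Ring (GSym W) := inferInstanceAs (Ring (RingQuot (GSymRel W)))
noncomputable instance : Algebra ℝ (GSym W) :=
  inferInstanceAs (Algebra ℝ (RingQuot (GSymRel W)))

namespace GSym

/-- The quotient map from the free algebra. -/
noncomputable def mk : FreeAlgebra ℝ (Σ k, W k) →ₐ[ℝ] GSym W :=
  RingQuot.mkAlgHom ℝ (GSymRel W)

theorem mk_rel {a b : FreeAlgebra ℝ (Σ k, W k)} (h : GSymRel W a b) : mk W a = mk W b :=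
  RingQuot.mkAlgHom_rel ℝ h

theorem mk_surjective : Function.Surjective (mk W) :=
  RingQuot.mkAlgHom_surjective ℝ (GSymRel W)

/-- The inclusion of the generators of degree `-k`. -/
noncomputable def ι (k : ZStar) : W k →ₗ[ℝ] GSym W where
  toFun v := mk W (FreeAlgebra.ι ℝ ⟨k, v⟩)
  map_add' v w := by
    rw [← map_add]; exact mk_rel W (GSymRel.add k v w)
  map_smul' c v := by
    rw [RingHom.id_apply, ← map_smul]; exact mk_rel W (GSymRel.smul k c v)

theorem ι_mul_ι (k l : ZStar) (v : W k) (w : W l) :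
    ι W k v * ι W l w = (-1 : ℝ) ^ (k.1 * l.1) • (ι W l w * ι W k v) := by
  simp only [ι, LinearMap.coe_mk, AddHom.coe_mk]
  rw [← map_mul, ← map_mul, ← map_smul]
  exact mk_rel W (GSymRel.comm k l v w)

variable {W}

/-- The universal property of the graded symmetric algebra. -/
noncomputable def lift {A : Type*} [Ring A] [Algebra ℝ A] (f : ∀ k, W k →ₗ[ℝ] A)
    (hf : ∀ (k l : ZStar) (v : W k) (w : W l),
      f k v * f l w = (-1 : ℝ) ^ (k.1 * l.1) • (f l w * f k v)) : GSym W →ₐ[ℝ] A :=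
  RingQuot.liftAlgHom ℝ ⟨FreeAlgebra.lift ℝ fun p => f p.1 p.2, by
    intro a b h
    cases h with
    | add k v w => simp
    | smul k c v => simp
    | comm k l v w => simpa using hf k l v w⟩

@[simp] theorem lift_ι {A : Type*} [Ring A] [Algebra ℝ A] (f : ∀ k, W k →ₗ[ℝ] A)
    (hf : ∀ (k l : ZStar) (v : W k) (w : W l),
      f k v * f l w = (-1 : ℝ) ^ (k.1 * l.1) • (f l w * f k v)) (k : ZStar) (v : W k) :
    lift f hf (ι W k v) = f k v := by
  change RingQuot.liftAlgHom ℝ _ (RingQuot.mkAlgHom ℝ (GSymRel W) _) = _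
  simp

theorem induction {P : GSym W → Prop} (hs : ∀ c : ℝ, P (algebraMap ℝ _ c))
    (hι : ∀ k v, P (ι W k v)) (hm : ∀ a b, P a → P b → P (a * b))
    (ha : ∀ a b, P a → P b → P (a + b)) (a : GSym W) : P a := by
  obtain ⟨a, rfl⟩ := mk_surjective W a
  induction a with
  | grade0 c => simpa using hs c
  | grade1 p => exact hι p.1 p.2
  | mul a b h1 h2 => simpa using hm _ _ h1 h2
  | add a b h1 h2 => simpa using ha _ _ h1 h2

/-- The augmentation, which kills all generators. -/
noncomputable def aug : GSym W →ₐ[ℝ] ℝ := lift (fun _ => 0) (by simp)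

/-- A functional on `W k`, extended by zero to the other `W l`. -/
noncomputable def extend (k : ZStar) (φ : W k →ₗ[ℝ] ℝ) (l : ZStar) : W l →ₗ[ℝ] ℝ :=
  if h : k = l then h ▸ φ else 0

theorem extend_same (k : ZStar) (φ : W k →ₗ[ℝ] ℝ) : extend k φ k = φ := by simp [extend]

theorem extend_ne {k l : ZStar} (φ : W k →ₗ[ℝ] ℝ) (h : k ≠ l) : extend k φ l = 0 := by
  simp [extend, h]

/-- Auxiliary: the algebra morphism `a ↦ !![γ a, D a; 0, a]` in which `D` is the derivation of
degree `k` extending `φ`, and `γ a = (-1)^{k |a|} a`. -/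
noncomputable def contractHom (k : ZStar) (φ : W k →ₗ[ℝ] ℝ) :
    GSym W →ₐ[ℝ] Matrix (Fin 2) (Fin 2) (GSym W) :=
  lift (fun l =>
    { toFun := fun w => !![(-1 : ℝ) ^ (k.1 * l.1) • ι W l w,
          algebraMap ℝ (GSym W) (extend k φ l w); 0, ι W l w]
      map_add' := by
        intro v w; ext i j; fin_cases i <;> fin_cases j <;> simp
      map_smul' := by
        intro c w; ext i j
        fin_cases i <;> fin_cases j <;> simp [Algebra.algebraMap_eq_smul_one, mul_smul]
        rw [smul_comm] }) (by
    intro l m v w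
    have hvw := ι_mul_ι W l m v w
    have h1 : ∀ a : ℤ, (-1 : ℝ) ^ a * (-1 : ℝ) ^ a = 1 := by
      intro a; rw [← mul_zpow]; simp
    have h2 : ∀ (a : ℤ) (r : ℝ), (-1 : ℝ) ^ a * (r * (-1 : ℝ) ^ a) = r := by
      intro a r; rw [mul_left_comm, h1, mul_one]
    ext i j
    fin_cases i <;> fin_cases j
    · simp [Matrix.mul_apply, Fin.sum_univ_two, hvw, smul_smul]
      congr 1; ring
    · by_cases hl : k = l <;> by_cases hm : k = m
      · subst hl; subst hm
        simp only [Fin.zero_eta, Fin.mk_one, Matrix.mul_apply, Fin.sum_univ_two, extend_same,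
          Algebra.algebraMap_eq_smul_one, LinearMap.coe_mk, AddHom.coe_mk, Matrix.of_apply,
          Matrix.cons_val', Matrix.cons_val_zero, Matrix.cons_val_one, Matrix.cons_val_fin_one,
          Matrix.smul_apply, smul_mul_assoc, mul_smul_comm, one_mul, mul_one, smul_smul, smul_add,
          h2]
        rw [add_comm, mul_comm (φ w)]
      · subst hl
        simp [Matrix.mul_apply, Fin.sum_univ_two, extend_same, extend_ne _ hm,
          Algebra.algebraMap_eq_smul_one, smul_smul]
        rw [← mul_assoc, h1, one_mul]
      · subst hm
        simp [Matrix.mul_apply, Fin.sum_univ_two, extend_same, extend_ne _ hl,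
          Algebra.algebraMap_eq_smul_one, smul_smul]
        rw [mul_comm k.1 l.1, mul_comm]
      · simp [Matrix.mul_apply, Fin.sum_univ_two, extend_ne _ hl, extend_ne _ hm]
    · simp [Matrix.mul_apply, Fin.sum_univ_two]
    · simp [Matrix.mul_apply, Fin.sum_univ_two, hvw])

/-- Contraction with a functional `φ` on `W k`: the graded derivation of degree `k` of `S(⊕ W l)`
which is `φ` on `W k` and zero on `W l`, `l ≠ k`. -/
noncomputable def contract (k : ZStar) (φ : W k →ₗ[ℝ] ℝ) : GSym W →ₗ[ℝ] GSym W where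
  toFun a := contractHom k φ a 0 1
  map_add' a b := by simp
  map_smul' c a := by simp

@[simp] theorem contract_one (k : ZStar) (φ : W k →ₗ[ℝ] ℝ) : contract k φ 1 = 0 := by
  simp [contract]

theorem contractHom_lower (k : ZStar) (φ : W k →ₗ[ℝ] ℝ) (a : GSym W) :
    contractHom k φ a 1 0 = 0 ∧ contractHom k φ a 1 1 = a := by
  induction a using induction with
  | hs c => simp [Matrix.algebraMap_matrix_apply]
  | hι l v => simp [contractHom]
  | hm a b h1 h2 => simp [Matrix.mul_apply, Fin.sum_univ_two, h1.1, h1.2, h2.1, h2.2]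
  | ha a b h1 h2 => simp [h1.1, h1.2, h2.1, h2.2]

theorem contractHom_ι (k : ZStar) (φ : W k →ₗ[ℝ] ℝ) (l : ZStar) (w : W l) :
    contractHom k φ (ι W l w) = !![(-1 : ℝ) ^ (k.1 * l.1) • ι W l w,
      algebraMap ℝ (GSym W) (extend k φ l w); 0, ι W l w] := by
  simp [contractHom]

theorem contract_ι_mul (k : ZStar) (φ : W k →ₗ[ℝ] ℝ) (l : ZStar) (w : W l) (a : GSym W) :
    contract k φ (ι W l w * a) =
      extend k φ l w • a + (-1 : ℝ) ^ (k.1 * l.1) • (ι W l w * contract k φ a) := by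
  simp only [contract, LinearMap.coe_mk, AddHom.coe_mk, map_mul, Matrix.mul_apply,
    Fin.sum_univ_two, (contractHom_lower k φ a).2, contractHom_ι]
  simp [Algebra.algebraMap_eq_smul_one, add_comm]

end GSym
end Sym

/-! ### Sections of the completed graded symmetric algebra -/

section Sections

universe u v

/-- A family of real vector spaces over a manifold `M`, indexed by `ℤ*`, with a notion of
smoothness of a section at (that is, near) a point. It is only used for the two families below:
trivial bundles and the duals of the canonical bundles of a graded manifold. -/
structure GradedFamily (d : ℕ) (M : Type u) where
  fib : ZStar → M → Type v
  [grp : ∀ k x, AddCommGroup (fib k x)]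
  [mod : ∀ k x, Module ℝ (fib k x)]
  smoothAt : ∀ k : ZStar, (∀ y, fib k y) → M → Prop

attribute [instance] GradedFamily.grp GradedFamily.mod

variable {d : ℕ} {M : Type u} [TopologicalSpace M] [ChartedSpace (EuclideanSpace ℝ (Fin d)) M]

variable (d M) in
/-- The family of trivial bundles `M × ℝ^(r k)`. -/
def trivialFamily (r : ZStar → ℕ) : GradedFamily.{u, 0} d M where
  fib k _ := Fin (r k) → ℝ
  smoothAt k w x := ContMDiffAt (𝓡 d) 𝓘(ℝ, Fin (r k) → ℝ) ∞ (w : M → Fin (r k) → ℝ) x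

namespace GradedFamily

variable (W : GradedFamily.{u, v} d M)

/-- The fibre at `x` of the symmetric algebra of the family. -/
abbrev Sym (x : M) : Type v := GSym fun k => W.fib k x

/-- Formal series with coefficients in the fibre at `x` of the symmetric algebra. The exponent of
the formal variable records the negative degree, so that the fibre at `x` of the completion with
respect to the negative filtration consists of such series. -/
abbrev CSym (x : M) : Type v := PowerSeries (W.Sym x)

/-- The monomials `c • w₁ ⋯ w_p`, where the function `c` and the sections `w_a` of `W (k_a)`
are smooth over `V`, of total degree `-k₁ - ⋯ - k_p = j` and of negative degree
`max k₁ 0 + ⋯ + max k_p 0 = n`. -/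
def monomials (V : Opens M) (j : ℤ) (n : ℕ) : Set (∀ y, W.Sym y) :=
  {t | ∃ (c : M → ℝ) (l : List (Σ k : ZStar, ∀ y, W.fib k y)),
    (∀ y ∈ V, ContMDiffAt (𝓡 d) 𝓘(ℝ, ℝ) ∞ c y) ∧
    (∀ w ∈ l, ∀ y ∈ V, W.smoothAt w.1 w.2 y) ∧
    (l.map fun w => -w.1.1).sum = j ∧ (l.map fun w => w.1.1.toNat).sum = n ∧
    ∀ y, t y = c y • (l.map fun w => GSym.ι (fun k => W.fib k y) w.1 (w.2 y)).prod}

theorem monomials_anti {V V' : Opens M} (h : V' ≤ V) (j : ℤ) (n : ℕ) :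
    W.monomials V j n ⊆ W.monomials V' j n := by
  rintro t ⟨c, l, hc, hl, hj, hn, ht⟩
  exact ⟨c, l, fun y hy => hc y (h hy), fun w hw y hy => hl w hw y (h hy), hj, hn, ht⟩

theorem mul_mem_span_monomials {V : Opens M} {i j : ℤ} {m n : ℕ} {s t : ∀ y, W.Sym y}
    (hs : s ∈ Submodule.span ℝ (W.monomials V i m))
    (ht : t ∈ Submodule.span ℝ (W.monomials V j n)) :
    s * t ∈ Submodule.span ℝ (W.monomials V (i + j) (m + n)) := by
  have h := Submodule.mul_mem_mul hs ht
  rw [Submodule.span_mul_span] at h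
  refine Submodule.span_mono ?_ h
  rintro _ ⟨s, ⟨c, l, hc, hl, hi, hm, hs⟩, t, ⟨c', l', hc', hl', hj, hn, ht⟩, rfl⟩
  refine ⟨fun y => c y * c' y, l ++ l', fun y hy => (hc y hy).mul (hc' y hy), ?_, ?_, ?_, ?_⟩
  · intro w hw
    rcases List.mem_append.1 hw with h | h
    exacts [hl w h, hl' w h]
  · simp [hi, hj]
  · simp [hm, hn]
  · intro y
    simp [hs y, ht y, smul_smul, mul_comm]

/-- Smooth sections over `U` of the part of total degree `j` and negative degree `n` of the
symmetric algebra: locally, finite sums of monomials. -/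
def symSections (U : Opens M) (j : ℤ) (n : ℕ) : Submodule ℝ (∀ x : U, W.Sym x.1) where
  carrier := {s | ∀ x : U, ∃ V : Opens M, x.1 ∈ V ∧
    ∃ t ∈ Submodule.span ℝ (W.monomials V j n), ∀ y : U, y.1 ∈ V → s y = t y.1}
  zero_mem' := fun x => ⟨⊤, trivial, 0, Submodule.zero_mem _, fun _ _ => rfl⟩
  add_mem' := by
    intro a b ha hb x
    obtain ⟨V, hx, t, ht, h⟩ := ha x
    obtain ⟨V', hx', t', ht', h'⟩ := hb x
    exact ⟨V ⊓ V', ⟨hx, hx'⟩, t + t', Submodule.add_mem _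
      (Submodule.span_mono (W.monomials_anti inf_le_left j n) ht)
      (Submodule.span_mono (W.monomials_anti inf_le_right j n) ht'),
      fun y hy => by simp [h y hy.1, h' y hy.2]⟩
  smul_mem' := by
    intro c a ha x
    obtain ⟨V, hx, t, ht, h⟩ := ha x
    exact ⟨V, hx, c • t, Submodule.smul_mem _ _ ht, fun y hy => by simp [h y hy]⟩

theorem mul_mem_symSections {U : Opens M} {i j : ℤ} {m n : ℕ} {s t : ∀ x : U, W.Sym x.1}
    (hs : s ∈ W.symSections U i m) (ht : t ∈ W.symSections U j n) :
    s * t ∈ W.symSections U (i + j) (m + n) := by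
  intro x
  obtain ⟨V, hx, a, ha, h⟩ := hs x
  obtain ⟨V', hx', b, hb, h'⟩ := ht x
  exact ⟨V ⊓ V', ⟨hx, hx'⟩, a * b, W.mul_mem_span_monomials
    (Submodule.span_mono (W.monomials_anti inf_le_left _ _) ha)
    (Submodule.span_mono (W.monomials_anti inf_le_right _ _) hb),
    fun y hy => by simp [h y hy.1, h' y hy.2]⟩

/-- Sections over `U` of degree `j` of the completed symmetric algebra: families
`(s_n)_{n ≥ 0}` with `s_n` a smooth section of the part of degree `j` and negative degree `n`. -/
def homSections (U : Opens M) (j : ℤ) : Submodule ℝ (∀ x : U, W.CSym x.1) where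
  carrier := {s | ∀ n, (fun x => PowerSeries.coeff n (s x)) ∈ W.symSections U j n}
  zero_mem' := fun n => (W.symSections U j n).zero_mem
  add_mem' := fun ha hb n => (W.symSections U j n).add_mem (ha n) (hb n)
  smul_mem' := fun c _ ha n => (W.symSections U j n).smul_mem c (ha n)

theorem mul_mem_homSections {U : Opens M} {i j : ℤ} {s t : ∀ x : U, W.CSym x.1}
    (hs : s ∈ W.homSections U i) (ht : t ∈ W.homSections U j) :
    s * t ∈ W.homSections U (i + j) := by
  intro n
  have h : (fun x : U => PowerSeries.coeff n ((s * t) x)) =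
      ∑ p ∈ Finset.HasAntidiagonal.antidiagonal n, (fun x : U => PowerSeries.coeff p.1 (s x)) *
        (fun x : U => PowerSeries.coeff p.2 (t x)) := by
    funext x
    simp [PowerSeries.coeff_mul]
  rw [h]
  refine Submodule.sum_mem _ fun p hp => ?_
  rw [← Finset.HasAntidiagonal.mem_antidiagonal.1 hp]
  exact W.mul_mem_symSections (hs p.1) (ht p.2)

/-- A function, as a section of polynomial degree `0`. -/
noncomputable def constSec {U : Opens M} (f : U → ℝ) : ∀ x : U, W.CSym x.1 :=
  fun x => algebraMap ℝ (W.CSym x.1) (f x)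

/-- A section of `W k`, as a section of polynomial degree `1`. -/
noncomputable def genSec {U : Opens M} (k : ZStar) (w : ∀ x : U, W.fib k x.1) :
    ∀ x : U, W.CSym x.1 :=
  fun x => PowerSeries.monomial k.1.toNat (GSym.ι (fun k => W.fib k x.1) k (w x))

theorem constSec_mem {U : Opens M} (f : C^∞⟮𝓡 d, U; 𝓘(ℝ, ℝ), ℝ⟯) :
    W.constSec (fun x => f x) ∈ W.homSections U 0 := by
  classical
  intro n
  by_cases hn : n = 0
  · subst hn
    intro x
    refine ⟨U, x.2, _, Submodule.subset_span
      ⟨fun y => if h : y ∈ U then f ⟨y, h⟩ else 0, [], ?_, by simp, rfl, rfl, fun y => rfl⟩, ?_⟩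
    · intro y hy
      have h := (f.contMDiff (n := ∞)).contMDiffAt (x := ⟨y, hy⟩)
      refine (contMDiffAt_subtype_iff (x := (⟨y, hy⟩ : U))).1 (h.congr_of_eventuallyEq ?_)
      exact Filter.Eventually.of_forall fun z => by simp
    · intro y _
      simp [constSec, Algebra.algebraMap_eq_smul_one]
  · convert (W.symSections U 0 n).zero_mem using 1
    funext x
    simp [constSec, Algebra.algebraMap_eq_smul_one, PowerSeries.coeff_one, hn]

theorem genSec_mem {U : Opens M} (k : ZStar) (w : ∀ x : U, W.fib k x.1)
    (hw : ∀ x : U, ∃ (V : Opens M) (w' : ∀ y, W.fib k y), x.1 ∈ V ∧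
      (∀ y ∈ V, W.smoothAt k w' y) ∧ ∀ y : U, y.1 ∈ V → w y = w' y.1) :
    W.genSec k w ∈ W.homSections U (-k.1) := by
  intro n
  by_cases hn : n = k.1.toNat
  · subst hn
    intro x
    obtain ⟨V, w', hx, hs, h⟩ := hw x
    refine ⟨V, hx, _, Submodule.subset_span
      ⟨fun _ => 1, [⟨k, w'⟩], fun y _ => contMDiffAt_const, by simpa using hs, by simp, by simp,
        fun y => rfl⟩, ?_⟩
    intro y hy
    simp [genSec, h y hy]
  · convert (W.symSections U (-k.1) n).zero_mem using 1
    funext x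
    simp [genSec, PowerSeries.coeff_monomial, hn]

/-- `Γ(U, S̃(⊕ W k))`: the direct sum over `j ∈ ℤ` of its parts of degree `j`. -/
def sections (U : Opens M) : Subalgebra ℝ (∀ x : U, W.CSym x.1) where
  carrier := ((⨆ j, W.homSections U j : Submodule ℝ (∀ x : U, W.CSym x.1)) : Set _)
  mul_mem' := by
    intro a b ha hb
    have h := Submodule.mul_mem_mul (M := ⨆ j, W.homSections U j) (N := ⨆ j, W.homSections U j)
      ha hb
    simp only [Submodule.iSup_mul, Submodule.mul_iSup] at h
    refine (iSup_le fun i => iSup_le fun j => ?_ :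
      _ ≤ (⨆ j, W.homSections U j : Submodule ℝ (∀ x : U, W.CSym x.1))) h
    refine Submodule.mul_le.2 fun s hs t ht => ?_
    exact Submodule.mem_iSup_of_mem (_ + _) (W.mul_mem_homSections hs ht)
  add_mem' := fun ha hb => Submodule.add_mem _ ha hb
  algebraMap_mem' := fun c =>
    Submodule.mem_iSup_of_mem 0 (W.constSec_mem (ContMDiffMap.const c))

theorem homSections_le (U : Opens M) (j : ℤ) :
    W.homSections U j ≤ Subalgebra.toSubmodule (W.sections U) := fun _ hs =>
  Submodule.mem_iSup_of_mem (p := fun j => W.homSections U j) j hs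

/-- Contraction with a section `φ` of the dual of `W k`: the derivation of degree `k` which is
linear over functions and given by `φ` on sections of `W k` and by zero on those of `W l`,
`l ≠ k`. It lowers the negative degree by `max k 0`. -/
noncomputable def contract {U : Opens M} (k : ZStar) (φ : ∀ x : U, W.fib k x.1 →ₗ[ℝ] ℝ) :
    (∀ x : U, W.CSym x.1) →ₗ[ℝ] (∀ x : U, W.CSym x.1) where
  toFun s x := PowerSeries.mk fun n =>
    GSym.contract k (φ x) (PowerSeries.coeff (n + k.1.toNat) (s x))
  map_add' s t := by
    funext x; ext n; simp
  map_smul' c s := by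
    funext x; ext n; simp

theorem contract_prod_mem {V : Opens M} (k : ZStar) (φ : ∀ y, W.fib k y →ₗ[ℝ] ℝ)
    (hφ : ∀ w : ∀ y, W.fib k y, (∀ y ∈ V, W.smoothAt k w y) →
      ∀ y ∈ V, ContMDiffAt (𝓡 d) 𝓘(ℝ, ℝ) ∞ (fun z => φ z (w z)) y)
    (l : List (Σ k : ZStar, ∀ y, W.fib k y)) (hl : ∀ w ∈ l, ∀ y ∈ V, W.smoothAt w.1 w.2 y) :
    (fun y => GSym.contract k (φ y)
      (l.map fun w => GSym.ι (fun k => W.fib k y) w.1 (w.2 y)).prod) ∈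
    Submodule.span ℝ {t | ∃ n, n + k.1.toNat = (l.map fun w => w.1.1.toNat).sum ∧
      t ∈ W.monomials V ((l.map fun w => -w.1.1).sum + k.1) n} := by
  induction l with
  | nil =>
    convert Submodule.zero_mem _ using 1
    funext y
    simp
  | cons w l ih =>
    have ih := ih fun w' hw' => hl w' (List.mem_cons_of_mem _ hw')
    have hw := hl w List.mem_cons_self
    have key : (fun y => GSym.contract k (φ y)
        ((w :: l).map fun w => GSym.ι (fun k => W.fib k y) w.1 (w.2 y)).prod) =
        (fun y => GSym.extend (W := fun k => W.fib k y) k (φ y) w.1 (w.2 y) •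
          (l.map fun w => GSym.ι (fun k => W.fib k y) w.1 (w.2 y)).prod) +
        (-1 : ℝ) ^ (k.1 * w.1.1) • ((fun y => GSym.ι (fun k => W.fib k y) w.1 (w.2 y)) *
          fun y => GSym.contract k (φ y)
            (l.map fun w => GSym.ι (fun k => W.fib k y) w.1 (w.2 y)).prod) := by
      funext y
      simp [GSym.contract_ι_mul]
    rw [key]
    refine Submodule.add_mem _ ?_ (Submodule.smul_mem _ _ ?_)
    · by_cases h : k = w.1
      · obtain ⟨m, w⟩ := w
        obtain rfl : k = m := h
        refine Submodule.subset_span ⟨(l.map fun w => w.1.1.toNat).sum, by simp [add_comm],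
          fun y => φ y (w y), l, hφ w hw, fun w' hw' => hl w' (List.mem_cons_of_mem _ hw'),
          by simp, rfl, fun y => by simp [GSym.extend_same]⟩
      · convert Submodule.zero_mem _ using 1
        funext y
        simp [GSym.extend_ne _ h]
    · refine Submodule.span_induction (p := fun t _ =>
        (fun y => GSym.ι (fun k => W.fib k y) w.1 (w.2 y)) * t ∈ Submodule.span ℝ
          {t | ∃ n, n + k.1.toNat = ((w :: l).map fun w => w.1.1.toNat).sum ∧
            t ∈ W.monomials V (((w :: l).map fun w => -w.1.1).sum + k.1) n}) ?_ ?_ ?_ ?_ ih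
      · rintro t ⟨n, hn, c, l', hc, hl', hj, hn', ht⟩
        refine Submodule.subset_span ⟨n + w.1.1.toNat, ?_, c, w :: l', hc, ?_, ?_, ?_, ?_⟩
        · simp only [List.map_cons, List.sum_cons]; omega
        · intro w' hw'
          rcases List.mem_cons.1 hw' with rfl | h
          exacts [hw, hl' w' h]
        · simp only [List.map_cons, List.sum_cons, hj]; ring
        · simp only [List.map_cons, List.sum_cons, hn']; ring
        · intro y
          simp [ht y]
      · simp
      · intro a b _ _ ha hb
        rw [mul_add]; exact Submodule.add_mem _ ha hb
      · intro c a _ ha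
        rw [mul_smul_comm]; exact Submodule.smul_mem _ _ ha

theorem contract_mem_span {V : Opens M} (k : ZStar) (φ : ∀ y, W.fib k y →ₗ[ℝ] ℝ)
    (hφ : ∀ w : ∀ y, W.fib k y, (∀ y ∈ V, W.smoothAt k w y) →
      ∀ y ∈ V, ContMDiffAt (𝓡 d) 𝓘(ℝ, ℝ) ∞ (fun z => φ z (w z)) y)
    {j : ℤ} {n : ℕ} {t : ∀ y, W.Sym y}
    (ht : t ∈ Submodule.span ℝ (W.monomials V j (n + k.1.toNat))) :
    (fun y => GSym.contract k (φ y) (t y)) ∈ Submodule.span ℝ (W.monomials V (j + k.1) n) := by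
  let T : (∀ y, W.Sym y) →ₗ[ℝ] (∀ y, W.Sym y) :=
    LinearMap.pi fun y => GSym.contract k (φ y) ∘ₗ LinearMap.proj y
  suffices h : Submodule.span ℝ (W.monomials V j (n + k.1.toNat)) ≤
      (Submodule.span ℝ (W.monomials V (j + k.1) n)).comap T from h ht
  rw [Submodule.span_le]
  rintro t ⟨c, l, hc, hl, hj, hn, ht⟩
  have h1 := W.contract_prod_mem k φ hφ l hl
  rw [hj, hn] at h1
  have h2 : (fun y => GSym.contract k (φ y)
      (l.map fun w => GSym.ι (fun k => W.fib k y) w.1 (w.2 y)).prod) ∈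
      Submodule.span ℝ (W.monomials V (j + k.1) n) := by
    refine Submodule.span_mono ?_ h1
    rintro t ⟨m, hm, hmem⟩
    obtain rfl : m = n := by omega
    exact hmem
  have h3 : (fun y => c y • (1 : W.Sym y)) ∈ Submodule.span ℝ (W.monomials V 0 0) :=
    Submodule.subset_span ⟨c, [], hc, by simp, rfl, rfl, fun y => rfl⟩
  have h4 := W.mul_mem_span_monomials h3 h2
  rw [zero_add, zero_add] at h4
  have h5 : T t = (fun y => c y • (1 : W.Sym y)) * fun y => GSym.contract k (φ y)
      (l.map fun w => GSym.ι (fun k => W.fib k y) w.1 (w.2 y)).prod := by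
    funext y
    simp [T, ht y]
  rw [SetLike.mem_coe, Submodule.mem_comap, h5]
  exact h4

theorem contract_mem_sections {U : Opens M} (k : ZStar) (φ : ∀ x : U, W.fib k x.1 →ₗ[ℝ] ℝ)
    (hφ : ∀ (V : Opens M) (w : ∀ y, W.fib k y), (∀ y ∈ V, W.smoothAt k w y) →
      ∀ y ∈ V ⊓ U, ∃ g : M → ℝ, ContMDiffAt (𝓡 d) 𝓘(ℝ, ℝ) ∞ g y ∧
        ∀ᶠ z in nhds y, ∀ hz : z ∈ U, φ ⟨z, hz⟩ (w z) = g z)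
    {s : ∀ x : U, W.CSym x.1} (hs : s ∈ W.sections U) : W.contract k φ s ∈ W.sections U := by
  classical
  let ψ : ∀ y, W.fib k y →ₗ[ℝ] ℝ := fun y => if h : y ∈ U then φ ⟨y, h⟩ else 0
  have hψ : ∀ (V : Opens M) (w : ∀ y, W.fib k y), (∀ y ∈ V ⊓ U, W.smoothAt k w y) →
      ∀ y ∈ V ⊓ U, ContMDiffAt (𝓡 d) 𝓘(ℝ, ℝ) ∞ (fun z => ψ z (w z)) y := by
    intro V w hw y hy
    obtain ⟨g, hg, h⟩ := hφ (V ⊓ U) w hw y ⟨hy, hy.2⟩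
    refine hg.congr_of_eventuallyEq ?_
    filter_upwards [h, U.isOpen.mem_nhds hy.2] with z h1 h2
    have h2 : z ∈ U := h2
    simp [ψ, h2, h1 h2]
  have main : ∀ j, ∀ s ∈ W.homSections U j, W.contract k φ s ∈ W.homSections U (j + k.1) := by
    intro j s hs n x
    obtain ⟨V, hx, t, ht, h⟩ := hs (n + k.1.toNat) x
    refine ⟨V ⊓ U, ⟨hx, x.2⟩, _, W.contract_mem_span k ψ (hψ V)
      (Submodule.span_mono (W.monomials_anti inf_le_left _ _) ht), ?_⟩
    intro y hy
    have := h y hy.1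
    simp only at this
    simp [contract, ψ, this]
  have hle : (⨆ j, W.homSections U j) ≤
      (⨆ j, W.homSections U j : Submodule ℝ (∀ x : U, W.CSym x.1)).comap (W.contract k φ) :=
    iSup_le fun j s hs => Submodule.mem_iSup_of_mem (p := fun j => W.homSections U j) _ (main j s hs)
  exact hle hs

end GradedFamily
end Sections

/-! ### Graded manifolds -/

section Manifolds

universe u v

/-- A sheaf `O = ⊕ O_j` of `ℤ`-graded commutative real algebras on a manifold `M`, with the
gluing axiom in each degree, together with a decreasing filtration of `O` by subsheaves `F^n`
(the negative filtration) and a morphism `body` of sheaves of graded algebras to the sheaf of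
smooth functions of `M`, placed in degree `0` (the restriction of functions to `M`). -/
structure GradedSpace (d : ℕ) (M : Type u) [TopologicalSpace M]
    [ChartedSpace (EuclideanSpace ℝ (Fin d)) M] where
  obj : Opens M → Type v
  [ring : ∀ U, Ring (obj U)]
  [algebra : ∀ U, Algebra ℝ (obj U)]
  res : ∀ {U V : Opens M}, V ≤ U → obj U →ₐ[ℝ] obj V
  res_refl : ∀ (U : Opens M) (f : obj U), res (le_refl U) f = f
  res_res : ∀ {U V W : Opens M} (h : V ≤ U) (h' : W ≤ V) (f : obj U),
    res h' (res h f) = res (h'.trans h) f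
  deg : ∀ U, ℤ → Submodule ℝ (obj U)
  [graded : ∀ U, GradedAlgebra (deg U)]
  res_deg : ∀ {U V : Opens M} (h : V ≤ U) (j : ℤ), ∀ f ∈ deg U j, res h f ∈ deg V j
  gcomm : ∀ (U : Opens M) (i j : ℤ), ∀ a ∈ deg U i, ∀ b ∈ deg U j,
    a * b = (-1 : ℝ) ^ (i * j) • (b * a)
  glue : ∀ (j : ℤ) (S : Set (Opens M)) (s : ∀ V : S, obj V.1), (∀ V : S, s V ∈ deg V.1 j) →
    (∀ V V' : S, res (inf_le_left : V.1 ⊓ V'.1 ≤ V.1) (s V) =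
      res (inf_le_right : V.1 ⊓ V'.1 ≤ V'.1) (s V')) →
    ∃! f : obj (sSup S), f ∈ deg (sSup S) j ∧ ∀ V : S, res (le_sSup V.2) f = s V
  F : ∀ U, ℕ → Submodule ℝ (obj U)
  res_F : ∀ {U V : Opens M} (h : V ≤ U) (n : ℕ), ∀ f ∈ F U n, res h f ∈ F V n
  F_local : ∀ (U : Opens M) (n : ℕ) (f : obj U),
    (∀ x ∈ U, ∃ (V : Opens M) (h : V ≤ U), x ∈ V ∧ res h f ∈ F V n) → f ∈ F U n
  body : ∀ U : Opens M, obj U →ₐ[ℝ] C^∞⟮𝓡 d, U; 𝓘(ℝ, ℝ), ℝ⟯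
  body_res : ∀ {U V : Opens M} (h : V ≤ U) (f : obj U) (x : V),
    body V (res h f) x = body U f ⟨x.1, h x.2⟩
  body_deg : ∀ (U : Opens M) (j : ℤ), j ≠ 0 → ∀ f ∈ deg U j, body U f = 0

attribute [instance] GradedSpace.ring GradedSpace.algebra GradedSpace.graded

variable {d : ℕ} {M : Type u} [TopologicalSpace M] [ChartedSpace (EuclideanSpace ℝ (Fin d)) M]

namespace GradedSpace

variable (O : GradedSpace.{u, v} d M)

/-- An isomorphism over `U` of `O` with the sheaf `V ↦ Γ(V, S̃(⊕ W k))`, compatible with the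
gradings, with the negative filtrations and with the projections to smooth functions. -/
structure Iso (U : Opens M) (W : GradedFamily d M) where
  equiv : ∀ V : Opens M, V ≤ U → (O.obj V ≃ₐ[ℝ] W.sections V)
  natural : ∀ (V V' : Opens M) (hV : V ≤ U) (h : V' ≤ V) (f : O.obj V) (x : V'),
    (equiv V' (h.trans hV) (O.res h f)).1 x = (equiv V hV f).1 ⟨x.1, h x.2⟩
  deg : ∀ (V : Opens M) (hV : V ≤ U) (j : ℤ) (f : O.obj V),
    f ∈ O.deg V j ↔ (equiv V hV f).1 ∈ W.homSections V j
  filt : ∀ (V : Opens M) (hV : V ≤ U) (n : ℕ) (f : O.obj V),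
    f ∈ O.F V n ↔ ∀ x, ∀ m < n, PowerSeries.coeff m ((equiv V hV f).1 x) = 0
  body : ∀ (V : Opens M) (hV : V ≤ U) (f : O.obj V) (x : V),
    O.body V f x = GSym.aug (PowerSeries.coeff 0 ((equiv V hV f).1 x))

/-- The ideal `I` of functions vanishing on `M`: the closure of the ideal generated by the
functions of non-zero degree. -/
noncomputable def I (U : Opens M) : Submodule ℝ (O.obj U) := LinearMap.ker (O.body U).toLinearMap

/-- The ideal `I²`, closed with respect to the negative filtration. -/
noncomputable def Isq (U : Opens M) : Submodule ℝ (O.obj U) := ⨅ n, (O.I U * O.I U ⊔ O.F U n)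

/-- The fibre at `x` of the canonical bundle `E_k`, `k ≠ 0`: the dual of the fibre at `x` of the
sheaf of modules `I_{-k} / I²_{-k}`. An element is a linear functional on germs at `x` of functions
of degree `-k`, extended by zero to the other degrees, which is linear over functions of degree `0`
(acting on `ℝ` through their value at `x`) and vanishes on `I²`. -/
noncomputable def E (k : ℤ) (x : M) :
    Submodule ℝ (∀ U : {U : Opens M // x ∈ U}, O.obj U.1 →ₗ[ℝ] ℝ) where
  carrier := {e | (∀ (U V : {U : Opens M // x ∈ U}) (h : V.1 ≤ U.1) (f : O.obj U.1),
      e V (O.res h f) = e U f) ∧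
    (∀ (U : {U : Opens M // x ∈ U}) (j : ℤ), j ≠ -k → ∀ f ∈ O.deg U.1 j, e U f = 0) ∧
    (∀ (U : {U : Opens M // x ∈ U}), ∀ g ∈ O.deg U.1 0, ∀ f,
      e U (g * f) = O.body U.1 g ⟨x, U.2⟩ * e U f) ∧
    (∀ (U : {U : Opens M // x ∈ U}), ∀ f ∈ O.Isq U.1, e U f = 0)}
  zero_mem' := by simp
  add_mem' := by
    rintro a b ⟨h1, h2, h3, h4⟩ ⟨h1', h2', h3', h4'⟩
    refine ⟨fun U V h f => ?_, fun U j hj f hf => ?_, fun U g hg f => ?_, fun U f hf => ?_⟩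
    · simp [h1 U V h, h1' U V h]
    · simp [h2 U j hj f hf, h2' U j hj f hf]
    · simp [h3 U g hg, h3' U g hg, mul_add]
    · simp [h4 U f hf, h4' U f hf]
  smul_mem' := by
    rintro c a ⟨h1, h2, h3, h4⟩
    refine ⟨fun U V h f => ?_, fun U j hj f hf => ?_, fun U g hg f => ?_, fun U f hf => ?_⟩
    · simp [h1 U V h]
    · simp [h2 U j hj f hf]
    · simp [h3 U g hg, mul_left_comm]
    · simp [h4 U f hf]

/-- The value at `x` of the class in `I_{-k} / I²_{-k}` of a function of degree `-k`, an element of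
the fibre at `x` of `(E_k)*`. -/
noncomputable def cls {U : Opens M} (f : O.obj U) (k : ℤ) (x : U) : Module.Dual ℝ (O.E k x.1) where
  toFun e := e.1 ⟨U, x.2⟩ f
  map_add' _ _ := rfl
  map_smul' _ _ := rfl

/-- The family of bundles `(E_k)*`. A section is smooth if it is locally the class of a
function of degree `-k`, that is, `Γ((E_k)*) = I_{-k} / I²_{-k}`. -/
noncomputable def dualFamily : GradedFamily d M where
  fib k x := Module.Dual ℝ (O.E k.1 x)
  smoothAt k w x := ∃ V : Opens M, x ∈ V ∧ ∃ f ∈ O.deg V (-k.1), ∀ y : V, w y.1 = O.cls f k.1 y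

/-- Smooth sections of `E_k` over `V`: those with smooth pairing with all sections of `(E_k)*`. -/
structure SecE (V : Opens M) (k : ℤ) where
  val : ∀ x : V, O.E k x.1
  smooth : ∀ (W : Opens M) (h : W ≤ V), ∀ f ∈ O.deg W (-k),
    ContMDiff (𝓡 d) 𝓘(ℝ, ℝ) ∞ fun x : W => O.cls f k x (val ⟨x.1, h x.2⟩)

/-- Smooth sections of `(E_k)*` over `V`. -/
structure SecDual (V : Opens M) (k : ℤ) where
  val : ∀ x : V, Module.Dual ℝ (O.E k x.1)
  smooth : ∀ x : V, ∃ (W : Opens M) (h : W ≤ V), x.1 ∈ W ∧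
    ∃ f ∈ O.deg W (-k), ∀ y : W, val ⟨y.1, h y.2⟩ = O.cls f k y

variable {O}

theorem genSec_mem_homSections {V : Opens M} (k : ZStar) (α : O.SecDual V k.1) :
    O.dualFamily.genSec k α.val ∈ O.dualFamily.homSections V (-k.1) := by
  classical
  let w' : ∀ y, Module.Dual ℝ (O.E k.1 y) := fun y => if hy : y ∈ V then α.val ⟨y, hy⟩ else 0
  have hw' : ∀ y (hy : y ∈ V), w' y = α.val ⟨y, hy⟩ := fun y hy => dif_pos hy
  refine O.dualFamily.genSec_mem k α.val fun x => ?_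
  obtain ⟨W, h, hx, f, hf, hα⟩ := α.smooth x
  exact ⟨W, w', hx, fun y hy => ⟨W, hy, f, hf, fun z => (hw' z.1 (h z.2)).trans (hα z)⟩,
    fun y _ => (hw' y.1 y.2).symm⟩

theorem contract_mem {V : Opens M} (k : ZStar) (e : O.SecE V k.1)
    {s : ∀ x : V, O.dualFamily.CSym x.1} (hs : s ∈ O.dualFamily.sections V) :
    O.dualFamily.contract k (fun x => Module.Dual.eval ℝ (O.E k.1 x.1) (e.val x)) s ∈
      O.dualFamily.sections V := by
  classical
  refine O.dualFamily.contract_mem_sections k _ ?_ hs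
  intro V' w hw y hy
  obtain ⟨W, hyW, f, hf, hwf⟩ := hw y hy.1
  have hG := e.smooth (W ⊓ V) inf_le_right (O.res inf_le_left f) (O.res_deg _ _ f hf)
  set G : (W ⊓ V : Opens M) → ℝ := fun x =>
    O.cls (O.res inf_le_left f) k.1 x (e.val ⟨x.1, x.2.2⟩) with hGdef
  refine ⟨fun z => if h : z ∈ W ⊓ V then G ⟨z, h⟩ else 0, ?_, ?_⟩
  · refine (contMDiffAt_subtype_iff (x := (⟨y, hyW, hy.2⟩ : (W ⊓ V : Opens M)))).1
      (hG.contMDiffAt.congr_of_eventuallyEq ?_)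
    refine Filter.Eventually.of_forall fun z => ?_
    simp only [dif_pos z.2]
  · filter_upwards [W.isOpen.mem_nhds hyW] with z hz hzV
    have hz : z ∈ W := hz
    have hzz : z ∈ W ⊓ V := ⟨hz, hzV⟩
    simp only [dif_pos hzz]
    refine Eq.trans (congrArg (Module.Dual.eval ℝ (O.E k.1 z) (e.val ⟨z, hzV⟩)) (hwf ⟨z, hz⟩)) ?_
    exact ((e.val ⟨z, hzV⟩).2.1 ⟨W, hz⟩ ⟨W ⊓ V, hz, hzV⟩ inf_le_left f).symm

namespace Iso

variable {U : Opens M} (Φ : O.Iso U O.dualFamily) {V : Opens M} (hV : V ≤ U)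

/-- The inclusion of smooth functions, as elements of polynomial degree `0`, under `Φ`. -/
noncomputable def const (f : C^∞⟮𝓡 d, V; 𝓘(ℝ, ℝ), ℝ⟯) : O.obj V :=
  (Φ.equiv V hV).symm
    ⟨O.dualFamily.constSec fun x => f x, O.dualFamily.homSections_le V 0
      (O.dualFamily.constSec_mem f)⟩

/-- The inclusion of sections of `(E_k)*`, as elements of polynomial degree `1`, under `Φ`. -/
noncomputable def lin (k : ZStar) (α : O.SecDual V k.1) : O.obj V :=
  (Φ.equiv V hV).symm
    ⟨O.dualFamily.genSec k α.val, O.dualFamily.homSections_le V _ (genSec_mem_homSections k α)⟩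

/-- The contraction `i_e` with a section `e` of `E_k`, under `Φ`. -/
noncomputable def contraction (k : ZStar) (e : O.SecE V k.1) : O.obj V →ₗ[ℝ] O.obj V :=
  (Φ.equiv V hV).symm.toLinearMap ∘ₗ
    ((O.dualFamily.contract k fun x => Module.Dual.eval ℝ (O.E k.1 x.1) (e.val x)).restrict
      (p := Subalgebra.toSubmodule (O.dualFamily.sections V))
      (q := Subalgebra.toSubmodule (O.dualFamily.sections V))
      fun _ hs => contract_mem k e hs) ∘ₗ
    (Φ.equiv V hV).toLinearMap

end Iso

variable (O) in
/-- A splitting of `O` over `U`: an isomorphism of `O` with `Γ(S̃(⊕ (E_k)*))` over `U` which induces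
the identity on smooth functions and on the bundles `(E_k)*`. -/
structure Splitting (U : Opens M) extends O.Iso U O.dualFamily where
  cls_lin : ∀ (V : Opens M) (hV : V ≤ U) (k : ZStar) (α : O.SecDual V k.1) (x : V),
    O.cls (toIso.lin hV k α) k.1 x = α.val x

end GradedSpace

/-- A `ℤ*`-graded manifold with base `M`: locally, its sheaf of functions is the sheaf of sections
of the completed graded symmetric algebra of bundles of finite rank, which after shrinking are
trivial. -/
structure GradedManifold (d : ℕ) (M : Type u) [TopologicalSpace M]
    [ChartedSpace (EuclideanSpace ℝ (Fin d)) M] extends GradedSpace.{u, v} d M where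
  locally_split : ∀ x : M, ∃ U : Opens M, x ∈ U ∧ ∃ r : ZStar → ℕ,
    Nonempty (toGradedSpace.Iso U (trivialFamily d M r))

/-- A `Q`-structure: a vector field `Q` of degree `+1` (a derivation of the sheaf of functions, which
is continuous in that it lowers the negative filtration by at most one) with
`[Q, Q] = 2 Q² = 0`. -/
structure QStructure (O : GradedManifold.{u, v} d M) where
  Q : ∀ U : Opens M, O.obj U →ₗ[ℝ] O.obj U
  res : ∀ {U V : Opens M} (h : V ≤ U) (f : O.obj U), Q V (O.res h f) = O.res h (Q U f)
  deg : ∀ (U : Opens M) (j : ℤ), ∀ f ∈ O.deg U j, Q U f ∈ O.deg U (j + 1)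
  leibniz : ∀ (U : Opens M) (j : ℤ), ∀ f ∈ O.deg U j, ∀ g,
    Q U (f * g) = Q U f * g + (-1 : ℝ) ^ j • (f * Q U g)
  filt : ∀ (U : Opens M) (n : ℕ), ∀ f ∈ O.F U (n + 1), Q U f ∈ O.F U n
  square : ∀ (U : Opens M) (f : O.obj U), Q U (Q U f) = 0

namespace GradedManifold

variable (O : GradedManifold.{u, v} d M)

theorem body_F {U : Opens M} {f : O.obj U} (hf : f ∈ O.F U 1) : O.body U f = 0 := by
  ext x
  obtain ⟨W, hx, r, ⟨Φ⟩⟩ := O.locally_split x.1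
  have h := (Φ.filt (U ⊓ W) inf_le_right 1 _).1 (O.res_F (inf_le_left : U ⊓ W ≤ U) 1 f hf)
    ⟨x.1, x.2, hx⟩ 0 one_pos
  have h2 := O.body_res (inf_le_left : U ⊓ W ≤ U) f ⟨x.1, x.2, hx⟩
  rw [Φ.body _ inf_le_right, h] at h2
  simpa using h2.symm

end GradedManifold

namespace QStructure

variable {O : GradedManifold.{u, v} d M} (D : QStructure O)

theorem body_Q_mul (U : Opens M) (f g : O.obj U) :
    O.body U (D.Q U (f * g)) = O.body U (D.Q U f) * O.body U g + O.body U f * O.body U (D.Q U g) := by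
  induction f using DirectSum.Decomposition.inductionOn (O.deg U) with
  | zero => simp
  | @homogeneous j f =>
    rw [D.leibniz U j f f.2]
    by_cases hj : j = 0
    · subst hj; simp
    · simp [O.body_deg U j hj f f.2]
  | add a b ha hb =>
    simp only [add_mul, map_add, ha, hb]
    ring

/-- The curvature `κ`, the section of `E_{+1}` induced by `f ↦ (Q f) mod I` for `f` of degree
`-1`. -/
noncomputable def curvature (x : M) : O.E 1 x :=
  ⟨fun U => { toFun := fun f => O.body U.1 (D.Q U.1 f) ⟨x, U.2⟩
              map_add' := by simp
              map_smul' := by simp }, by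
    refine ⟨fun U V h f => ?_, fun U j hj f hf => ?_, fun U g hg f => ?_, fun U f hf => ?_⟩
    · simp [D.res h, O.body_res h]
    · have h : j + 1 ≠ 0 := by omega
      simp [O.body_deg _ _ h _ (D.deg _ _ _ hf)]
    · have h : O.body U.1 (D.Q U.1 g) = 0 := O.body_deg _ _ (by norm_num) _ (D.deg _ _ _ hg)
      simp [D.body_Q_mul, h]
    · have h1 := (Submodule.mem_iInf _).1 hf 2
      obtain ⟨a, ha, b, hb, rfl⟩ := Submodule.mem_sup.1 h1
      have hb : O.body U.1 (D.Q U.1 b) = 0 := O.body_F (D.filt _ _ _ hb)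
      have ha : O.body U.1 (D.Q U.1 a) = 0 := by
        refine Submodule.mul_induction_on ha (fun g hg h hh => ?_) (fun g h hg hh => ?_)
        · have hg : O.body U.1 g = 0 := hg
          have hh : O.body U.1 h = 0 := hh
          simp [D.body_Q_mul, hg, hh]
        · simp [hg, hh]
      simp [ha, hb]⟩

/-- The curvature, as a smooth section of `E_{+1}` over `V`. -/
noncomputable def curvatureSec (V : Opens M) : O.SecE V 1 :=
  ⟨fun x => D.curvature x.1, fun W _ f _ => (O.body W (D.Q W f)).contMDiff⟩

variable {U : Opens M} (Φ : O.Splitting U) {V : Opens M} (hV : V ≤ U)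

/-- For homogeneous sections `e₁, …, e_n` of `⊕ E_k` over `V`, the iterated graded commutator
`[…[[Q, i_{e₁}], i_{e₂}], …, i_{e_n}]`, together with its degree. -/
noncomputable def commutator (es : List (Σ k : ZStar, O.SecE V k.1)) :
    ℤ × (O.obj V →ₗ[ℝ] O.obj V) :=
  es.foldl (fun P e => (P.1 + e.1.1, P.2 ∘ₗ Φ.contraction hV e.1 e.2 -
    (-1 : ℝ) ^ (P.1 * e.1.1) • (Φ.contraction hV e.1 e.2 ∘ₗ P.2))) (1, D.Q V)

/-- The `n`-ary bracket `ℓ_n(e₁, …, e_n)` of the Lie `∞`-algebroid dual to `Q` in the splitting `Φ`,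
as a functional on sections `α` of `(E_k)*`: the pairing `⟨ℓ_n(e₁, …, e_n), α⟩` is the projection to
smooth functions of `[…[Q, i_{e₁}], …, i_{e_n}] α`. -/
noncomputable def bracket (es : List (Σ k : ZStar, O.SecE V k.1)) (k : ZStar)
    (α : O.SecDual V k.1) : C^∞⟮𝓡 d, V; 𝓘(ℝ, ℝ), ℝ⟯ :=
  O.body V ((D.commutator Φ hV es).2 (Φ.lin hV k α))

/-- The `n`-ary anchor `ρ_n(e₁, …, e_n)[f]` of the Lie `∞`-algebroid dual to `Q` in the splitting
`Φ`: the projection to smooth functions of `[…[Q, i_{e₁}], …, i_{e_n}] f`. -/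
noncomputable def anchor (es : List (Σ k : ZStar, O.SecE V k.1))
    (f : C^∞⟮𝓡 d, V; 𝓘(ℝ, ℝ), ℝ⟯) : C^∞⟮𝓡 d, V; 𝓘(ℝ, ℝ), ℝ⟯ :=
  O.body V ((D.commutator Φ hV es).2 (Φ.const hV f))

end QStructure
end Manifolds
end GradedQ

/-! Call a degree-zero vector field `ε` an Euler field if it acts by `p` on `I^p / I^(p+1)`. The
proof finds one over `U` with `[Q, ε] = Q`, and reads the splitting off it.

An Euler field determines a splitting. If `f = ∑ f_q` with `ε f_q = q f_q`, then the binomial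
operator `binom(ε, p) = ε(ε-1)⋯(ε-p+1)/p!` sends `f` to `∑ C(q,p) f_q`, which lies in `I^p` and
equals `f_p` modulo `I^(p+1)`. The symbol of order `p` of an element of `I^p` (up to the negative
filtration) does not depend on a splitting (`Iso.Adapted.bicoeff_eq`). So the symbol of `binom(ε, p)
f` can serve as the component of `f` of polynomial degree `p`, without solving any eigenvalue
equation. This map is multiplicative by the Vandermonde identity (`binom_mul`). It is bijective
because it has the same leading terms as any local splitting and, in fixed total and negative
degree, only finitely many polynomial degrees occur (`GSym.length_le`).

In this splitting `Q` is the contraction with `κ`. The relation `Qε = (ε+1)Q` and Pascal's rule give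
`Q binom(ε, p+1) = (binom(ε, p+1) + binom(ε, p)) Q` (`Q_binom`), and the symbol of `Q : I^(p+1) →
I^p` is the contraction with `κ` (`bicoeff_Q`). Comparing symbols of order `p` gives the claim
(`glob_Q`). The vanishing of brackets and anchors follows, since contractions commute in the graded
sense.

Existence of `ε`. Near a point where `κ ≠ 0` some `f` of degree `-1` has `Q f` invertible. The
inverse `g` is `Q`-closed, so `θ = f g` satisfies `Q θ = 1`. Given any local Euler field with defect
`δ = [Q, ε] - Q`, one has `[Q, δ] = 0`, so `ε - θ δ` satisfies the required relation
(`Q_corrected`). To globalize, a partition of unity `ρ_i` is lifted to `Q`-closed functions `X_i =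
c_i - θ_i Q c_i` of body `ρ_i`. Multiplication by a closed function of degree zero commutes with
`Q`, so the weighted average `(∑ X_i)⁻¹ ∑ X_i ε_i` keeps the relation and is again an Euler field
(`Q_average`).

The initial local Euler fields come from the local models. These are first rewritten in terms of the
canonical bundles, whose fibres are defined by functionals on germs, so that duality with the model
fibres has to be proved (`bijective_pairing`, `adapted_canonical`). -/

namespace GradedQ

/-! ### Polynomial degree and bidegree in the graded symmetric algebra. -/

namespace GSym

universe v v'
variable {W : ZStar → Type v} [∀ k, AddCommGroup (W k)] [∀ k, Module ℝ (W k)]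
variable {W' : ZStar → Type v'} [∀ k, AddCommGroup (W' k)] [∀ k, Module ℝ (W' k)]

/-- The product of a list of generators. -/
noncomputable def prodι (l : List (Σ k, W k)) : GSym W := (l.map fun w => ι W w.1 w.2).prod

@[simp] theorem prodι_nil : prodι ([] : List (Σ k, W k)) = 1 := rfl

@[simp] theorem prodι_cons (w : Σ k, W k) (l : List (Σ k, W k)) :
    prodι (w :: l) = ι W w.1 w.2 * prodι l := by simp [prodι]

theorem prodι_append (l l' : List (Σ k, W k)) : prodι (l ++ l') = prodι l * prodι l' := by
  simp [prodι]

theorem span_prodι : Submodule.span ℝ (Set.range (prodι (W := W))) = ⊤ := by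
  refine eq_top_iff.2 fun a _ => ?_
  induction a using induction with
  | hs c =>
    rw [Algebra.algebraMap_eq_smul_one]
    exact Submodule.smul_mem _ _ (Submodule.subset_span ⟨[], rfl⟩)
  | hι k v => exact Submodule.subset_span ⟨[⟨k, v⟩], by simp⟩
  | hm a b ha hb =>
    have h := Submodule.mul_mem_mul (ha trivial) (hb trivial)
    rw [Submodule.span_mul_span] at h
    refine Submodule.span_mono ?_ h
    rintro _ ⟨_, ⟨l, rfl⟩, _, ⟨l', rfl⟩, rfl⟩
    exact ⟨l ++ l', prodι_append l l'⟩
  | ha a b ha hb => exact Submodule.add_mem _ (ha trivial) (hb trivial)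

theorem induction_prodι {P : GSym W → Prop} (hl : ∀ l, P (prodι l))
    (hs : ∀ (c : ℝ) a, P a → P (c • a)) (ha : ∀ a b, P a → P b → P (a + b)) (a : GSym W) : P a := by
  have h : a ∈ Submodule.span ℝ (Set.range (prodι (W := W))) := by rw [span_prodι]; trivial
  induction h using Submodule.span_induction with
  | mem x hx => obtain ⟨l, rfl⟩ := hx; exact hl l
  | zero => simpa using hs 0 _ (hl [])
  | add x y _ _ hx hy => exact ha _ _ hx hy
  | smul c x _ hx => exact hs _ _ hx

/-- The decomposition by polynomial degree, recorded by the exponent of a formal variable. -/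
noncomputable def pol : GSym W →ₐ[ℝ] PowerSeries (GSym W) :=
  lift (fun k => ((PowerSeries.monomial (R := GSym W) 1).restrictScalars ℝ).comp (ι W k)) (by
    intro k l v w
    simp only [LinearMap.comp_apply, LinearMap.restrictScalars_apply,
      PowerSeries.monomial_mul_monomial, ι_mul_ι W k l v w]
    ext n
    simp [PowerSeries.coeff_monomial])

theorem pol_prodι (l : List (Σ k, W k)) :
    pol (prodι l) = PowerSeries.monomial l.length (prodι l) := by
  induction l with
  | nil => simp [PowerSeries.monomial_zero_eq_C_apply]
  | cons w l ih =>
    rw [prodι_cons, map_mul, ih, pol, lift_ι]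
    simp [PowerSeries.monomial_mul_monomial, add_comm]

/-- The part of polynomial degree `p`. -/
noncomputable def comp (p : ℕ) : GSym W →ₗ[ℝ] GSym W :=
  ((PowerSeries.coeff (R := GSym W) p).restrictScalars ℝ).comp pol.toLinearMap

theorem coeff_pol (p : ℕ) (a : GSym W) : PowerSeries.coeff p (pol a) = comp p a := rfl

theorem comp_prodι (p : ℕ) (l : List (Σ k, W k)) :
    comp p (prodι l) = if p = l.length then prodι l else 0 := by
  rw [← coeff_pol, pol_prodι, PowerSeries.coeff_monomial]

theorem comp_mul (p : ℕ) (a b : GSym W) :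
    comp p (a * b) = ∑ q ∈ Finset.HasAntidiagonal.antidiagonal p, comp q.1 a * comp q.2 b := by
  simp only [← coeff_pol, map_mul, PowerSeries.coeff_mul]

theorem comp_comp (p q : ℕ) (a : GSym W) : comp p (comp q a) = if p = q then comp p a else 0 := by
  induction a using induction_prodι with
  | hl l =>
    simp only [comp_prodι]
    split_ifs <;> simp_all [comp_prodι]
  | hs c a h => simp only [map_smul, h]; split_ifs <;> simp
  | ha a b h h' => simp only [map_add, h, h']; split_ifs <;> simp

theorem sum_comp (a : GSym W) : ∃ N, ∀ n, N ≤ n → ∑ p ∈ Finset.range n, comp p a = a := by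
  induction a using induction_prodι with
  | hl l =>
    refine ⟨l.length + 1, fun n hn => ?_⟩
    simp only [comp_prodι]
    rw [Finset.sum_ite_eq']
    simp; omega
  | hs c a h =>
    obtain ⟨N, h⟩ := h
    exact ⟨N, fun n hn => by simp only [map_smul, ← Finset.smul_sum, h n hn]⟩
  | ha a b h h' =>
    obtain ⟨N, h⟩ := h
    obtain ⟨N', h'⟩ := h'
    exact ⟨max N N', fun n hn => by
      simp only [map_add, Finset.sum_add_distrib, h n (le_of_max_le_left hn),
        h' n (le_of_max_le_right hn)]⟩

/-- Elements are finite sums of their components, although the components are extracted from a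
formal series. -/
theorem ext_comp {a b : GSym W} (h : ∀ p, comp p a = comp p b) : a = b := by
  obtain ⟨N, hN⟩ := sum_comp a
  obtain ⟨N', hN'⟩ := sum_comp b
  rw [← hN _ (le_max_left N N'), ← hN' _ (le_max_right N N')]
  exact Finset.sum_congr rfl fun p _ => h p

theorem aug_prodι (l : List (Σ k, W k)) : aug (prodι l) = if l = [] then 1 else 0 := by
  cases l with
  | nil => simp
  | cons w l => simp [aug]

@[simp] theorem aug_ι (k : ZStar) (w : W k) : aug (ι W k w) = 0 := by simp [aug]

theorem comp_zero (a : GSym W) : comp 0 a = algebraMap ℝ _ (aug a) := by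
  induction a using induction_prodι with
  | hl l => cases l <;> simp only [comp_prodι, aug_prodι] <;> simp
  | hs c a h => rw [map_smul, map_smul, h, Algebra.smul_def, smul_eq_mul, map_mul]
  | ha a b h h' => simp [h, h']

theorem aug_comp (p : ℕ) (a : GSym W) : aug (comp p a) = if p = 0 then aug a else 0 := by
  induction a using induction_prodι with
  | hl l =>
    rw [comp_prodι]
    split_ifs with h h' h'
    · rfl
    · rw [aug_prodι, if_neg]
      rintro rfl
      exact h' h
    · rw [map_zero, aug_prodι, if_neg]
      rintro rfl
      exact h h'
    · simp
  | hs c a h => simp [h]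
  | ha a b h h' => simp only [map_add, h, h']; split_ifs <;> simp

theorem comp_ι_mul_succ (p : ℕ) (k : ZStar) (w : W k) (a : GSym W) :
    comp (p + 1) (ι W k w * a) = ι W k w * comp p a := by
  induction a using induction_prodι with
  | hl l =>
    rw [← prodι_cons ⟨k, w⟩ l]
    simp only [comp_prodι, List.length_cons, add_left_inj]
    split_ifs <;> simp
  | hs c a h => simp [h]
  | ha a b h h' => simp [h, h', mul_add]

theorem comp_ι_mul_zero (k : ZStar) (w : W k) (a : GSym W) :
    comp 0 (ι W k w * a) = 0 := by
  simp [comp_zero]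

theorem comp_ι (p : ℕ) (k : ZStar) (w : W k) :
    comp p (ι W k w) = if p = 1 then ι W k w else 0 := by
  have := comp_prodι p [(⟨k, w⟩ : Σ k, W k)]
  simpa using this

theorem comp_contract (p : ℕ) (k : ZStar) (φ : W k →ₗ[ℝ] ℝ) (a : GSym W) :
    comp p (contract k φ a) = contract k φ (comp (p + 1) a) := by
  induction a using induction_prodι with
  | hl l =>
    induction l generalizing p with
    | nil => rw [comp_prodι, if_neg (by simp)]; simp
    | cons w l ih =>
      rw [prodι_cons, contract_ι_mul, comp_ι_mul_succ, contract_ι_mul]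
      simp only [map_add, map_smul]
      congr 2
      cases p with
      | zero => rw [comp_ι_mul_zero, comp_zero, Algebra.algebraMap_eq_smul_one]; simp
      | succ p => rw [comp_ι_mul_succ, ih]
  | hs c a h => simp [h]
  | ha a b h h' => simp [h, h']

/-- Contractions are graded derivations, so their graded commutator is one too, and it kills the
generators. The induction on words makes this explicit. It is what makes all higher brackets vanish
in the end. -/
theorem contract_contract (k l : ZStar) (φ : W k →ₗ[ℝ] ℝ) (ψ : W l →ₗ[ℝ] ℝ) (a : GSym W) :
    contract k φ (contract l ψ a) =
      (-1 : ℝ) ^ (k.1 * l.1) • contract l ψ (contract k φ a) := by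
  induction a using induction_prodι with
  | hl L =>
    induction L with
    | nil => simp
    | cons w L ih =>
      rw [prodι_cons]
      -- The value of the extended functional on the first letter is nonzero only when the indices
      -- agree, and then the two signs cancel.
      have h1 : ∀ (k l : ZStar) (ψ : W l →ₗ[ℝ] ℝ), (-1 : ℝ) ^ (k.1 * l.1) * (-1 : ℝ) ^ (k.1 * w.1.1) *
          extend l ψ w.1 w.2 = extend l ψ w.1 w.2 := by
        intro k l ψ
        by_cases h : l = w.1
        · have h' : l.1 = w.1.1 := congrArg Subtype.val h
          rw [h', ← mul_zpow]; simp
        · simp [extend_ne ψ h]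
      have h2 : (-1 : ℝ) ^ (k.1 * l.1) * extend k φ w.1 w.2 =
          (-1 : ℝ) ^ (l.1 * w.1.1) * extend k φ w.1 w.2 := by
        conv_rhs => rw [← h1 l k φ, ← mul_assoc, ← mul_assoc, mul_comm (_ ^ _) (_ ^ _), mul_assoc (_ ^ _),
          ← mul_zpow]
        simp [mul_comm]
      simp only [contract_ι_mul, map_add, map_smul, ih, smul_add, mul_smul_comm, smul_smul, h2]
      have h3 := h1 k l ψ
      rw [mul_assoc] at h3
      rw [h3]
      module
  | hs c a h => simp only [map_smul, h]; rw [smul_comm]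
  | ha a b h h' => simp [h, h']

theorem contract_ι (k : ZStar) (φ : W k →ₗ[ℝ] ℝ) (l : ZStar) (w : W l) :
    contract k φ (ι W l w) = algebraMap ℝ _ (extend k φ l w) := by
  have := contract_ι_mul k φ l w 1
  simpa [Algebra.algebraMap_eq_smul_one] using this

/-- Contraction with a functional recovers its value on a generator, and functionals separate
points. -/
theorem ι_injective (k : ZStar) : Function.Injective (ι W k) := by
  refine (injective_iff_map_eq_zero _).2 fun w hw => ?_
  refine (Module.forall_dual_apply_eq_zero_iff ℝ w).1 fun φ => ?_
  have h := congrArg aug (contract_ι k φ k w)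
  simpa [hw, extend_same] using h.symm

/-- The Koszul sign drops out: it multiplies `aug a`, which vanishes on every nonempty word. -/
theorem aug_contract_mul (k : ZStar) (φ : W k →ₗ[ℝ] ℝ) (a b : GSym W) :
    aug (contract k φ (a * b)) = aug (contract k φ a) * aug b + aug a * aug (contract k φ b) := by
  induction a using induction_prodι with
  | hl l =>
    induction l generalizing b with
    | nil => simp
    | cons w l ih =>
      simp only [prodι_cons, mul_assoc, contract_ι_mul]
      simp [mul_assoc]
  | hs c a h => simp [h, mul_add, mul_assoc]
  | ha a b h h' => simp [h, h', add_mul]; ring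

/-- The morphism of graded symmetric algebras induced by linear maps. -/
noncomputable def map (L : ∀ k, W k →ₗ[ℝ] W' k) : GSym W →ₐ[ℝ] GSym W' :=
  lift (fun k => (ι W' k).comp (L k)) fun k l v w => ι_mul_ι W' k l (L k v) (L l w)

@[simp] theorem map_ι (L : ∀ k, W k →ₗ[ℝ] W' k) (k : ZStar) (w : W k) :
    map L (ι W k w) = ι W' k (L k w) := by simp [map]

theorem map_prodι (L : ∀ k, W k →ₗ[ℝ] W' k) (l : List (Σ k, W k)) :
    map L (prodι l) = prodι (l.map fun w => ⟨w.1, L w.1 w.2⟩) := by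
  induction l with
  | nil => simp
  | cons w l ih => simp [ih]

theorem comp_map (p : ℕ) (L : ∀ k, W k →ₗ[ℝ] W' k) (a : GSym W) :
    comp p (map L a) = map L (comp p a) := by
  induction a using induction_prodι with
  | hl l =>
    simp only [map_prodι, comp_prodι, List.length_map]
    split_ifs
    · rw [map_prodι]
    · simp
  | hs c a h => simp [h]
  | ha a b h h' => simp [h, h']

theorem aug_map (L : ∀ k, W k →ₗ[ℝ] W' k) (a : GSym W) : aug (map L a) = aug a := by
  induction a using induction_prodι with
  | hl l => simp [map_prodι, aug_prodι]
  | hs c a h => simp [h]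
  | ha a b h h' => simp [h, h']

theorem map_map_of_leftInverse {L : ∀ k, W k →ₗ[ℝ] W' k} {L' : ∀ k, W' k →ₗ[ℝ] W k}
    (h : ∀ k w, L' k (L k w) = w) (a : GSym W) : map L' (map L a) = a := by
  induction a using induction with
  | hs c => simp
  | hι k w => simp [h]
  | hm a b ha hb => simp [ha, hb]
  | ha a b ha hb => simp [ha, hb]

/-! ### Bidegrees -/

variable (W) in
/-- The part of total degree `j` and negative degree `n`. -/
noncomputable def bideg (j : ℤ) (n : ℕ) : Submodule ℝ (GSym W) :=
  Submodule.span ℝ {a | ∃ l : List (Σ k, W k), (l.map fun w => -w.1.1).sum = j ∧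
    (l.map fun w => w.1.1.toNat).sum = n ∧ a = prodι l}

-- A letter of index `k` contributes `-k + 2 max(k, 0) = |k| ≥ 1`. Hence total and negative degree
-- together bound the polynomial degree, which makes every sum over polynomial degrees below finite.
omit [∀ k, AddCommGroup (W k)] [∀ k, Module ℝ (W k)] in
theorem length_le (l : List (Σ k, W k)) :
    (l.length : ℤ) ≤ (l.map fun w => -w.1.1).sum + 2 * ((l.map fun w => w.1.1.toNat).sum : ℕ) := by
  induction l with
  | nil => simp
  | cons w l ih =>
    simp only [List.length_cons, List.map_cons, List.sum_cons]
    have := w.1.2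
    rw [Nat.cast_add, Nat.cast_add]
    omega

-- Letterwise `k ≤ max(k, 0)`. The case of interest is total degree `-1`, which forces negative
-- degree at least one.
omit [∀ k, AddCommGroup (W k)] [∀ k, Module ℝ (W k)] in
theorem neg_sum_le (l : List (Σ k, W k)) :
    -(l.map fun w => -w.1.1).sum ≤ ((l.map fun w => w.1.1.toNat).sum : ℕ) := by
  induction l with
  | nil => simp
  | cons w l ih =>
    simp only [List.map_cons, List.sum_cons]
    rw [Nat.cast_add]
    omega

theorem bideg_induction {j : ℤ} {n : ℕ} {P : GSym W → Prop} (h0 : P 0)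
    (hl : ∀ l : List (Σ k, W k), (l.map fun w => -w.1.1).sum = j →
      (l.map fun w => w.1.1.toNat).sum = n → P (prodι l))
    (hs : ∀ (c : ℝ) a, P a → P (c • a)) (ha : ∀ a b, P a → P b → P (a + b)) {a : GSym W}
    (h : a ∈ bideg W j n) : P a := by
  induction h using Submodule.span_induction with
  | mem x hx => obtain ⟨l, h1, h2, rfl⟩ := hx; exact hl l h1 h2
  | zero => exact h0
  | add x y _ _ hx hy => exact ha _ _ hx hy
  | smul c x _ hx => exact hs _ _ hx

theorem comp_eq_zero_of_bideg {j : ℤ} {n : ℕ} {a : GSym W} (h : a ∈ bideg W j n) {p : ℕ}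
    (hp : j + 2 * n < p) : comp p a = 0 := by
  refine bideg_induction (P := fun a => comp p a = 0) (by simp) (fun l h1 h2 => ?_)
    (fun c a h => by simp [h]) (fun a b h h' => by simp [h, h']) h
  have := length_le l
  rw [comp_prodι, if_neg]
  rintro rfl
  rw [h1, h2] at this
  omega

theorem eq_zero_of_bideg {j : ℤ} {n : ℕ} {a : GSym W} (h : a ∈ bideg W j n)
    (hj : (n : ℤ) < -j) : a = 0 := by
  refine bideg_induction (P := fun a => a = 0) rfl (fun l h1 h2 => ?_)
    (fun c a h => by simp [h]) (fun a b h h' => by simp [h, h']) h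
  have := neg_sum_le l
  rw [h1, h2] at this
  omega

theorem aug_eq_zero_of_bideg {j : ℤ} {n : ℕ} {a : GSym W} (h : a ∈ bideg W j n)
    (hn : j ≠ 0 ∨ n ≠ 0) : aug a = 0 := by
  refine bideg_induction (P := fun a => aug a = 0) (by simp) (fun l h1 h2 => ?_)
    (fun c a h => by simp [h]) (fun a b h h' => by simp [h, h']) h
  rw [aug_prodι, if_neg]
  rintro rfl
  simp at h1 h2
  omega

/-- By `length_le`, words of bidegree `(0, 0)` are empty. -/
theorem eq_algebraMap_of_bideg {a : GSym W} (h : a ∈ bideg W 0 0) :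
    a = algebraMap ℝ _ (aug a) := by
  rw [← comp_zero]
  refine ext_comp fun p => ?_
  rw [comp_comp]
  split_ifs with hp
  · rfl
  · exact comp_eq_zero_of_bideg h (by omega)

/-- A word with one letter of index `k` has bidegree `(-k, max(k, 0))`, so the total degree already
determines `k`. -/
theorem comp_one_of_bideg {j : ℤ} {n : ℕ} {a : GSym W} (h : a ∈ bideg W j n) :
    comp 1 a = 0 ∨ ∃ (k : ZStar) (w : W k), j = -k.1 ∧ n = k.1.toNat ∧ comp 1 a = ι W k w := by
  by_cases hk : ∃ k : ZStar, j = -k.1 ∧ n = k.1.toNat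
  · obtain ⟨k, rfl, rfl⟩ := hk
    right
    refine ⟨k, ?_⟩
    suffices ∃ w, comp 1 a = ι W k w by
      obtain ⟨w, hw⟩ := this
      exact ⟨w, rfl, rfl, hw⟩
    refine bideg_induction (P := fun a => ∃ w, comp 1 a = ι W k w) ⟨0, by simp⟩
      (fun l h1 h2 => ?_) ?_ ?_ h
    · by_cases hl : l.length = 1
      · obtain ⟨⟨m, w⟩, rfl⟩ := List.length_eq_one_iff.1 hl
        simp at h1
        obtain rfl : m = k := Subtype.ext h1
        exact ⟨w, by simp [comp_ι]⟩
      · exact ⟨0, by rw [comp_prodι, if_neg (Ne.symm hl)]; simp⟩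
    · rintro c a ⟨w, hw⟩
      exact ⟨c • w, by simp [hw]⟩
    · rintro a b ⟨w, hw⟩ ⟨w', hw'⟩
      exact ⟨w + w', by simp [hw, hw']⟩
  · left
    refine bideg_induction (P := fun a => comp 1 a = 0) (by simp) (fun l h1 h2 => ?_)
      (fun c a h => by simp [h]) (fun a b h h' => by simp [h, h']) h
    rw [comp_prodι, if_neg]
    intro hl
    obtain ⟨⟨m, w⟩, rfl⟩ := List.length_eq_one_iff.1 hl.symm
    exact hk ⟨m, by simpa using h1.symm, by simpa using h2.symm⟩

end GSym
end GradedQ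

/-! ### Bigraded components of formal series, orders of vanishing, Euler derivation and contraction.
-/

namespace GradedQ

namespace GSym

universe v v'
variable {W : ZStar → Type v} [∀ k, AddCommGroup (W k)] [∀ k, Module ℝ (W k)]
variable {W' : ZStar → Type v'} [∀ k, AddCommGroup (W' k)] [∀ k, Module ℝ (W' k)]

theorem finite_comp (a : GSym W) : {p | comp p a ≠ 0}.Finite := by
  obtain ⟨N, hN⟩ := sum_comp a
  refine (Set.finite_lt_nat N).subset fun p hp => ?_
  by_contra h
  refine hp ?_
  rw [← hN N le_rfl, map_sum]
  refine Finset.sum_eq_zero fun q hq => ?_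
  rw [comp_comp, if_neg]
  rintro rfl
  exact h (Finset.mem_range.1 hq)

/-- The Euler derivation, which multiplies by the polynomial degree. -/
noncomputable def euler : GSym W →ₗ[ℝ] GSym W where
  toFun a := ∑ᶠ p : ℕ, (p : ℝ) • comp p a
  map_add' a b := by
    simp only [map_add, smul_add]
    refine finsum_add_distrib ((finite_comp a).subset ?_) ((finite_comp b).subset ?_) <;>
    · intro p hp h
      simp [h] at hp
  map_smul' c a := by
    simp only [map_smul, RingHom.id_apply, smul_finsum]
    exact finsum_congr fun p => smul_comm _ _ _

theorem euler_prodι (l : List (Σ k, W k)) : euler (prodι l) = (l.length : ℝ) • prodι l := by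
  change ∑ᶠ p : ℕ, (p : ℝ) • comp p (prodι l) = _
  rw [finsum_eq_single _ l.length, comp_prodι, if_pos rfl]
  intro p hp
  rw [comp_prodι, if_neg hp, smul_zero]

theorem comp_euler (p : ℕ) (a : GSym W) : comp p (euler a) = (p : ℝ) • comp p a := by
  induction a using induction_prodι with
  | hl l =>
    rw [euler_prodι, map_smul, comp_prodι]
    split_ifs with h
    · rw [h]
    · simp
  | hs c a h => simp only [map_smul, h]; rw [smul_comm]
  | ha a b h h' => simp only [map_add, h, h', smul_add]

/-- The part of polynomial degree `p` and negative degree `n` of a formal series. -/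
noncomputable def bicoeff (p n : ℕ) : PowerSeries (GSym W) →ₗ[ℝ] GSym W :=
  (comp p).comp ((PowerSeries.coeff (R := GSym W) n).restrictScalars ℝ)

theorem bicoeff_apply (p n : ℕ) (a : PowerSeries (GSym W)) :
    bicoeff p n a = comp p (PowerSeries.coeff n a) := rfl

theorem ext_bicoeff {a b : PowerSeries (GSym W)} (h : ∀ p n, bicoeff p n a = bicoeff p n b) :
    a = b :=
  PowerSeries.ext fun n => ext_comp fun p => h p n

theorem bicoeff_mul (p n : ℕ) (a b : PowerSeries (GSym W)) :
    bicoeff p n (a * b) = ∑ i ∈ Finset.HasAntidiagonal.antidiagonal n,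
      ∑ q ∈ Finset.HasAntidiagonal.antidiagonal p, bicoeff q.1 i.1 a * bicoeff q.2 i.2 b := by
  simp only [bicoeff_apply, PowerSeries.coeff_mul, map_sum, comp_mul]

/-- The parts of polynomial degree `< p` and negative degree `< n` vanish. -/
def Vanish (p n : ℕ) (a : PowerSeries (GSym W)) : Prop := ∀ q < p, ∀ m < n, bicoeff q m a = 0

theorem Vanish.add {p n : ℕ} {a b : PowerSeries (GSym W)} (ha : Vanish p n a) (hb : Vanish p n b) :
    Vanish p n (a + b) := fun q hq m hm => by rw [map_add, ha q hq m hm, hb q hq m hm, add_zero]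

theorem Vanish.mono {p p' n n' : ℕ} {a : PowerSeries (GSym W)} (ha : Vanish p n a) (hp : p' ≤ p)
    (hn : n' ≤ n) : Vanish p' n' a :=
  fun q hq m hm => ha q (hq.trans_le hp) m (hm.trans_le hn)

theorem vanish_zero_left (n : ℕ) (a : PowerSeries (GSym W)) : Vanish 0 n a :=
  fun _ hq => absurd hq (Nat.not_lt_zero _)

theorem Vanish.mul {p p' n : ℕ} {a b : PowerSeries (GSym W)} (ha : Vanish p n a)
    (hb : Vanish p' n b) : Vanish (p + p') n (a * b) := by
  intro q hq m hm
  rw [bicoeff_mul]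
  refine Finset.sum_eq_zero fun i hi => Finset.sum_eq_zero fun r hr => ?_
  have h1 := Finset.HasAntidiagonal.mem_antidiagonal.1 hi
  have h2 := Finset.HasAntidiagonal.mem_antidiagonal.1 hr
  by_cases h : r.1 < p
  · rw [ha _ h _ (by omega), zero_mul]
  · rw [hb _ (by omega) _ (by omega), mul_zero]

/-- Leading symbols multiply: any other splitting of `p + p'` makes one of the two polynomial
degrees too small. The negative degrees still convolve. -/
theorem Vanish.bicoeff_mul {p p' n m : ℕ} {a b : PowerSeries (GSym W)} (ha : Vanish p n a)
    (hb : Vanish p' n b) (hm : m < n) : bicoeff (p + p') m (a * b) =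
      ∑ i ∈ Finset.HasAntidiagonal.antidiagonal m, bicoeff p i.1 a * bicoeff p' i.2 b := by
  rw [GSym.bicoeff_mul]
  refine Finset.sum_congr rfl fun i hi => ?_
  have h1 := Finset.HasAntidiagonal.mem_antidiagonal.1 hi
  refine Finset.sum_eq_single (p, p') (fun r hr hne => ?_) fun h => ?_
  · have h2 := Finset.HasAntidiagonal.mem_antidiagonal.1 hr
    rcases lt_trichotomy r.1 p with h | h | h
    · rw [ha _ h _ (by omega), zero_mul]
    · exact absurd (Prod.ext h (by simp only; omega)) hne
    · rw [hb _ (by omega) _ (by omega), mul_zero]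
  · exact absurd (Finset.HasAntidiagonal.mem_antidiagonal.2 (rfl : (p, p').1 + (p, p').2 = _)) h

/-- The Euler derivation on formal series. -/
noncomputable def eulerSeries : PowerSeries (GSym W) →ₗ[ℝ] PowerSeries (GSym W) where
  toFun a := PowerSeries.mk fun n => euler (PowerSeries.coeff n a)
  map_add' a b := by ext n; simp
  map_smul' c a := by ext n; simp

theorem bicoeff_eulerSeries (p n : ℕ) (a : PowerSeries (GSym W)) :
    bicoeff p n (eulerSeries a) = (p : ℝ) • bicoeff p n a := by
  simp [bicoeff_apply, eulerSeries, comp_euler]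

/-- On a product of bihomogeneous terms the factor is the sum of the two polynomial degrees. -/
theorem eulerSeries_mul (a b : PowerSeries (GSym W)) :
    eulerSeries (a * b) = eulerSeries a * b + a * eulerSeries b := by
  refine ext_bicoeff fun p n => ?_
  rw [map_add]
  simp only [bicoeff_eulerSeries, bicoeff_mul, Finset.smul_sum, ← Finset.sum_add_distrib]
  refine Finset.sum_congr rfl fun i _ => Finset.sum_congr rfl fun q hq => ?_
  rw [← Finset.HasAntidiagonal.mem_antidiagonal.1 hq]
  simp [add_smul]

/-- The contraction on formal series. -/
noncomputable def contractSeries (k : ZStar) (φ : W k →ₗ[ℝ] ℝ) :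
    PowerSeries (GSym W) →ₗ[ℝ] PowerSeries (GSym W) where
  toFun a := PowerSeries.mk fun n => contract k φ (PowerSeries.coeff (n + k.1.toNat) a)
  map_add' a b := by ext n; simp
  map_smul' c a := by ext n; simp

theorem bicoeff_contractSeries (p n : ℕ) (k : ZStar) (φ : W k →ₗ[ℝ] ℝ)
    (a : PowerSeries (GSym W)) : bicoeff p n (contractSeries k φ a) =
      contract k φ (bicoeff (p + 1) (n + k.1.toNat) a) := by
  simp [bicoeff_apply, contractSeries, comp_contract]

theorem contractSeries_contractSeries (k l : ZStar) (φ : W k →ₗ[ℝ] ℝ) (ψ : W l →ₗ[ℝ] ℝ)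
    (a : PowerSeries (GSym W)) : contractSeries k φ (contractSeries l ψ a) =
      (-1 : ℝ) ^ (k.1 * l.1) • contractSeries l ψ (contractSeries k φ a) := by
  ext n
  simp only [contractSeries, LinearMap.coe_mk, AddHom.coe_mk, PowerSeries.coeff_mk]
  rw [contract_contract, add_right_comm]
  simp

/-- The morphism of algebras of formal series induced by linear maps. -/
noncomputable def mapSeries (L : ∀ k, W k →ₗ[ℝ] W' k) :
    PowerSeries (GSym W) →ₐ[ℝ] PowerSeries (GSym W') :=
  { PowerSeries.map (map L : GSym W →+* GSym W') with
    commutes' := fun c => by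
      simp [Algebra.algebraMap_eq_smul_one]
      ext n
      simp [PowerSeries.coeff_one]
      split_ifs <;> simp }

@[simp] theorem coeff_mapSeries (L : ∀ k, W k →ₗ[ℝ] W' k) (n : ℕ) (a : PowerSeries (GSym W)) :
    PowerSeries.coeff n (mapSeries L a) = map L (PowerSeries.coeff n a) :=
  PowerSeries.coeff_map _ _ _

theorem bicoeff_mapSeries (p n : ℕ) (L : ∀ k, W k →ₗ[ℝ] W' k) (a : PowerSeries (GSym W)) :
    bicoeff p n (mapSeries L a) = map L (bicoeff p n a) := by
  rw [bicoeff_apply, coeff_mapSeries, comp_map, bicoeff_apply]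

theorem mapSeries_mapSeries {L : ∀ k, W k →ₗ[ℝ] W' k} {L' : ∀ k, W' k →ₗ[ℝ] W k}
    (h : ∀ k w, L' k (L k w) = w) (a : PowerSeries (GSym W)) :
    mapSeries L' (mapSeries L a) = a := by
  ext n
  simp [map_map_of_leftInverse h]

end GSym

/-! ### Fibrewise operations on smooth sections. -/

namespace GradedFamily

universe u v v'
variable {d : ℕ} {M : Type u} [TopologicalSpace M] [ChartedSpace (EuclideanSpace ℝ (Fin d)) M]
variable (W : GradedFamily.{u, v} d M) {W' : GradedFamily.{u, v'} d M}

theorem monomial_eq (V : Opens M) (j : ℤ) (n : ℕ) {t : ∀ y, W.Sym y} (ht : t ∈ W.monomials V j n) :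
    ∃ (c : M → ℝ) (l : List (Σ k : ZStar, ∀ y, W.fib k y)),
    (∀ y ∈ V, ContMDiffAt (𝓡 d) 𝓘(ℝ, ℝ) ∞ c y) ∧
    (∀ w ∈ l, ∀ y ∈ V, W.smoothAt w.1 w.2 y) ∧
    (l.map fun w => -w.1.1).sum = j ∧ (l.map fun w => w.1.1.toNat).sum = n ∧
    ∀ y, t y = c y • GSym.prodι (l.map fun w => (⟨w.1, w.2 y⟩ : Σ k, W.fib k y)) := by
  obtain ⟨c, l, h1, h2, h3, h4, h5⟩ := ht
  refine ⟨c, l, h1, h2, h3, h4, fun y => (h5 y).trans ?_⟩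
  simp [GSym.prodι, Function.comp_def]

variable {W}

theorem bideg_of_mem_span {V : Opens M} {j : ℤ} {n : ℕ} {t : ∀ y, W.Sym y}
    (ht : t ∈ Submodule.span ℝ (W.monomials V j n)) (y : M) :
    t y ∈ GSym.bideg (fun k => W.fib k y) j n := by
  suffices h : Submodule.span ℝ (W.monomials V j n) ≤
      (GSym.bideg (fun k => W.fib k y) j n).comap (LinearMap.proj y) from h ht
  rw [Submodule.span_le]
  intro t ht
  obtain ⟨c, l, -, -, h3, h4, h5⟩ := W.monomial_eq V j n ht
  change t y ∈ GSym.bideg (fun k => W.fib k y) j n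
  rw [h5]
  refine Submodule.smul_mem _ _ (Submodule.subset_span ⟨_, ?_, ?_, rfl⟩)
  · simpa [Function.comp_def] using h3
  · simpa [Function.comp_def] using h4

theorem bideg_of_mem {U : Opens M} {j : ℤ} {n : ℕ} {s : ∀ x : U, W.Sym x.1}
    (hs : s ∈ W.symSections U j n) (x : U) : s x ∈ GSym.bideg (fun k => W.fib k x.1) j n := by
  obtain ⟨V, hx, t, ht, h⟩ := hs x
  rw [h x hx]
  exact bideg_of_mem_span ht x.1

theorem map_mem_symSections {U : Opens M} {j : ℤ} {n : ℕ} (T : ∀ y, W.Sym y →ₗ[ℝ] W'.Sym y)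
    (hT : ∀ V ≤ U, ∀ t ∈ W.monomials V j n,
      (fun y => T y (t y)) ∈ Submodule.span ℝ (W'.monomials V j n))
    {s : ∀ x : U, W.Sym x.1} (hs : s ∈ W.symSections U j n) :
    (fun x : U => T x.1 (s x)) ∈ W'.symSections U j n := by
  intro x
  obtain ⟨V, hx, t, ht, h⟩ := hs x
  refine ⟨V ⊓ U, ⟨hx, x.2⟩, fun y => T y (t y), ?_, fun y hy => congrArg (T y.1) (h y hy.1)⟩
  have ht := Submodule.span_mono (W.monomials_anti (inf_le_left : V ⊓ U ≤ V) j n) ht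
  let T' : (∀ y, W.Sym y) →ₗ[ℝ] (∀ y, W'.Sym y) :=
    LinearMap.pi fun y => T y ∘ₗ LinearMap.proj y
  suffices h : Submodule.span ℝ (W.monomials (V ⊓ U) j n) ≤
      (Submodule.span ℝ (W'.monomials (V ⊓ U) j n)).comap T' from h ht
  rw [Submodule.span_le]
  intro t ht
  exact hT _ inf_le_right t ht

/-- All values of a monomial have the same word length, so the projection either keeps it or kills
it. -/
theorem comp_mem_symSections {U : Opens M} {j : ℤ} {n : ℕ} (p : ℕ) {s : ∀ x : U, W.Sym x.1}
    (hs : s ∈ W.symSections U j n) : (fun x : U => GSym.comp p (s x)) ∈ W.symSections U j n := by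
  refine map_mem_symSections (fun y => GSym.comp p) (fun V _ t ht => ?_) hs
  obtain ⟨c, l, -, -, -, -, h⟩ := W.monomial_eq V j n ht
  by_cases hp : p = l.length
  · have : (fun y => GSym.comp p (t y)) = t := by
      funext y
      simp [h, GSym.comp_prodι, hp]
    rw [this]
    exact Submodule.subset_span ht
  · convert Submodule.zero_mem _ using 1
    funext y
    simp [h, GSym.comp_prodι, hp]

theorem euler_mem_symSections {U : Opens M} {j : ℤ} {n : ℕ} {s : ∀ x : U, W.Sym x.1}
    (hs : s ∈ W.symSections U j n) : (fun x : U => GSym.euler (s x)) ∈ W.symSections U j n := by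
  refine map_mem_symSections (fun y => GSym.euler) (fun V _ t ht => ?_) hs
  obtain ⟨c, l, -, -, -, -, h⟩ := W.monomial_eq V j n ht
  convert Submodule.smul_mem _ (l.length : ℝ) (Submodule.subset_span ht) using 1
  funext y
  simp only [h, map_smul, GSym.euler_prodι, List.length_map, Pi.smul_apply]
  rw [smul_comm]

theorem symSections_res {U V : Opens M} (hVU : V ≤ U) {j : ℤ} {n : ℕ} {s : ∀ x : U, W.Sym x.1}
    (hs : s ∈ W.symSections U j n) :
    (fun x : V => s ⟨x.1, hVU x.2⟩) ∈ W.symSections V j n := by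
  intro x
  obtain ⟨V', hx, t, ht, h⟩ := hs ⟨x.1, hVU x.2⟩
  exact ⟨V', hx, t, ht, fun y hy => h _ hy⟩

theorem symSections_of_local {U : Opens M} {j : ℤ} {n : ℕ} {s : ∀ x : U, W.Sym x.1}
    (h : ∀ x : U, ∃ (V : Opens M) (hV : V ≤ U), x.1 ∈ V ∧
      (fun y : V => s ⟨y.1, hV y.2⟩) ∈ W.symSections V j n) : s ∈ W.symSections U j n := by
  intro x
  obtain ⟨V, hV, hx, h⟩ := h x
  obtain ⟨V', hx', t, ht, h'⟩ := h ⟨x.1, hx⟩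
  exact ⟨V ⊓ V', ⟨hx, hx'⟩, t, Submodule.span_mono (W.monomials_anti inf_le_right j n) ht,
    fun y hy => h' ⟨y.1, hy.1⟩ hy.2⟩

theorem homSections_of_local {U : Opens M} {j : ℤ} {s : ∀ x : U, W.CSym x.1}
    (h : ∀ x : U, ∃ (V : Opens M) (hV : V ≤ U), x.1 ∈ V ∧
      (fun y : V => s ⟨y.1, hV y.2⟩) ∈ W.homSections V j) : s ∈ W.homSections U j := fun n =>
  symSections_of_local fun x => by
    obtain ⟨V, hV, hx, h⟩ := h x
    exact ⟨V, hV, hx, h n⟩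

theorem euler_mem_homSections {U : Opens M} {j : ℤ} {s : ∀ x : U, W.CSym x.1}
    (hs : s ∈ W.homSections U j) : (fun x : U => GSym.eulerSeries (s x)) ∈ W.homSections U j := by
  intro n
  simpa [GSym.eulerSeries] using euler_mem_symSections (hs n)

theorem mapSeries_mem_homSections {U : Opens M} {j : ℤ}
    (L : ∀ y k, W.fib k y →ₗ[ℝ] W'.fib k y)
    (hL : ∀ V ≤ U, ∀ k w, (∀ y ∈ V, W.smoothAt k w y) →
      ∀ y ∈ V, W'.smoothAt k (fun y => L y k (w y)) y)
    {s : ∀ x : U, W.CSym x.1} (hs : s ∈ W.homSections U j) :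
    (fun x : U => (GSym.mapSeries (L x.1) (s x) : W'.CSym x.1)) ∈ W'.homSections U j := by
  intro n
  simp only [GSym.coeff_mapSeries]
  refine map_mem_symSections (fun y => (GSym.map (L y)).toLinearMap) (fun V hV t ht => ?_) (hs n)
  obtain ⟨c, l, h1, h2, h3, h4, h5⟩ := W.monomial_eq V j n ht
  refine Submodule.subset_span ⟨c, l.map fun w => ⟨w.1, fun y => L y w.1 (w.2 y)⟩, h1, ?_, ?_, ?_,
    fun y => ?_⟩
  · intro w hw
    obtain ⟨w', hw', rfl⟩ := List.mem_map.1 hw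
    exact hL V hV _ _ (h2 w' hw')
  · simpa [Function.comp_def] using h3
  · simpa [Function.comp_def] using h4
  · change GSym.map (L y) (t y) = _
    rw [h5]
    simp only [map_smul, GSym.map_prodι]
    simp [GSym.prodι, Function.comp_def]

end GradedFamily
end GradedQ

/-! ### Powers of `I`, the filtration and completeness in a trivialization. -/

namespace GradedQ

universe u v v'
variable {d : ℕ} {M : Type u} [TopologicalSpace M] [ChartedSpace (EuclideanSpace ℝ (Fin d)) M]

namespace GradedSpace

variable {O : GradedSpace.{u, v} d M}

theorem deg_induction {V : Opens M} {P : O.obj V → Prop} (h0 : P 0)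
    (hj : ∀ j, ∀ f ∈ O.deg V j, P f) (ha : ∀ f g, P f → P g → P (f + g)) (f : O.obj V) : P f := by
  induction f using DirectSum.Decomposition.inductionOn (O.deg V) with
  | zero => exact h0
  | @homogeneous j f => exact hj j f f.2
  | add a b ha' hb => exact ha _ _ ha' hb

theorem mem_I {V : Opens M} {f : O.obj V} : f ∈ O.I V ↔ O.body V f = 0 := Iff.rfl

/-- `I` is a graded ideal: `body` vanishes outside degree zero, so only the component of degree zero
has to be checked to lie in `I`. -/
theorem I_induction {V : Opens M} {P : O.obj V → Prop} (h0 : P 0)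
    (hj : ∀ j, ∀ f ∈ O.deg V j, f ∈ O.I V → P f) (ha : ∀ f g, P f → P g → P (f + g))
    {f : O.obj V} (hf : f ∈ O.I V) : P f := by
  classical
  -- The property is known only on homogeneous elements of `I`, and an arbitrary `f` is not in `I`.
  -- The induction therefore runs on `f` minus its component of degree zero.
  suffices h : ∀ f : O.obj V,
      P (f - (DirectSum.decompose (O.deg V) f 0 : O.obj V)) ∧
      O.body V (DirectSum.decompose (O.deg V) f 0 : O.obj V) = O.body V f by
    have h1 := hj 0 _ (DirectSum.decompose (O.deg V) f 0).2
      (by rw [mem_I, (h f).2]; exact hf)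
    have h2 := ha _ _ (h f).1 h1
    simpa using h2
  intro f
  induction f using deg_induction with
  | h0 => simpa using h0
  | hj j f hf =>
    by_cases h : j = 0
    · subst h
      rw [DirectSum.decompose_of_mem_same _ hf]
      simpa using h0
    · rw [DirectSum.decompose_of_mem_ne _ hf h]
      have h3 := O.body_deg V j h f hf
      exact ⟨by simpa using hj j f hf h3, by rw [h3, map_zero]⟩
  | ha a b h h' =>
    rw [DirectSum.decompose_add]
    simp only [DirectSum.add_apply, Submodule.coe_add, map_add]
    refine ⟨?_, by rw [h.2, h'.2]⟩
    rw [add_sub_add_comm]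
    exact ha _ _ h.1 h'.1

theorem mul_mem_deg {V : Opens M} {i j : ℤ} {f g : O.obj V} (hf : f ∈ O.deg V i)
    (hg : g ∈ O.deg V j) : f * g ∈ O.deg V (i + j) := SetLike.mul_mem_graded hf hg

theorem one_mem_deg (V : Opens M) : (1 : O.obj V) ∈ O.deg V 0 := SetLike.one_mem_graded _

theorem commute_of_mem_deg_zero {V : Opens M} {f : O.obj V} (hf : f ∈ O.deg V 0) (g : O.obj V) :
    f * g = g * f := by
  induction g using deg_induction with
  | h0 => simp
  | hj j g hg => simpa using O.gcomm V 0 j f hf g hg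
  | ha a b h h' => rw [mul_add, add_mul, h, h']

theorem mul_mem_I_left {V : Opens M} (f : O.obj V) {g : O.obj V} (hg : g ∈ O.I V) :
    f * g ∈ O.I V := by
  rw [mem_I] at *
  rw [map_mul, hg, mul_zero]

theorem mul_mem_I_right {V : Opens M} (f : O.obj V) {g : O.obj V} (hg : g ∈ O.I V) :
    g * f ∈ O.I V := by
  rw [mem_I] at *
  rw [map_mul, hg, zero_mul]

theorem res_mem_I {U V : Opens M} (h : V ≤ U) {f : O.obj U} (hf : f ∈ O.I U) :
    O.res h f ∈ O.I V := by
  rw [mem_I] at *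
  ext x
  rw [O.body_res, hf]
  rfl

variable (O) in
/-- The powers of the ideal `I`. -/
noncomputable def Ipow (V : Opens M) : ℕ → Submodule ℝ (O.obj V)
  | 0 => ⊤
  | p + 1 => O.I V * Ipow V p

theorem mul_mem_Ipow_succ {V : Opens M} {p : ℕ} {f g : O.obj V} (hf : f ∈ O.I V)
    (hg : g ∈ O.Ipow V p) : f * g ∈ O.Ipow V (p + 1) := Submodule.mul_mem_mul hf hg

theorem Ipow_mul_left {V : Opens M} {p : ℕ} (f : O.obj V) {g : O.obj V} (hg : g ∈ O.Ipow V p) :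
    f * g ∈ O.Ipow V p := by
  cases p with
  | zero => trivial
  | succ p =>
    refine Submodule.mul_induction_on (C := fun g => f * g ∈ O.Ipow V (p + 1)) hg
      (fun a ha b hb => ?_) fun a b h h' => ?_
    · rw [← mul_assoc]
      exact mul_mem_Ipow_succ (mul_mem_I_left f ha) hb
    · rw [mul_add]; exact Submodule.add_mem _ h h'

theorem Ipow_add {V : Opens M} {p q : ℕ} {f g : O.obj V} (hf : f ∈ O.Ipow V p)
    (hg : g ∈ O.Ipow V q) : f * g ∈ O.Ipow V (p + q) := by
  induction p generalizing f with
  | zero => rw [zero_add]; exact Ipow_mul_left f hg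
  | succ p ih =>
    refine Submodule.mul_induction_on (C := fun f => f * g ∈ O.Ipow V (p + 1 + q)) hf
      (fun a ha b hb => ?_) fun a b h h' => ?_
    · rw [mul_assoc, add_right_comm]
      exact mul_mem_Ipow_succ ha (ih hb)
    · rw [add_mul]; exact Submodule.add_mem _ h h'

theorem Ipow_succ_le (V : Opens M) (p : ℕ) : O.Ipow V (p + 1) ≤ O.Ipow V p :=
  Submodule.mul_le.2 fun f _ _ hg => Ipow_mul_left f hg

theorem Ipow_antitone (V : Opens M) : Antitone (O.Ipow V) :=
  antitone_nat_of_succ_le (Ipow_succ_le V)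

theorem mem_Ipow_one {V : Opens M} {f : O.obj V} (hf : f ∈ O.I V) : f ∈ O.Ipow V 1 := by
  have := mul_mem_Ipow_succ (p := 0) hf (g := 1) trivial
  simpa using this

namespace Iso

variable {N : Opens M} {W : GradedFamily.{u, v'} d M} (Φ : O.Iso N W)

/-- The value at `x` of a function in the trivialization `Φ`. -/
noncomputable def app {V : Opens M} (hV : V ≤ N) (x : V) : O.obj V →ₐ[ℝ] W.CSym x.1 :=
  ((Pi.evalAlgHom ℝ (fun x : V => W.CSym x.1) x).comp (W.sections V).val).comp
    (Φ.equiv V hV : O.obj V →ₐ[ℝ] W.sections V)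

theorem app_apply {V : Opens M} (hV : V ≤ N) (x : V) (f : O.obj V) :
    Φ.app hV x f = (Φ.equiv V hV f).1 x := rfl

theorem app_res {V V' : Opens M} (hV : V ≤ N) (h : V' ≤ V) (f : O.obj V) (x : V') :
    Φ.app (h.trans hV) x (O.res h f) = Φ.app hV ⟨x.1, h x.2⟩ f := Φ.natural V V' hV h f x

theorem app_ext {V : Opens M} (hV : V ≤ N) {f g : O.obj V}
    (h : ∀ x, Φ.app hV x f = Φ.app hV x g) : f = g :=
  (Φ.equiv V hV).injective (Subtype.ext (funext h))

theorem mem_deg_iff {V : Opens M} (hV : V ≤ N) {j : ℤ} {f : O.obj V} :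
    f ∈ O.deg V j ↔ (fun x => Φ.app hV x f) ∈ W.homSections V j := Φ.deg V hV j f

theorem mem_F_iff {V : Opens M} (hV : V ≤ N) {n : ℕ} {f : O.obj V} :
    f ∈ O.F V n ↔ ∀ x, ∀ m < n, PowerSeries.coeff m (Φ.app hV x f) = 0 := Φ.filt V hV n f

theorem exists_app_eq {V : Opens M} (hV : V ≤ N) {j : ℤ} {s : ∀ x : V, W.CSym x.1}
    (hs : s ∈ W.homSections V j) : ∃ f ∈ O.deg V j, ∀ x, Φ.app hV x f = s x := by
  have h : ∀ x, Φ.app hV x ((Φ.equiv V hV).symm ⟨s, W.homSections_le V j hs⟩) = s x := by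
    intro x
    rw [app_apply, AlgEquiv.apply_symm_apply]
  exact ⟨_, (Φ.mem_deg_iff hV).2 (by simpa only [h] using hs), h⟩

theorem bideg_coeff {V : Opens M} (hV : V ≤ N) {j : ℤ} {f : O.obj V} (hf : f ∈ O.deg V j) (x : V)
    (n : ℕ) : PowerSeries.coeff n (Φ.app hV x f) ∈ GSym.bideg (fun k => W.fib k x.1) j n :=
  GradedFamily.bideg_of_mem ((Φ.mem_deg_iff hV).1 hf n) x

theorem aug_coeff {V : Opens M} (hV : V ≤ N) (f : O.obj V) (x : V) (n : ℕ) :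
    GSym.aug (PowerSeries.coeff n (Φ.app hV x f)) = if n = 0 then O.body V f x else 0 := by
  split_ifs with hn
  · subst hn
    exact (Φ.body V hV f x).symm
  · induction f using deg_induction with
    | h0 => simp
    | hj j f hf => exact GSym.aug_eq_zero_of_bideg (Φ.bideg_coeff hV hf x n) (Or.inr hn)
    | ha a b h h' => simp [h, h']

theorem bicoeff_zero {V : Opens M} (hV : V ≤ N) (f : O.obj V) (x : V) (n : ℕ) :
    GSym.bicoeff 0 n (Φ.app hV x f) =
      algebraMap ℝ _ (if n = 0 then O.body V f x else 0) := by
  rw [GSym.bicoeff_apply, GSym.comp_zero, aug_coeff]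

theorem mem_I_iff {V : Opens M} (hV : V ≤ N) {f : O.obj V} :
    f ∈ O.I V ↔ ∀ x, GSym.bicoeff 0 0 (Φ.app hV x f) = 0 := by
  rw [mem_I]
  constructor
  · intro h x
    simp [bicoeff_zero, h]
  · intro h
    ext x
    have := congrArg GSym.aug (h x)
    simpa [bicoeff_zero] using this

/-- Constants occur only in negative degree zero, where the constant term is the body. -/
theorem vanish_one {V : Opens M} (hV : V ≤ N) {f : O.obj V} (hf : f ∈ O.I V) (x : V) (n : ℕ) :
    GSym.Vanish 1 n (Φ.app hV x f) := by
  intro q hq m _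
  obtain rfl : q = 0 := by omega
  have h : O.body V f = 0 := hf
  simp [bicoeff_zero, h]

theorem vanish_of_mem_F {V : Opens M} (hV : V ≤ N) {n : ℕ} {f : O.obj V} (hf : f ∈ O.F V n)
    (p : ℕ) (x : V) : GSym.Vanish p n (Φ.app hV x f) := fun q _ m hm => by
  rw [GSym.bicoeff_apply, (Φ.mem_F_iff hV).1 hf x m hm, map_zero]

theorem vanish_of_mem_Ipow {V : Opens M} (hV : V ≤ N) {p : ℕ} {f : O.obj V} (hf : f ∈ O.Ipow V p)
    (n : ℕ) (x : V) : GSym.Vanish p n (Φ.app hV x f) := by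
  induction p generalizing f with
  | zero => exact GSym.vanish_zero_left _ _
  | succ p ih =>
    refine Submodule.mul_induction_on (C := fun f => GSym.Vanish (p + 1) n (Φ.app hV x f)) hf
      (fun a ha b hb => ?_) fun a b h h' => ?_
    · rw [map_mul, add_comm p]
      exact (Φ.vanish_one hV ha x n).mul (ih hb)
    · rw [map_add]; exact h.add h'

theorem vanish_of_mem {V : Opens M} (hV : V ≤ N) {p n : ℕ} {f : O.obj V}
    (hf : f ∈ O.Ipow V p ⊔ O.F V n) (x : V) : GSym.Vanish p n (Φ.app hV x f) := by
  obtain ⟨a, ha, b, hb, rfl⟩ := Submodule.mem_sup.1 hf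
  rw [map_add]
  exact (Φ.vanish_of_mem_Ipow hV ha n x).add (Φ.vanish_of_mem_F hV hb p x)

include Φ in
theorem mul_mem_F {V : Opens M} (hV : V ≤ N) {m n : ℕ} {f g : O.obj V} (hf : f ∈ O.F V m)
    (hg : g ∈ O.F V n) : f * g ∈ O.F V (m + n) := by
  rw [Φ.mem_F_iff hV] at *
  intro x i hi
  rw [map_mul, PowerSeries.coeff_mul]
  refine Finset.sum_eq_zero fun r hr => ?_
  have h := Finset.HasAntidiagonal.mem_antidiagonal.1 hr
  by_cases h' : r.1 < m
  · rw [hf x _ h', zero_mul]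
  · rw [hg x _ (by omega), mul_zero]

include Φ in
theorem mem_F_zero {V : Opens M} (hV : V ≤ N) (f : O.obj V) : f ∈ O.F V 0 :=
  (Φ.mem_F_iff hV).2 fun _ _ h => absurd h (Nat.not_lt_zero _)

include Φ in
theorem mul_mem_F_left {V : Opens M} (hV : V ≤ N) {n : ℕ} (f : O.obj V) {g : O.obj V}
    (hg : g ∈ O.F V n) : f * g ∈ O.F V n := by
  simpa using Φ.mul_mem_F hV (Φ.mem_F_zero hV f) hg

include Φ in
theorem mul_mem_F_right {V : Opens M} (hV : V ≤ N) {n : ℕ} (f : O.obj V) {g : O.obj V}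
    (hg : g ∈ O.F V n) : g * f ∈ O.F V n := by
  simpa using Φ.mul_mem_F hV hg (Φ.mem_F_zero hV f)

include Φ in
theorem F_antitone {V : Opens M} (hV : V ≤ N) : Antitone (O.F V) := by
  intro m n hmn f hf
  rw [Φ.mem_F_iff hV] at *
  exact fun x i hi => hf x i (hi.trans_le hmn)

include Φ in
theorem eq_zero_of_forall_mem_F {V : Opens M} (hV : V ≤ N) {f : O.obj V}
    (hf : ∀ n, f ∈ O.F V n) : f = 0 := by
  refine Φ.app_ext hV fun x => PowerSeries.ext fun n => ?_
  rw [(Φ.mem_F_iff hV).1 (hf (n + 1)) x n n.lt_succ_self]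
  simp

include Φ in
theorem mul_mem_sup {V : Opens M} (hV : V ≤ N) {p q n : ℕ} {f g : O.obj V}
    (hf : f ∈ O.Ipow V p ⊔ O.F V n) (hg : g ∈ O.Ipow V q ⊔ O.F V n) :
    f * g ∈ O.Ipow V (p + q) ⊔ O.F V n := by
  obtain ⟨a, ha, b, hb, rfl⟩ := Submodule.mem_sup.1 hf
  obtain ⟨a', ha', b', hb', rfl⟩ := Submodule.mem_sup.1 hg
  rw [add_mul, mul_add, add_assoc]
  refine Submodule.add_mem_sup (Ipow_add ha ha') (Submodule.add_mem _ ?_ ?_)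
  · exact Φ.mul_mem_F_left hV _ hb'
  · exact Φ.mul_mem_F_right hV _ hb

include Φ in
theorem mul_mem_sup_left {V : Opens M} (hV : V ≤ N) {p n : ℕ} (f : O.obj V) {g : O.obj V}
    (hg : g ∈ O.Ipow V p ⊔ O.F V n) : f * g ∈ O.Ipow V p ⊔ O.F V n := by
  have := Φ.mul_mem_sup hV (p := 0) (n := n) (f := f) (Submodule.mem_sup_left trivial) hg
  simpa using this

include Φ in
-- Completeness for the negative filtration. The coefficient `n` of the limit is taken from `g (K (n
-- + 1))`, because it is congruence modulo `F^(n+1)` that fixes this coefficient. A fixed total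
-- degree is needed for the limit to be a section.
theorem exists_limit {V : Opens M} (hV : V ≤ N) {j : ℤ} (g : ℕ → O.obj V) (K : ℕ → ℕ)
    (hg : ∀ i, g i ∈ O.deg V j) (hK : ∀ n, ∀ i ≥ K n, g (i + 1) - g i ∈ O.F V n) :
    ∃ f ∈ O.deg V j, ∀ n, ∀ i ≥ K n, f - g i ∈ O.F V n := by
  have h1 : ∀ n, ∀ i ≥ K n, ∀ l, g (i + l) - g i ∈ O.F V n := by
    intro n i hi l
    induction l with
    | zero => simp
    | succ l ih =>
      have := Submodule.add_mem _ (hK n (i + l) (by omega)) ih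
      rw [sub_add_sub_cancel] at this
      exact this
  have h2 : ∀ n, ∀ i ≥ K n, ∀ i' ≥ K n, g i - g i' ∈ O.F V n := by
    intro n i hi i' hi'
    have a := h1 n i hi i'
    have b := h1 n i' hi' i
    rw [add_comm i'] at b
    have := Submodule.sub_mem _ b a
    simpa using this
  obtain ⟨f, hf, hfx⟩ := Φ.exists_app_eq hV (j := j)
    (s := fun x => PowerSeries.mk fun n => PowerSeries.coeff n (Φ.app hV x (g (K (n + 1))))) (by
      intro n
      simp only [PowerSeries.coeff_mk]
      exact (Φ.mem_deg_iff hV).1 (hg _) n)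
  refine ⟨f, hf, fun n i hi => (Φ.mem_F_iff hV).2 fun x m hm => ?_⟩
  rw [map_sub, hfx, map_sub, PowerSeries.coeff_mk, ← map_sub, ← map_sub]
  have a : g (K (m + 1)) - g (max i (K (m + 1))) ∈ O.F V (m + 1) :=
    h2 (m + 1) _ le_rfl _ (le_max_right _ _)
  have b : g (max i (K (m + 1))) - g i ∈ O.F V n := h2 n _ (le_max_of_le_left hi) _ hi
  have c := congrArg₂ (· + ·) ((Φ.mem_F_iff hV).1 a x m m.lt_succ_self)
    ((Φ.mem_F_iff hV).1 b x m hm)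
  simpa [← map_add] using c

theorem exists_const {V : Opens M} (hV : V ≤ N) (c : C^∞⟮𝓡 d, V; 𝓘(ℝ, ℝ), ℝ⟯) :
    ∃ f ∈ O.deg V 0, (∀ x, Φ.app hV x f = algebraMap ℝ _ (c x)) ∧ O.body V f = c := by
  obtain ⟨f, hf, h⟩ := Φ.exists_app_eq hV (W.constSec_mem c)
  refine ⟨f, hf, h, ?_⟩
  ext x
  rw [Φ.body V hV, ← app_apply, h]
  simp [GradedFamily.constSec, Algebra.algebraMap_eq_smul_one]

include Φ in
-- In total degree zero, the part of negative degree zero is just a function, namely the body.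
theorem mem_F_one {V : Opens M} (hV : V ≤ N) {f : O.obj V} (hf : f ∈ O.deg V 0)
    (hb : O.body V f = 0) : f ∈ O.F V 1 := by
  refine (Φ.mem_F_iff hV).2 fun x m hm => ?_
  obtain rfl : m = 0 := by omega
  rw [GSym.eq_algebraMap_of_bideg (Φ.bideg_coeff hV hf x 0), aug_coeff, hb]
  simp

include Φ in
/-- A function of degree `0` whose body does not vanish is invertible. -/
theorem exists_inverse {V : Opens M} (hV : V ≤ N) {f : O.obj V} (hf : f ∈ O.deg V 0)
    (hb : ∀ x, O.body V f x ≠ 0) : ∃ g ∈ O.deg V 0, f * g = 1 := by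
  obtain ⟨c, hc, -, hcb⟩ := Φ.exists_const hV
    ⟨fun x => (O.body V f x)⁻¹, (O.body V f).contMDiff.inv₀ hb⟩
  -- With `c` the inverse of the body, `w` lies in `F^1`, so `w^i` lies in `F^i` and the geometric
  -- series of `w` converges to an inverse of `f c`.
  set w := 1 - f * c with hw
  have hw0 : w ∈ O.deg V 0 := Submodule.sub_mem _ (one_mem_deg V) (by simpa using mul_mem_deg hf hc)
  have hwF : w ∈ O.F V 1 := by
    refine Φ.mem_F_one hV hw0 ?_
    rw [hw, map_sub, map_mul, hcb, map_one]
    ext x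
    change 1 - O.body V f x * (O.body V f x)⁻¹ = 0
    rw [mul_inv_cancel₀ (hb x), sub_self]
  have hpow : ∀ i, w ^ i ∈ O.deg V 0 ∧ w ^ i ∈ O.F V i := by
    intro i
    induction i with
    | zero => simpa using ⟨one_mem_deg V, Φ.mem_F_zero hV 1⟩
    | succ i ih =>
      rw [pow_succ]
      exact ⟨by simpa using mul_mem_deg ih.1 hw0, Φ.mul_mem_F hV ih.2 hwF⟩
  obtain ⟨g, hg, hlim⟩ := Φ.exists_limit hV (j := 0) (fun i => ∑ l ∈ Finset.range i, w ^ l) id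
    (fun i => Submodule.sum_mem _ fun l _ => (hpow l).1) fun n i hi => by
      simp only [Finset.sum_range_succ, add_sub_cancel_left]
      exact Φ.F_antitone hV hi (hpow i).2
  refine ⟨c * g, by simpa using mul_mem_deg hc hg, ?_⟩
  have h : (1 - w) * g - 1 = 0 := by
    refine Φ.eq_zero_of_forall_mem_F hV fun n => ?_
    have h1 := Φ.mul_mem_F_left hV (1 - w) (hlim n n le_rfl)
    rw [mul_sub, mul_neg_geom_sum] at h1
    have h2 := Submodule.sub_mem _ h1 (hpow n).2
    convert h2 using 1
    abel
  rw [← mul_assoc, show f * c = 1 - w by rw [hw]; abel]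
  exact sub_eq_zero.1 h

end Iso

end GradedSpace
end GradedQ

/-! ### Symbols, Euler vector fields and their binomial operators. -/

namespace GradedQ

universe u v v'
variable {d : ℕ} {M : Type u} [TopologicalSpace M] [ChartedSpace (EuclideanSpace ℝ (Fin d)) M]

namespace GradedSpace

variable {O : GradedSpace.{u, v} d M}

theorem cls_res {U V : Opens M} (h : V ≤ U) (f : O.obj U) (k : ℤ) (x : V) :
    O.cls (O.res h f) k x = O.cls f k ⟨x.1, h x.2⟩ := by
  ext e
  exact e.2.1 ⟨U, h x.2⟩ ⟨V, x.2⟩ h f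

/-- A local isomorphism with the completed symmetric algebra of the canonical bundles which
identifies linear parts with classes modulo `I²`, and in which functions of polynomial order `≥ p`
lie in the `p`-th power of `I` up to high negative degree. -/
structure Iso.Adapted {N : Opens M} (Φ : O.Iso N O.dualFamily) : Prop where
  lin : ∀ {V : Opens M} (hV : V ≤ N) (k : ZStar), ∀ f ∈ O.deg V (-k.1), ∀ x : V,
    GSym.bicoeff 1 k.1.toNat (Φ.app hV x f) =
      GSym.ι (fun k => O.dualFamily.fib k x.1) k (O.cls f k.1 x)
  dense : ∀ {V : Opens M} (hV : V ≤ N) (j : ℤ) (p n : ℕ), ∀ f ∈ O.deg V j,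
    (∀ x, GSym.Vanish p n (Φ.app hV x f)) → f ∈ O.Ipow V p ⊔ O.F V n

/-- Linear terms occur only in the bidegrees `(-k, max(k, 0))`, and there `lin` identifies them with
the class modulo `I²` in both isomorphisms. -/
theorem Iso.Adapted.bicoeff_one_eq {N N' : Opens M} {Φ : O.Iso N O.dualFamily}
    {Φ' : O.Iso N' O.dualFamily} (hΦ : Φ.Adapted) (hΦ' : Φ'.Adapted) {V : Opens M} (hV : V ≤ N)
    (hV' : V ≤ N') {f : O.obj V} (hf : f ∈ O.I V) (x : V) (m : ℕ) :
    GSym.bicoeff 1 m (Φ.app hV x f) = GSym.bicoeff 1 m (Φ'.app hV' x f) := by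
  refine I_induction (P := fun f => GSym.bicoeff 1 m (Φ.app hV x f) =
    GSym.bicoeff 1 m (Φ'.app hV' x f)) (by simp) (fun j f hj hf => ?_)
    (fun a b h h' => by simp only [map_add, h, h']) hf
  by_cases h : ∃ k : ZStar, j = -k.1 ∧ m = k.1.toNat
  · obtain ⟨k, rfl, rfl⟩ := h
    rw [hΦ.lin hV k f hj, hΦ'.lin hV' k f hj]
  · rcases GSym.comp_one_of_bideg (Φ.bideg_coeff hV hj x m) with h1 | ⟨k, w, h1, h2, -⟩
    · rcases GSym.comp_one_of_bideg (Φ'.bideg_coeff hV' hj x m) with h1' | ⟨k, w, h1', h2, -⟩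
      · rw [GSym.bicoeff_apply, GSym.bicoeff_apply, h1, h1']
      · exact absurd ⟨k, h1', h2⟩ h
    · exact absurd ⟨k, h1, h2⟩ h

/-- The symbol of a function in the `p`-th power of `I` does not depend on the splitting. -/
theorem Iso.Adapted.bicoeff_eq {N N' : Opens M} {Φ : O.Iso N O.dualFamily}
    {Φ' : O.Iso N' O.dualFamily} (hΦ : Φ.Adapted) (hΦ' : Φ'.Adapted) {V : Opens M} (hV : V ≤ N)
    (hV' : V ≤ N') {p n : ℕ} {f : O.obj V} (hf : f ∈ O.Ipow V p ⊔ O.F V n) (x : V) {m : ℕ}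
    (hm : m < n) : GSym.bicoeff p m (Φ.app hV x f) = GSym.bicoeff p m (Φ'.app hV' x f) := by
  obtain ⟨a, ha, b, hb, rfl⟩ := Submodule.mem_sup.1 hf
  rw [map_add, map_add, map_add, map_add]
  congr 1
  · clear hf
    induction p generalizing a m with
    | zero => rw [Φ.bicoeff_zero, Φ'.bicoeff_zero]
    | succ p ih =>
      -- Symbols of products are convolutions of symbols, so the claim for `I^(p+1)` reduces to `I`
      -- and `I^p`.
      refine Submodule.mul_induction_on (C := fun a =>
        GSym.bicoeff (p + 1) m (Φ.app hV x a) = GSym.bicoeff (p + 1) m (Φ'.app hV' x a)) ha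
        (fun a ha b hb => ?_) fun a b h h' => ?_
      · rw [map_mul (Φ.app hV x), map_mul (Φ'.app hV' x), add_comm p,
          (Φ.vanish_one hV ha x n).bicoeff_mul (Φ.vanish_of_mem_Ipow hV hb n x) hm,
          (Φ'.vanish_one hV' ha x n).bicoeff_mul (Φ'.vanish_of_mem_Ipow hV' hb n x) hm]
        refine Finset.sum_congr rfl fun i hi => ?_
        have := Finset.HasAntidiagonal.mem_antidiagonal.1 hi
        rw [hΦ.bicoeff_one_eq hΦ' hV hV' ha, ih (by omega) b hb]
      · simp only [map_add, h, h']
  · rw [Φ.vanish_of_mem_F hV hb (p + 1) x p p.lt_succ_self m hm,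
      Φ'.vanish_of_mem_F hV' hb (p + 1) x p p.lt_succ_self m hm]

variable (O) in
/-- An open cover of `U` by domains of adapted isomorphisms. -/
structure SplittingAtlas (U : Opens M) where
  dom : U → Opens M
  mem : ∀ x, x.1 ∈ dom x
  iso : ∀ x, O.Iso (dom x) O.dualFamily
  adapted : ∀ x, (iso x).Adapted

/-- An Euler vector field over `U`: a vector field of degree `0` which acts by `p` on
`I^p / I^(p+1)`. -/
structure EulerField {U : Opens M} (A : O.SplittingAtlas U) where
  op : ∀ V : Opens M, V ≤ U → O.obj V →ₗ[ℝ] O.obj V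
  res : ∀ {V V' : Opens M} (hV : V ≤ U) (h : V' ≤ V) (f : O.obj V),
    op V' (h.trans hV) (O.res h f) = O.res h (op V hV f)
  deg : ∀ {V : Opens M} (hV : V ≤ U) (j : ℤ), ∀ f ∈ O.deg V j, op V hV f ∈ O.deg V j
  leibniz : ∀ {V : Opens M} (hV : V ≤ U) (f g : O.obj V),
    op V hV (f * g) = op V hV f * g + f * op V hV g
  filt : ∀ {V : Opens M} (hV : V ≤ U) (n : ℕ), ∀ f ∈ O.F V n, op V hV f ∈ O.F V n
  body : ∀ {V : Opens M} (hV : V ≤ U) (f : O.obj V), op V hV f ∈ O.I V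
  -- The powers of `I` used here are algebraic, so the condition is imposed modulo each `F^n` and
  -- only inside the domains of the atlas.
  near : ∀ (x : U) {V : Opens M} (hV : V ≤ U), V ≤ A.dom x → ∀ f ∈ O.I V, ∀ n,
    op V hV f - f ∈ O.Ipow V 2 ⊔ O.F V n

namespace EulerField

variable {U : Opens M} {A : O.SplittingAtlas U} (ε : EulerField A)

/-- By the Leibniz rule each of the `p` factors in `I` contributes once the product itself, modulo
one more factor of `I`. For `p = 0` this is the condition `body`. -/
theorem sub_mem {x : U} {V : Opens M} (hV : V ≤ U) (hx : V ≤ A.dom x) {p n : ℕ} {f : O.obj V}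
    (hf : f ∈ O.Ipow V p ⊔ O.F V n) :
    ε.op V hV f - (p : ℝ) • f ∈ O.Ipow V (p + 1) ⊔ O.F V n := by
  obtain ⟨a, ha, b, hb, rfl⟩ := Submodule.mem_sup.1 hf
  rw [map_add, smul_add, add_sub_add_comm]
  refine Submodule.add_mem _ ?_ (Submodule.mem_sup_right
    (Submodule.sub_mem _ (ε.filt hV n b hb) (Submodule.smul_mem _ _ hb)))
  clear hf
  induction p generalizing a with
  | zero =>
    refine Submodule.mem_sup_left ?_
    simpa using mem_Ipow_one (ε.body hV a)
  | succ p ih =>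
    refine Submodule.mul_induction_on (C := fun a =>
        ε.op V hV a - ((p + 1 : ℕ) : ℝ) • a ∈ O.Ipow V (p + 1 + 1) ⊔ O.F V n) ha
        (fun a ha b hb => ?_) fun a b h h' => ?_
    · have h1 := (A.iso x).mul_mem_sup hx (ε.near x hV hx a ha n)
        (Submodule.mem_sup_left hb : b ∈ O.Ipow V p ⊔ O.F V n)
      have h2 := (A.iso x).mul_mem_sup hx
        (Submodule.mem_sup_left (mem_Ipow_one ha) : a ∈ O.Ipow V 1 ⊔ O.F V n) (ih b hb)
      rw [show 2 + p = p + 1 + 1 by ring] at h1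
      rw [show 1 + (p + 1) = p + 1 + 1 by ring] at h2
      convert Submodule.add_mem _ h1 h2 using 1
      rw [ε.leibniz, sub_mul, mul_sub, mul_smul_comm]
      push_cast
      module
    · rw [map_add, smul_add, add_sub_add_comm]
      exact Submodule.add_mem _ h h'

/-- The binomial coefficients in the operator `ε`. -/
noncomputable def binom (V : Opens M) (hV : V ≤ U) : ℕ → O.obj V →ₗ[ℝ] O.obj V
  | 0 => LinearMap.id
  | p + 1 => ((p + 1 : ℕ) : ℝ)⁻¹ • (ε.op V hV - (p : ℝ) • LinearMap.id) ∘ₗ binom V hV p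

theorem binom_zero {V : Opens M} (hV : V ≤ U) (f : O.obj V) : ε.binom V hV 0 f = f := rfl

theorem binom_succ {V : Opens M} (hV : V ≤ U) (p : ℕ) (f : O.obj V) :
    ((p + 1 : ℕ) : ℝ) • ε.binom V hV (p + 1) f =
      ε.op V hV (ε.binom V hV p f) - (p : ℝ) • ε.binom V hV p f := by
  have h : ((p + 1 : ℕ) : ℝ) ≠ 0 := by positivity
  simp only [binom, LinearMap.smul_apply, LinearMap.comp_apply, LinearMap.sub_apply,
    LinearMap.id_apply]
  rw [smul_inv_smul₀ h]

theorem binom_succ' {V : Opens M} (hV : V ≤ U) (p : ℕ) (f : O.obj V) :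
    ε.binom V hV (p + 1) f = ((p + 1 : ℕ) : ℝ)⁻¹ •
      (ε.op V hV (ε.binom V hV p f) - (p : ℝ) • ε.binom V hV p f) := rfl

theorem binom_res {V V' : Opens M} (hV : V ≤ U) (h : V' ≤ V) (p : ℕ) (f : O.obj V) :
    ε.binom V' (h.trans hV) p (O.res h f) = O.res h (ε.binom V hV p f) := by
  induction p with
  | zero => rfl
  | succ p ih => rw [binom_succ', binom_succ' _ hV, ih, ε.res hV h]; simp

theorem binom_deg {V : Opens M} (hV : V ≤ U) {j : ℤ} (p : ℕ) {f : O.obj V} (hf : f ∈ O.deg V j) :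
    ε.binom V hV p f ∈ O.deg V j := by
  induction p with
  | zero => exact hf
  | succ p ih =>
    rw [binom_succ']
    exact Submodule.smul_mem _ _ (Submodule.sub_mem _ (ε.deg hV j _ ih) (Submodule.smul_mem _ _ ih))

theorem binom_filt {V : Opens M} (hV : V ≤ U) {n : ℕ} (p : ℕ) {f : O.obj V} (hf : f ∈ O.F V n) :
    ε.binom V hV p f ∈ O.F V n := by
  induction p with
  | zero => exact hf
  | succ p ih =>
    rw [binom_succ']
    exact Submodule.smul_mem _ _ (Submodule.sub_mem _ (ε.filt hV n _ ih) (Submodule.smul_mem _ _ ih))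

/-- The Vandermonde identity for the derivation `ε`: on a product it acts as the sum of its actions
on the two factors, and these commute. -/
theorem binom_mul {V : Opens M} (hV : V ≤ U) (p : ℕ) (f g : O.obj V) :
    ε.binom V hV p (f * g) = ∑ q ∈ Finset.HasAntidiagonal.antidiagonal p,
      ε.binom V hV q.1 f * ε.binom V hV q.2 g := by
  induction p with
  | zero => simp [binom_zero]
  | succ p ih =>
    have h : ((p + 1 : ℕ) : ℝ) ≠ 0 := by positivity
    refine smul_right_injective _ h ?_
    -- Writing `p + 1 = q.1 + q.2` lets each of the two sums absorb its weight into the recursion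
    -- for one factor.
    have h1 : ((p + 1 : ℕ) : ℝ) • ∑ q ∈ Finset.HasAntidiagonal.antidiagonal (p + 1),
        ε.binom V hV q.1 f * ε.binom V hV q.2 g =
        ∑ q ∈ Finset.HasAntidiagonal.antidiagonal (p + 1),
          (q.1 : ℝ) • (ε.binom V hV q.1 f * ε.binom V hV q.2 g) +
        ∑ q ∈ Finset.HasAntidiagonal.antidiagonal (p + 1),
          (q.2 : ℝ) • (ε.binom V hV q.1 f * ε.binom V hV q.2 g) := by
      rw [Finset.smul_sum, ← Finset.sum_add_distrib]
      refine Finset.sum_congr rfl fun q hq => ?_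
      rw [← Finset.HasAntidiagonal.mem_antidiagonal.1 hq, ← add_smul]
      push_cast
      rfl
    simp only
    rw [h1, Finset.Nat.sum_antidiagonal_succ, Finset.Nat.sum_antidiagonal_succ', binom_succ, ih]
    have e1 : ∀ (q r : ℕ), ((q + 1 : ℕ) : ℝ) • (ε.binom V hV (q + 1) f * ε.binom V hV r g) =
        (ε.op V hV (ε.binom V hV q f) - (q : ℝ) • ε.binom V hV q f) * ε.binom V hV r g := by
      intro q r
      rw [← smul_mul_assoc, binom_succ]
    have e2 : ∀ (q r : ℕ), ((r + 1 : ℕ) : ℝ) • (ε.binom V hV q f * ε.binom V hV (r + 1) g) =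
        ε.binom V hV q f * (ε.op V hV (ε.binom V hV r g) - (r : ℝ) • ε.binom V hV r g) := by
      intro q r
      rw [← mul_smul_comm, binom_succ]
    simp only [Nat.cast_zero, zero_smul, zero_add, e1, e2, map_sum, Finset.smul_sum, ε.leibniz]
    rw [← Finset.sum_sub_distrib, ← Finset.sum_add_distrib]
    refine Finset.sum_congr rfl fun q hq => ?_
    rw [← Finset.HasAntidiagonal.mem_antidiagonal.1 hq]
    simp only [sub_mul, mul_sub, smul_mul_assoc, mul_smul_comm, Nat.cast_add, add_smul]
    abel

/-- Each factor `ε - p` maps `I^p` into `I^(p+1)`, so the product of the first `p` of them maps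
everything into `I^p`. -/
theorem binom_mem {x : U} {V : Opens M} (hV : V ≤ U) (hx : V ≤ A.dom x) (p n : ℕ) (f : O.obj V) :
    ε.binom V hV p f ∈ O.Ipow V p ⊔ O.F V n := by
  induction p with
  | zero => exact Submodule.mem_sup_left trivial
  | succ p ih =>
    rw [binom_succ']
    exact Submodule.smul_mem _ _ (ε.sub_mem hV hx ih)

/-- On `I^p / I^(p+1)` the operator `ε` is the scalar `p`, so its binomial is the numerical one. The
case `q = p`, with coefficient one, is what compares the new splitting with a local one. -/
theorem binom_sub_mem {x : U} {V : Opens M} (hV : V ≤ U) (hx : V ≤ A.dom x) {p n : ℕ}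
    {f : O.obj V} (hf : f ∈ O.Ipow V p ⊔ O.F V n) (q : ℕ) :
    ε.binom V hV q f - (p.choose q : ℝ) • f ∈ O.Ipow V (p + 1) ⊔ O.F V n := by
  have hle : O.Ipow V (p + 1) ⊔ O.F V n ≤ O.Ipow V p ⊔ O.F V n :=
    sup_le_sup_right (Ipow_succ_le V p) _
  induction q with
  | zero => simp [binom_zero]
  | succ q ih =>
    have h : ((q + 1 : ℕ) : ℝ) ≠ 0 := by positivity
    have h1 := ε.sub_mem hV hx hf
    have h2 : ε.op V hV (ε.binom V hV q f - (p.choose q : ℝ) • f) ∈ O.Ipow V (p + 1) ⊔ O.F V n := by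
      have := Submodule.add_mem _ (sup_le_sup_right (Ipow_succ_le V (p + 1)) _ (ε.sub_mem hV hx ih))
        (Submodule.smul_mem _ ((p + 1 : ℕ) : ℝ) ih)
      simpa using this
    have h3 : ((q + 1 : ℕ) : ℝ) • (ε.binom V hV (q + 1) f - (p.choose (q + 1) : ℝ) • f) =
        ε.op V hV (ε.binom V hV q f - (p.choose q : ℝ) • f) +
        ((p.choose q : ℝ) • (ε.op V hV f - (p : ℝ) • f) -
        (q : ℝ) • (ε.binom V hV q f - (p.choose q : ℝ) • f)) := by
      rw [smul_sub, binom_succ, map_sub, map_smul, smul_smul]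
      -- Also true for `q > p`, where `p - q` is a negative real but both binomial coefficients
      -- vanish.
      have h4 : ((q + 1 : ℕ) : ℝ) * (p.choose (q + 1) : ℝ) = (p.choose q : ℝ) * ((p : ℝ) - q) := by
        rcases le_or_gt q p with hqp | hqp
        · have := Nat.choose_succ_right_eq p q
          rw [← Nat.cast_sub hqp, ← Nat.cast_mul, ← Nat.cast_mul, ← this, mul_comm]
        · rw [Nat.choose_eq_zero_of_lt hqp, Nat.choose_eq_zero_of_lt (by omega)]
          simp
      rw [h4]
      module
    rw [← Submodule.smul_mem_iff _ h, h3]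
    exact Submodule.add_mem _ h2 (Submodule.sub_mem _ (Submodule.smul_mem _ _ h1)
      (Submodule.smul_mem _ _ ih))

end EulerField
end GradedSpace
end GradedQ

/-! ### Locality, gluing, and the splitting map defined by an Euler vector field. -/

namespace GradedQ

universe u v v'
variable {d : ℕ} {M : Type u} [TopologicalSpace M] [ChartedSpace (EuclideanSpace ℝ (Fin d)) M]

namespace GradedSpace

variable {O : GradedSpace.{u, v} d M}

/-- The gluing axiom holds degree by degree only, so uniqueness of gluing is applied to each
homogeneous component, compared with the zero family. -/
theorem eq_zero_of_local {V : Opens M} {f : O.obj V}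
    (h : ∀ x ∈ V, ∃ (V' : Opens M) (h : V' ≤ V), x ∈ V' ∧ O.res h f = 0) : f = 0 := by
  classical
  suffices H : ∀ j, (DirectSum.decompose (O.deg V) f j : O.obj V) = 0 by
    rw [← DirectSum.sum_support_decompose (O.deg V) f]
    exact Finset.sum_eq_zero fun j _ => H j
  intro j
  have hres : ∀ {V' : Opens M} (h : V' ≤ V) (g : O.obj V),
      (DirectSum.decompose (O.deg V') (O.res h g) j : O.obj V') =
        O.res h (DirectSum.decompose (O.deg V) g j : O.obj V) := by
    intro V' h g
    induction g using deg_induction with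
    | h0 => simp
    | hj i g hg =>
      by_cases hij : i = j
      · subst hij
        rw [DirectSum.decompose_of_mem_same _ hg,
          DirectSum.decompose_of_mem_same _ (O.res_deg h i g hg)]
      · rw [DirectSum.decompose_of_mem_ne _ hg hij,
          DirectSum.decompose_of_mem_ne _ (O.res_deg h i g hg) hij, map_zero]
    | ha a b h1 h2 => simp [DirectSum.decompose_add, h1, h2]
  set g : O.obj V := (DirectSum.decompose (O.deg V) f j : O.obj V) with hg
  have hgj : g ∈ O.deg V j := (DirectSum.decompose (O.deg V) f j).2
  let S : Set (Opens M) := {V' | ∃ h : V' ≤ V, O.res h f = 0}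
  have hS : sSup S = V := by
    refine le_antisymm (sSup_le fun V' h => h.1) fun x hx => ?_
    obtain ⟨V', h1, h2, h3⟩ := h x hx
    exact Opens.mem_sSup.2 ⟨V', ⟨h1, h3⟩, h2⟩
  obtain ⟨w, -, hw⟩ := O.glue j S (fun _ => 0) (fun _ => Submodule.zero_mem _) (by simp)
  have h0 : (0 : O.obj (sSup S)) = w := hw _ ⟨Submodule.zero_mem _, by simp⟩
  have h1 : O.res hS.le g = w := by
    refine hw _ ⟨O.res_deg _ _ _ hgj, fun V' => ?_⟩
    rw [O.res_res, hg, ← hres (V'.2.1) f, V'.2.2]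
    simp
  have h2 := congrArg (O.res hS.ge) (h1.trans h0.symm)
  rw [O.res_res, O.res_refl, map_zero] at h2
  exact h2

theorem eq_of_local {V : Opens M} {f g : O.obj V}
    (h : ∀ x ∈ V, ∃ (V' : Opens M) (h : V' ≤ V), x ∈ V' ∧ O.res h f = O.res h g) : f = g := by
  refine sub_eq_zero.1 (eq_zero_of_local fun x hx => ?_)
  obtain ⟨V', h1, h2, h3⟩ := h x hx
  exact ⟨V', h1, h2, by rw [map_sub, h3, sub_self]⟩

/-- Independence of the symbol at a point, for two isomorphisms used on two different neighbourhoods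
of it: both are restricted to the intersection. -/
theorem Iso.Adapted.bicoeff_res_eq {N N' : Opens M} {Φ : O.Iso N O.dualFamily}
    {Φ' : O.Iso N' O.dualFamily} (hΦ : Φ.Adapted) (hΦ' : Φ'.Adapted) {V V₁ V₂ : Opens M}
    (h₁ : V₁ ≤ V) (hN : V₁ ≤ N) (h₂ : V₂ ≤ V) (hN' : V₂ ≤ N') (x : M) (hx₁ : x ∈ V₁) (hx₂ : x ∈ V₂)
    {p n : ℕ} (f : O.obj V)
    (hf : ∀ (V' : Opens M) (h : V' ≤ V), V' ≤ N' → O.res h f ∈ O.Ipow V' p ⊔ O.F V' (n + 1)) :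
    GSym.bicoeff p n (Φ.app hN ⟨x, hx₁⟩ (O.res h₁ f)) =
      GSym.bicoeff p n (Φ'.app hN' ⟨x, hx₂⟩ (O.res h₂ f)) := by
  have e1 := Φ.app_res hN (inf_le_left : V₁ ⊓ V₂ ≤ V₁) (O.res h₁ f) ⟨x, hx₁, hx₂⟩
  have e2 := Φ'.app_res hN' (inf_le_right : V₁ ⊓ V₂ ≤ V₂) (O.res h₂ f) ⟨x, hx₁, hx₂⟩
  rw [O.res_res] at e1 e2
  have e3 := hΦ.bicoeff_eq hΦ' (inf_le_left.trans hN : V₁ ⊓ V₂ ≤ N)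
    (inf_le_right.trans hN' : V₁ ⊓ V₂ ≤ N')
    (hf (V₁ ⊓ V₂) (inf_le_left.trans h₁) (inf_le_right.trans hN')) ⟨x, hx₁, hx₂⟩ n.lt_succ_self
  rw [e1, e2] at e3
  exact e3

/-- Gluing of sections of a fixed degree given near each point. -/
theorem exists_glue {V : Opens M} (j : ℤ) (V' : V → Opens M) (hV' : ∀ x, V' x ≤ V)
    (hx : ∀ x, x.1 ∈ V' x) (s : ∀ x, O.obj (V' x)) (hs : ∀ x, s x ∈ O.deg (V' x) j)
    (hc : ∀ x y, O.res (inf_le_left : V' x ⊓ V' y ≤ V' x) (s x) =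
      O.res (inf_le_right : V' x ⊓ V' y ≤ V' y) (s y)) :
    ∃ f ∈ O.deg V j, ∀ x, O.res (hV' x) f = s x := by
  classical
  let S : Set (Opens M) := Set.range V'
  have hS : sSup S = V := by
    refine le_antisymm (sSup_le ?_) fun x h => Opens.mem_sSup.2 ⟨V' ⟨x, h⟩, ⟨_, rfl⟩, hx ⟨x, h⟩⟩
    rintro _ ⟨x, rfl⟩
    exact hV' x
  -- Different points may have the same neighbourhood, whereas the axiom `glue` is indexed by open
  -- sets. One point is chosen for each open set.
  let y : S → V := fun T => T.2.choose
  have hy : ∀ T : S, V' (y T) = T.1 := fun T => T.2.choose_spec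
  have hcc : ∀ x y (T : Opens M) (h1 : T ≤ V' x) (h2 : T ≤ V' y),
      O.res h1 (s x) = O.res h2 (s y) := by
    intro x y T h1 h2
    have := congrArg (O.res (le_inf h1 h2)) (hc x y)
    rwa [O.res_res, O.res_res] at this
  obtain ⟨f, ⟨hf, hfs⟩, -⟩ := O.glue j S (fun T => O.res (hy T).ge (s (y T)))
    (fun T => O.res_deg _ _ _ (hs _)) (fun T T' => by
      simp only [O.res_res]
      exact hcc _ _ _ _ _)
  refine ⟨O.res hS.ge f, O.res_deg _ _ _ hf, fun x => ?_⟩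
  have h1 := hfs ⟨V' x, ⟨x, rfl⟩⟩
  rw [O.res_res]
  rw [h1, hcc _ x _ (hy _).ge le_rfl, O.res_refl]

namespace EulerField

variable {U : Opens M} {A : O.SplittingAtlas U} (ε : EulerField A)

/-- The part of polynomial degree `p` and negative degree `n` at `x` of the image of `f` in the
splitting defined by `ε`. -/
noncomputable def symb {V : Opens M} (hV : V ≤ U) (x : V) (p n : ℕ) :
    O.obj V →ₗ[ℝ] O.dualFamily.Sym x.1 :=
  GSym.bicoeff p n ∘ₗ
    ((A.iso ⟨x.1, hV x.2⟩).app (inf_le_left : A.dom ⟨x.1, hV x.2⟩ ⊓ V ≤ _)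
      ⟨x.1, A.mem ⟨x.1, hV x.2⟩, x.2⟩).toLinearMap ∘ₗ
    (O.res (inf_le_right : A.dom ⟨x.1, hV x.2⟩ ⊓ V ≤ V)).toLinearMap ∘ₗ ε.binom V hV p

theorem symb_apply {V : Opens M} (hV : V ≤ U) (x : V) (p n : ℕ) (f : O.obj V) :
    ε.symb hV x p n f = GSym.bicoeff p n ((A.iso ⟨x.1, hV x.2⟩).app
      (inf_le_left : A.dom ⟨x.1, hV x.2⟩ ⊓ V ≤ _) ⟨x.1, A.mem ⟨x.1, hV x.2⟩, x.2⟩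
      (O.res inf_le_right (ε.binom V hV p f))) := rfl

/-- Any domain of the atlas containing the point gives the same value, because `binom(ε, p) f` lies
in `I^p` up to the filtration and symbols are canonical there. -/
theorem symb_eq {V V' : Opens M} (hV : V ≤ U) (h : V' ≤ V) (y : U) (hy : V' ≤ A.dom y) (x : V')
    (p n : ℕ) (f : O.obj V) : ε.symb hV ⟨x.1, h x.2⟩ p n f =
      GSym.bicoeff p n ((A.iso y).app hy x (ε.binom V' (h.trans hV) p (O.res h f))) := by
  rw [ε.binom_res hV h]
  refine (ε.symb_apply hV ⟨x.1, h x.2⟩ p n f).trans ?_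
  refine (A.adapted _).bicoeff_res_eq (A.adapted y) inf_le_right inf_le_left h hy x.1 _ x.2 _
    fun V'' h1 h2 => ?_
  rw [← ε.binom_res hV h1]
  exact ε.binom_mem _ h2 _ _ _

theorem symb_eq' {V : Opens M} (hV : V ≤ U) (y : U) (hy : V ≤ A.dom y) (x : V)
    (p n : ℕ) (f : O.obj V) : ε.symb hV x p n f =
      GSym.bicoeff p n ((A.iso y).app hy x (ε.binom V hV p f)) := by
  rw [ε.symb_eq hV le_rfl y hy x p n f, O.res_refl]

theorem symb_res {V V' : Opens M} (hV : V ≤ U) (h : V' ≤ V) (x : V') (p n : ℕ) (f : O.obj V) :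
    ε.symb (h.trans hV) x p n (O.res h f) = ε.symb hV ⟨x.1, h x.2⟩ p n f := by
  set z : U := ⟨x.1, hV (h x.2)⟩ with hz
  have hx : x.1 ∈ A.dom z ⊓ V' := ⟨A.mem z, x.2⟩
  refine (ε.symb_eq (h.trans hV) (inf_le_right : A.dom z ⊓ V' ≤ V') z inf_le_left ⟨x.1, hx⟩
    p n (O.res h f)).trans (Eq.trans ?_ (ε.symb_eq hV (inf_le_right.trans h : A.dom z ⊓ V' ≤ V) z
    inf_le_left ⟨x.1, hx⟩ p n f).symm)
  rw [O.res_res]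

theorem symb_eq_zero {V : Opens M} (hV : V ≤ U) {j : ℤ} {f : O.obj V} (hf : f ∈ O.deg V j) (x : V)
    {p n : ℕ} (hp : j + 2 * n < p) : ε.symb hV x p n f = 0 :=
  (ε.symb_apply hV x p n f).trans <| GSym.comp_eq_zero_of_bideg ((A.iso _).bideg_coeff _
    (O.res_deg _ _ _ (ε.binom_deg hV p hf)) _ _) hp

theorem comp_symb {V : Opens M} (hV : V ≤ U) (x : V) (p q n : ℕ) (f : O.obj V) :
    GSym.comp q (ε.symb hV x p n f) = if q = p then ε.symb hV x p n f else 0 := by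
  change GSym.comp q (GSym.comp p _) = _
  rw [GSym.comp_comp]
  split_ifs with h
  · subst h; rfl
  · rfl

/-- For homogeneous `f` the degree bound leaves finitely many polynomial degrees for each negative
degree, and a general `f` is a finite sum of homogeneous ones. -/
theorem exists_series {V : Opens M} (hV : V ≤ U) (x : V) (f : O.obj V) :
    ∃ s : O.dualFamily.CSym x.1, ∀ p n, GSym.bicoeff p n s = ε.symb hV x p n f := by
  induction f using deg_induction with
  | h0 => exact ⟨0, by simp⟩
  | hj j f hf =>
    refine ⟨PowerSeries.mk fun n => ∑ p ∈ Finset.range ((j + 2 * n).toNat + 1),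
      ε.symb hV x p n f, fun p n => ?_⟩
    rw [GSym.bicoeff_apply, PowerSeries.coeff_mk, map_sum]
    simp only [comp_symb]
    rw [Finset.sum_ite_eq]
    split_ifs with h
    · rfl
    · rw [ε.symb_eq_zero hV hf]
      simp at h
      omega
  | ha a b h h' =>
    obtain ⟨s, hs⟩ := h
    obtain ⟨t, ht⟩ := h'
    exact ⟨s + t, fun p n => by rw [map_add, hs, ht, map_add]⟩

/-- Vandermonde for `binom(ε, p)` combined with multiplicativity of leading symbols. -/
theorem symb_mul {V : Opens M} (hV : V ≤ U) (x : V) (p n : ℕ) (f g : O.obj V) :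
    ε.symb hV x p n (f * g) = ∑ i ∈ Finset.HasAntidiagonal.antidiagonal n,
      ∑ q ∈ Finset.HasAntidiagonal.antidiagonal p,
        ε.symb hV x q.1 i.1 f * ε.symb hV x q.2 i.2 g := by
  set z : U := ⟨x.1, hV x.2⟩ with hz
  set N := A.dom z ⊓ V with hN
  have hx : x.1 ∈ N := ⟨A.mem z, x.2⟩
  have hNV : N ≤ V := inf_le_right
  have hNz : N ≤ A.dom z := inf_le_left
  have e : ∀ p n f, ε.symb hV x p n f = GSym.bicoeff p n ((A.iso z).app hNz ⟨x.1, hx⟩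
      (ε.binom N (hNV.trans hV) p (O.res hNV f))) :=
    fun p n f => ε.symb_eq hV hNV z hNz ⟨x.1, hx⟩ p n f
  have hv : ∀ p f, GSym.Vanish p (n + 1) ((A.iso z).app hNz ⟨x.1, hx⟩
      (ε.binom N (hNV.trans hV) p (O.res hNV f))) :=
    fun p f => (A.iso z).vanish_of_mem hNz (ε.binom_mem _ hNz _ _ _) _
  simp only [e, map_mul (O.res hNV), binom_mul, map_sum, map_mul ((A.iso z).app hNz ⟨x.1, hx⟩)]
  rw [Finset.sum_comm]
  refine Finset.sum_congr rfl fun q hq => ?_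
  have h1 := Finset.HasAntidiagonal.mem_antidiagonal.1 hq
  rw [← h1, (hv q.1 f).bicoeff_mul (hv q.2 g) n.lt_succ_self]

theorem symb_one {V : Opens M} (hV : V ≤ U) (x : V) (p n : ℕ) :
    ε.symb hV x p n 1 = GSym.bicoeff p n (1 : O.dualFamily.CSym x.1) := by
  have h1 : ε.op V hV 1 = 0 := by
    have := ε.leibniz hV 1 1
    simpa using this
  have h2 : ∀ p, ε.binom V hV (p + 1) 1 = 0 := by
    intro p
    induction p with
    | zero => simp [binom_succ', binom_zero, h1]
    | succ p ih => rw [binom_succ', ih]; simp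
  cases p with
  | zero => simp [symb, binom_zero]
  | succ p =>
    rw [GSym.bicoeff_apply, PowerSeries.coeff_one]
    simp only [symb, LinearMap.comp_apply, h2]
    have := GSym.comp_prodι (p + 1) ([] : List (Σ k, O.dualFamily.fib k x.1))
    rw [GSym.prodι_nil, if_neg (by simp)] at this
    split_ifs <;> simp [this]

/-- The splitting defined by `ε`, as a morphism of algebras into formal series at `x`. -/
noncomputable def glob {V : Opens M} (hV : V ≤ U) (x : V) :
    O.obj V →ₐ[ℝ] O.dualFamily.CSym x.1 :=
  AlgHom.ofLinearMap
    { toFun := fun f => (ε.exists_series hV x f).choose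
      map_add' := fun f g => GSym.ext_bicoeff fun p n => by
        rw [map_add, (ε.exists_series hV x _).choose_spec, (ε.exists_series hV x _).choose_spec,
          (ε.exists_series hV x _).choose_spec, map_add]
      map_smul' := fun c f => GSym.ext_bicoeff fun p n => by
        rw [RingHom.id_apply, map_smul, (ε.exists_series hV x _).choose_spec,
          (ε.exists_series hV x _).choose_spec, map_smul] }
    (GSym.ext_bicoeff fun p n =>
      ((ε.exists_series hV x _).choose_spec p n).trans (ε.symb_one hV x p n))
    (fun f g => GSym.ext_bicoeff fun p n => by
      refine ((ε.exists_series hV x _).choose_spec p n).trans ?_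
      rw [GSym.bicoeff_mul, symb_mul]
      refine Finset.sum_congr rfl fun i _ => Finset.sum_congr rfl fun q _ => ?_
      exact congrArg₂ _ ((ε.exists_series hV x _).choose_spec _ _).symm
        ((ε.exists_series hV x _).choose_spec _ _).symm)

theorem bicoeff_glob {V : Opens M} (hV : V ≤ U) (x : V) (f : O.obj V) (p n : ℕ) :
    GSym.bicoeff p n (ε.glob hV x f) = ε.symb hV x p n f :=
  (ε.exists_series hV x f).choose_spec p n

theorem glob_res {V V' : Opens M} (hV : V ≤ U) (h : V' ≤ V) (x : V') (f : O.obj V) :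
    ε.glob (h.trans hV) x (O.res h f) = ε.glob hV ⟨x.1, h x.2⟩ f :=
  GSym.ext_bicoeff fun p n => (ε.bicoeff_glob (h.trans hV) x (O.res h f) p n).trans
    ((ε.symb_res hV h x p n f).trans (ε.bicoeff_glob hV ⟨x.1, h x.2⟩ f p n).symm)

/-- Inside a domain of the atlas each coefficient is a finite sum of polynomial components of smooth
sections. -/
theorem glob_mem {V : Opens M} (hV : V ≤ U) {j : ℤ} {f : O.obj V} (hf : f ∈ O.deg V j) :
    (fun x => ε.glob hV x f) ∈ O.dualFamily.homSections V j := by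
  refine GradedFamily.homSections_of_local fun x => ?_
  set z : U := ⟨x.1, hV x.2⟩ with hz
  set N := A.dom z ⊓ V with hN
  have hx : x.1 ∈ N := ⟨A.mem z, x.2⟩
  have hNV : N ≤ V := inf_le_right
  have hNz : N ≤ A.dom z := inf_le_left
  refine ⟨N, hNV, hx, fun n => ?_⟩
  have e : (fun y : N => PowerSeries.coeff n (ε.glob hV ⟨y.1, hNV y.2⟩ f)) =
      ∑ p ∈ Finset.range ((j + 2 * n).toNat + 1), fun y : N => GSym.comp p
        (PowerSeries.coeff n ((A.iso z).app hNz y (ε.binom N (hNV.trans hV) p (O.res hNV f)))) := by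
    funext y
    rw [Finset.sum_apply]
    refine GSym.ext_comp fun q => ?_
    refine (ε.bicoeff_glob hV ⟨y.1, hNV y.2⟩ f q n).trans ?_
    rw [map_sum]
    refine Eq.trans ?_ (Finset.sum_congr rfl fun p _ =>
      ((congrArg (GSym.comp q) (ε.symb_eq hV hNV z hNz y p n f).symm).trans
        (ε.comp_symb hV ⟨y.1, hNV y.2⟩ p q n f)).symm)
    rw [Finset.sum_ite_eq]
    split_ifs with h
    · rfl
    · rw [ε.symb_eq_zero hV hf]
      simp at h
      omega
  rw [e]
  refine Submodule.sum_mem _ fun p _ => GradedFamily.comp_mem_symSections p ?_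
  exact ((A.iso z).mem_deg_iff hNz).1 (ε.binom_deg _ p (O.res_deg _ _ _ hf)) n

/-! ### Comparison with the local splittings -/

/-- On `I^p` the operator `binom(ε, p)` is the identity modulo `I^(p+1)`, so the new splitting and
the local one have the same leading term. -/
theorem bicoeff_glob_eq {V : Opens M} (hV : V ≤ U) (y : U) (hy : V ≤ A.dom y) {p n : ℕ}
    {f : O.obj V} (hf : f ∈ O.Ipow V p ⊔ O.F V n) (x : V) {m : ℕ} (hm : m < n) :
    GSym.bicoeff p m (ε.glob hV x f) = GSym.bicoeff p m ((A.iso y).app hy x f) := by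
  rw [bicoeff_glob, ε.symb_eq' hV y hy, ← sub_eq_zero, ← map_sub, ← map_sub]
  have := ε.binom_sub_mem hV hy hf p
  rw [Nat.choose_self, Nat.cast_one, one_smul] at this
  exact (A.iso y).vanish_of_mem hy this x p p.lt_succ_self m hm

theorem vanish_glob {V : Opens M} (hV : V ≤ U) (y : U) (hy : V ≤ A.dom y) {p n : ℕ}
    {f : O.obj V} (hf : f ∈ O.Ipow V p ⊔ O.F V n) (x : V) :
    GSym.Vanish p n (ε.glob hV x f) := by
  intro q hq m hm
  rw [ε.bicoeff_glob_eq hV y hy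
    ((sup_le_sup_right (Ipow_antitone V hq.le) _ : _ ≤ O.Ipow V q ⊔ O.F V n) hf) x hm]
  exact (A.iso y).vanish_of_mem hy hf x q hq m hm

/-- Induction on the order: once `f` is known to be of order `p`, its next term is the same in the
local splitting, where `dense` applies. -/
theorem mem_of_vanish_glob {V : Opens M} (hV : V ≤ U) (y : U) (hy : V ≤ A.dom y) {p n : ℕ} {j : ℤ}
    {f : O.obj V} (hf : f ∈ O.deg V j) (h : ∀ x, GSym.Vanish p n (ε.glob hV x f)) :
    f ∈ O.Ipow V p ⊔ O.F V n := by
  induction p with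
  | zero => exact Submodule.mem_sup_left trivial
  | succ p ih =>
    have h1 := ih fun x => (h x).mono p.le_succ le_rfl
    refine (A.adapted y).dense hy j _ _ f hf fun x q hq m hm => ?_
    rcases Nat.lt_succ_iff_lt_or_eq.1 hq with hq | rfl
    · exact (A.iso y).vanish_of_mem hy h1 x q hq m hm
    · rw [← ε.bicoeff_glob_eq hV y hy h1 x hm]
      exact h x q q.lt_succ_self m hm

/-- Below negative degree `n` the series vanishes to every polynomial order, so `f` lies in `I^p +
F^n` for all `p`, and the local coefficients vanish. -/
theorem mem_F_of_glob_of_deg {V : Opens M} (hV : V ≤ U) (y : U) (hy : V ≤ A.dom y) {n : ℕ} {j : ℤ}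
    {f : O.obj V} (hf : f ∈ O.deg V j)
    (h : ∀ x, ∀ m < n, PowerSeries.coeff m (ε.glob hV x f) = 0) : f ∈ O.F V n := by
  refine ((A.iso y).mem_F_iff hy).2 fun x m hm => GSym.ext_comp fun p => ?_
  have := ε.mem_of_vanish_glob hV y hy (p := p + 1) (n := n) hf fun x q _ m hm => by
    rw [GSym.bicoeff_apply, h x m hm, map_zero]
  rw [map_zero]
  exact (A.iso y).vanish_of_mem hy this x p p.lt_succ_self m hm

theorem coeff_glob_of_mem_F {V : Opens M} (hV : V ≤ U) {n : ℕ} {f : O.obj V} (hf : f ∈ O.F V n)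
    (x : V) {m : ℕ} (hm : m < n) : PowerSeries.coeff m (ε.glob hV x f) = 0 := by
  refine GSym.ext_comp fun p => ?_
  rw [← GSym.bicoeff_apply, bicoeff_glob, map_zero, symb_apply]
  exact (A.iso _).vanish_of_mem_F _ (O.res_F _ _ _ (ε.binom_filt hV p hf)) (p + 1) _ p
    p.lt_succ_self m hm

end EulerField
end GradedSpace
end GradedQ

/-! ### Bijectivity of the splitting map. -/

namespace GradedQ

universe u v v'
variable {d : ℕ} {M : Type u} [TopologicalSpace M] [ChartedSpace (EuclideanSpace ℝ (Fin d)) M]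

namespace GradedFamily

variable {W : GradedFamily.{u, v} d M}

theorem homSections_res {U V : Opens M} (hVU : V ≤ U) {j : ℤ} {s : ∀ x : U, W.CSym x.1}
    (hs : s ∈ W.homSections U j) : (fun x : V => s ⟨x.1, hVU x.2⟩) ∈ W.homSections V j :=
  fun n => symSections_res hVU (hs n)

theorem monomial_coeff_mem_homSections {U : Opens M} {j : ℤ} (m : ℕ) {s : ∀ x : U, W.CSym x.1}
    (hs : s ∈ W.homSections U j) :
    (fun x => PowerSeries.monomial m (PowerSeries.coeff m (s x)) : ∀ x : U, W.CSym x.1) ∈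
      W.homSections U j := by
  intro n
  by_cases h : n = m
  · subst h
    simpa [PowerSeries.coeff_monomial] using hs n
  · simp only [PowerSeries.coeff_monomial, if_neg h]
    exact Submodule.zero_mem _

end GradedFamily

namespace GradedSpace

variable {O : GradedSpace.{u, v} d M}

/-- Independence of sections of different total degree is transported from the grading of `O`. -/
theorem Iso.homSections_independent {N : Opens M} {W : GradedFamily.{u, v'} d M} (Φ : O.Iso N W)
    {V : Opens M} (hV : V ≤ N) (T : Finset ℤ) (s : ℤ → ∀ x : V, W.CSym x.1)
    (hs : ∀ j, s j ∈ W.homSections V j) (h : ∀ x, ∑ j ∈ T, s j x = 0) :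
    ∀ j ∈ T, ∀ x, s j x = 0 := by
  choose g hg hgs using fun j => Φ.exists_app_eq hV (hs j)
  have h0 : ∑ j ∈ T, g j = 0 := Φ.app_ext hV fun x => by
    rw [map_sum, map_zero, ← h x]
    exact Finset.sum_congr rfl fun j _ => hgs j x
  intro i hi x
  have h1 : (DirectSum.decompose (O.deg V) (∑ j ∈ T, g j) i : O.obj V) = g i := by
    rw [DirectSum.decompose_sum, DFinsupp.finsetSum_apply, AddSubmonoidClass.coe_finsetSum,
      Finset.sum_eq_single i]
    · exact DirectSum.decompose_of_mem_same _ (hg i)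
    · exact fun j _ hj => DirectSum.decompose_of_mem_ne _ (hg j) hj
    · exact fun h => absurd hi h
  rw [h0] at h1
  rw [← hgs, ← h1]
  simp

namespace EulerField

variable {U : Opens M} {A : O.SplittingAtlas U} (ε : EulerField A)

/-- The series of `f` mixes total degrees. Its truncation to one negative degree is a sum of
homogeneous sections, so independence gives the vanishing for each component of `f` separately. -/
theorem mem_F_of_glob {V : Opens M} (hV : V ≤ U) {n : ℕ} {f : O.obj V}
    (h : ∀ x, ∀ m < n, PowerSeries.coeff m (ε.glob hV x f) = 0) : f ∈ O.F V n := by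
  classical
  rw [← DirectSum.sum_support_decompose (O.deg V) f]
  refine Submodule.sum_mem _ fun i hi => O.F_local _ _ _ fun x hx => ?_
  set T := (DirectSum.decompose (O.deg V) f).support
  set g : ℤ → O.obj V := fun j => (DirectSum.decompose (O.deg V) f j : O.obj V) with hg
  have hgj : ∀ j, g j ∈ O.deg V j := fun j => (DirectSum.decompose (O.deg V) f j).2
  set z : U := ⟨x, hV hx⟩ with hz
  set N := A.dom z ⊓ V with hN
  have hNV : N ≤ V := inf_le_right
  have hNz : N ≤ A.dom z := inf_le_left
  refine ⟨N, hNV, ⟨A.mem z, hx⟩, ?_⟩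
  refine ε.mem_F_of_glob_of_deg (hNV.trans hV) z hNz (O.res_deg hNV i _ (hgj i)) fun y m hm => ?_
  have h1 := (A.iso z).homSections_independent hNz T
    (fun j y => PowerSeries.monomial m
      (PowerSeries.coeff m (ε.glob (hNV.trans hV) y (O.res hNV (g j)))))
    (fun j => GradedFamily.monomial_coeff_mem_homSections m
      (ε.glob_mem (hNV.trans hV) (O.res_deg hNV j _ (hgj j)))) (fun y => by
      rw [← map_sum, ← map_sum, ← map_sum, ← map_sum, DirectSum.sum_support_decompose]
      rw [show PowerSeries.coeff m (ε.glob (hNV.trans hV) y (O.res hNV f)) = 0 from ?_, map_zero]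
      rw [ε.glob_res hV hNV y f]
      exact h _ m hm) i hi y
  have h2 := congrArg (PowerSeries.coeff m) h1
  rwa [PowerSeries.coeff_monomial_same, map_zero] at h2

theorem glob_ext {V : Opens M} (hV : V ≤ U) {f g : O.obj V}
    (h : ∀ x, ε.glob hV x f = ε.glob hV x g) : f = g := by
  rw [← sub_eq_zero]
  refine eq_zero_of_local fun x hx => ⟨A.dom ⟨x, hV hx⟩ ⊓ V, inf_le_right, ⟨A.mem _, hx⟩, ?_⟩
  refine (A.iso ⟨x, hV hx⟩).eq_zero_of_forall_mem_F inf_le_left fun n => O.res_F _ _ _ ?_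
  exact ε.mem_F_of_glob hV fun y m _ => by rw [map_sub, h y, sub_self, map_zero]

/-- Successive approximation: the error `s - glob f` is lifted through the local isomorphism and
added to `f`. Since leading terms agree, the order of the error rises by one at each step. -/
theorem exists_glob_eq_of_le {V : Opens M} (hV : V ≤ U) (y : U) (hy : V ≤ A.dom y) {j : ℤ}
    {s : ∀ x : V, O.dualFamily.CSym x.1} (hs : s ∈ O.dualFamily.homSections V j) :
    ∃ f ∈ O.deg V j, ∀ x, ε.glob hV x f = s x := by
  have key : ∀ f : O.deg V j, ∃ f' : O.deg V j, ∀ x,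
      (A.iso y).app hy x (f'.1 - f.1) = s x - ε.glob hV x f.1 := by
    intro f
    obtain ⟨a, ha, hax⟩ := (A.iso y).exists_app_eq hy (j := j)
      (s := fun x => s x - ε.glob hV x f.1)
      (Submodule.sub_mem _ hs (ε.glob_mem hV f.2))
    exact ⟨f + ⟨a, ha⟩, fun x => by simpa using hax x⟩
  choose step hstep using key
  let g : ℕ → O.deg V j := fun i => step^[i] 0
  have hg : ∀ i x, (A.iso y).app hy x ((g (i + 1)).1 - (g i).1) = s x - ε.glob hV x (g i).1 := by
    intro i x
    have : g (i + 1) = step (g i) := Function.iterate_succ_apply' step i 0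
    rw [this]
    exact hstep _ x
  have hvan : ∀ p n x, GSym.Vanish p n (s x - ε.glob hV x (g p).1) := by
    intro p n
    induction p with
    | zero => exact fun x => GSym.vanish_zero_left _ _
    | succ p ih =>
      have h1 : (g (p + 1)).1 - (g p).1 ∈ O.Ipow V p ⊔ O.F V n :=
        (A.adapted y).dense hy j p n _ (Submodule.sub_mem _ (g (p + 1)).2 (g p).2) fun x => by
          rw [hg]; exact ih x
      intro x q hq m hm
      have e : s x - ε.glob hV x (g (p + 1)).1 = (s x - ε.glob hV x (g p).1) -
          ε.glob hV x ((g (p + 1)).1 - (g p).1) := by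
        rw [map_sub]; abel
      rw [e, map_sub]
      rcases Nat.lt_succ_iff_lt_or_eq.1 hq with hq | rfl
      · rw [ih x q hq m hm, ε.vanish_glob hV y hy h1 x q hq m hm, sub_self]
      · rw [ε.bicoeff_glob_eq hV y hy h1 x hm, hg, sub_self]
  -- Below order `p` the error vanishes by construction; from order `p` on, the bidegree leaves no
  -- room. So each coefficient is exact after finitely many steps, and the iterates converge.
  have hcoeff : ∀ (p m : ℕ) x, j + 2 * m < p →
      PowerSeries.coeff m (s x - ε.glob hV x (g p).1) = 0 := by
    intro p m x hp
    refine GSym.ext_comp fun q => ?_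
    rw [map_zero]
    by_cases hq : q < p
    · exact hvan p (m + 1) x q hq m m.lt_succ_self
    · refine GSym.comp_eq_zero_of_bideg (GradedFamily.bideg_of_mem
        ((Submodule.sub_mem _ hs (ε.glob_mem hV (g p).2) :
          s - (fun x => ε.glob hV x (g p).1) ∈ O.dualFamily.homSections V j) m) x) ?_
      have : (p : ℤ) ≤ q := by exact_mod_cast not_lt.1 hq
      omega
  obtain ⟨f, hf, hlim⟩ := (A.iso y).exists_limit hy (j := j) (fun i => (g i).1)
    (fun n => (j + 2 * n).toNat + 1) (fun i => (g i).2) (fun n i hi => by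
      refine ((A.iso y).mem_F_iff hy).2 fun x m hm => ?_
      rw [hg]
      exact hcoeff i m x (by omega))
  refine ⟨f, hf, fun x => PowerSeries.ext fun m => ?_⟩
  -- Late enough that the iterate agrees with the limit modulo `F^(m+1)` and that its own
  -- coefficient `m` is already exact.
  set i := (j + 2 * (m + 1 : ℕ)).toNat + 1 with hi
  have h1 := ε.coeff_glob_of_mem_F hV (hlim (m + 1) i le_rfl) x m.lt_succ_self
  have h2 := hcoeff i m x (by omega)
  rw [map_sub, map_sub, sub_eq_zero] at h1
  rw [map_sub, sub_eq_zero] at h2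
  rw [h1, h2]

/-- Local preimages agree on overlaps by injectivity, hence glue. -/
theorem exists_glob_eq {V : Opens M} (hV : V ≤ U) {j : ℤ}
    {s : ∀ x : V, O.dualFamily.CSym x.1} (hs : s ∈ O.dualFamily.homSections V j) :
    ∃ f ∈ O.deg V j, ∀ x, ε.glob hV x f = s x := by
  let N : V → Opens M := fun x => A.dom ⟨x.1, hV x.2⟩ ⊓ V
  have hN : ∀ x, N x ≤ V := fun x => inf_le_right
  choose g hg hgs using fun x : V => ε.exists_glob_eq_of_le ((hN x).trans hV) ⟨x.1, hV x.2⟩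
    inf_le_left (GradedFamily.homSections_res (hN x) hs)
  obtain ⟨f, hf, hfg⟩ := exists_glue j N hN (fun x => ⟨A.mem _, x.2⟩) g hg fun x y =>
    ε.glob_ext (inf_le_left.trans ((hN x).trans hV)) fun z =>
      ((ε.glob_res ((hN x).trans hV) (inf_le_left : N x ⊓ N y ≤ N x) z (g x)).trans
        (hgs x ⟨z.1, z.2.1⟩)).trans
      ((ε.glob_res ((hN y).trans hV) (inf_le_right : N x ⊓ N y ≤ N y) z (g y)).trans
        (hgs y ⟨z.1, z.2.2⟩)).symm
  refine ⟨f, hf, fun x => ?_⟩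
  have hx : x.1 ∈ N x := ⟨A.mem _, x.2⟩
  have h1 := ε.glob_res hV (hN x) ⟨x.1, hx⟩ f
  rw [hfg x] at h1
  exact h1.symm.trans (hgs x ⟨x.1, hx⟩)

theorem glob_mem_sections {V : Opens M} (hV : V ≤ U) (f : O.obj V) :
    (fun x => ε.glob hV x f) ∈ O.dualFamily.sections V := by
  induction f using deg_induction with
  | h0 =>
    simp only [map_zero]
    exact Subalgebra.zero_mem _
  | hj j f hf => exact O.dualFamily.homSections_le V j (ε.glob_mem hV hf)
  | ha a b h h' =>
    simp only [map_add]
    exact Subalgebra.add_mem _ h h'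

/-- The isomorphism of algebras over `V` defined by `ε`. -/
noncomputable def globEquiv {V : Opens M} (hV : V ≤ U) :
    O.obj V ≃ₐ[ℝ] O.dualFamily.sections V :=
  AlgEquiv.ofBijective ((AlgHom.pi (ε.glob hV)).codRestrict (O.dualFamily.sections V)
    (ε.glob_mem_sections hV)) (by
    constructor
    · intro f g h
      exact ε.glob_ext hV fun x => congrFun (congrArg Subtype.val h) x
    · rintro ⟨s, hs⟩
      have hs' : s ∈ (⨆ j, O.dualFamily.homSections V j : Submodule ℝ _) := hs
      suffices h : ∃ f, ∀ x, ε.glob hV x f = s x by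
        obtain ⟨f, hf⟩ := h
        exact ⟨f, Subtype.ext (funext hf)⟩
      clear hs
      induction hs' using Submodule.iSup_induction' with
      | mem j s hs =>
        obtain ⟨f, -, hf⟩ := ε.exists_glob_eq hV hs
        exact ⟨f, hf⟩
      | zero => exact ⟨0, fun x => by simp⟩
      | add s t _ _ h h' =>
        obtain ⟨f, hf⟩ := h
        obtain ⟨g, hg⟩ := h'
        exact ⟨f + g, fun x => by rw [map_add, hf, hg]; rfl⟩)

theorem globEquiv_apply {V : Opens M} (hV : V ≤ U) (f : O.obj V) (x : V) :
    (ε.globEquiv hV f).1 x = ε.glob hV x f := rfl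

theorem body_eq {V : Opens M} (hV : V ≤ U) (f : O.obj V) (x : V) :
    O.body V f x = GSym.aug (PowerSeries.coeff 0 (ε.glob hV x f)) := by
  have h : GSym.bicoeff 0 0 (ε.glob hV x f) = algebraMap ℝ _ (O.body V f x) :=
    (ε.bicoeff_glob hV x f 0 0).trans ((ε.symb_apply hV x 0 0 f).trans
      (((A.iso ⟨x.1, hV x.2⟩).bicoeff_zero inf_le_left (O.res inf_le_right f)
        ⟨x.1, A.mem ⟨x.1, hV x.2⟩, x.2⟩ 0).trans (by rw [if_pos rfl, O.body_res])))
  have h1 := congrArg GSym.aug h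
  rw [GSym.bicoeff_apply, GSym.aug_comp, if_pos rfl, AlgHom.commutes] at h1
  exact h1.symm

/-- The isomorphism with the completed symmetric algebra defined by `ε`. -/
noncomputable def toIso : O.Iso U O.dualFamily where
  equiv _ hV := ε.globEquiv hV
  natural _ _ hV h f x := ε.glob_res hV h x f
  deg V hV j f := by
    refine ⟨fun hf => ε.glob_mem hV hf, fun hf => ?_⟩
    obtain ⟨g, hg, h⟩ := ε.exists_glob_eq hV hf
    obtain rfl : g = f := ε.glob_ext hV h
    exact hg
  filt V hV n f :=
    ⟨fun hf x _ hm => ε.coeff_glob_of_mem_F hV hf x hm, fun h => ε.mem_F_of_glob hV h⟩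
  body V hV f x := ε.body_eq hV f x

/-- Functions of degree `-k ≠ 0` lie in `I`, so the linear part can be computed in an adapted
isomorphism. -/
theorem cls_eq_of_glob_eq {V : Opens M} (hV : V ≤ U) (k : ZStar) (f : O.obj V)
    (hf : f ∈ O.deg V (-k.1)) (x : V) :
    GSym.bicoeff 1 k.1.toNat (ε.glob hV x f) =
      GSym.ι (fun k => O.dualFamily.fib k x.1) k (O.cls f k.1 x) := by
  set z : U := ⟨x.1, hV x.2⟩ with hz
  set N := A.dom z ⊓ V with hN
  have hx : x.1 ∈ N := ⟨A.mem z, x.2⟩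
  have hNV : N ≤ V := inf_le_right
  have hNz : N ≤ A.dom z := inf_le_left
  have hfN := O.res_deg hNV _ _ hf
  have hI : O.res hNV f ∈ O.I N := O.body_deg N _ (neg_ne_zero.2 k.2) _ hfN
  have h1 := ε.glob_res hV hNV ⟨x.1, hx⟩ f
  have h2 := ε.bicoeff_glob_eq (hNV.trans hV) z hNz (p := 1) (n := k.1.toNat + 1)
    (Submodule.mem_sup_left (mem_Ipow_one hI)) ⟨x.1, hx⟩ k.1.toNat.lt_succ_self
  have h3 := (A.adapted z).lin hNz k _ hfN ⟨x.1, hx⟩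
  rw [cls_res] at h3
  rw [h1] at h2
  exact h2.trans h3

/-- The splitting defined by an Euler vector field. -/
noncomputable def splitting : O.Splitting U where
  toIso := ε.toIso
  cls_lin V hV k α x := by
    refine GSym.ι_injective (W := fun k => O.dualFamily.fib k x.1) k ?_
    have h0 : ∀ x, ε.glob hV x (ε.toIso.lin hV k α) = O.dualFamily.genSec k α.val x := by
      intro x
      rw [← globEquiv_apply]
      exact congrFun (congrArg Subtype.val ((ε.globEquiv hV).apply_symm_apply _)) x
    have h1 : ε.toIso.lin hV k α ∈ O.deg V (-k.1) := by
      rw [ε.toIso.deg V hV]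
      have := genSec_mem_homSections k α
      convert this using 1
      exact funext h0
    refine (ε.cls_eq_of_glob_eq hV k _ h1 x).symm.trans ?_
    rw [h0, GSym.bicoeff_apply]
    have h2 : PowerSeries.coeff k.1.toNat (O.dualFamily.genSec k α.val x) =
        GSym.ι (fun k => O.dualFamily.fib k x.1) k (α.val x) := PowerSeries.coeff_monomial_same _ _
    rw [h2]
    exact (GSym.comp_ι 1 k _).trans (if_pos rfl)

end EulerField
end GradedSpace
end GradedQ

/-! ### The vector field `Q` in the splitting of a compatible Euler field. -/

namespace GradedQ

universe u v v'

namespace GSym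

variable {W : ZStar → Type v} [∀ k, AddCommGroup (W k)] [∀ k, Module ℝ (W k)]

/-- Words of negative degree zero contain no letter of positive index. This removes the boundary
terms when negative degrees are shifted by one. -/
theorem contract_eq_zero_of_bideg {j : ℤ} {a : GSym W} (h : a ∈ bideg W j 0) {k : ZStar}
    (hk : 0 < k.1) (φ : W k →ₗ[ℝ] ℝ) : contract k φ a = 0 := by
  refine bideg_induction (P := fun a => contract k φ a = 0) (by simp) (fun l h1 h2 => ?_)
    (fun c a h => by simp [h]) (fun a b h h' => by simp [h, h']) h
  clear h h1
  induction l with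
  | nil => simp
  | cons w l ih =>
    simp only [List.map_cons, List.sum_cons, Nat.add_eq_zero_iff] at h2
    rw [prodι_cons, contract_ι_mul, ih h2.2, extend_ne]
    · simp
    · rintro rfl
      omega

end GSym

variable {d : ℕ} {M : Type u} [TopologicalSpace M] [ChartedSpace (EuclideanSpace ℝ (Fin d)) M]

theorem GradedSpace.Iso.contract_bicoeff_zero {O : GradedSpace.{u, v} d M} {N : Opens M}
    {W : GradedFamily.{u, v'} d M} (Φ : O.Iso N W) {V : Opens M} (hV : V ≤ N) (f : O.obj V) (x : V)
    (p : ℕ) {k : ZStar} (hk : 0 < k.1) (φ : W.fib k x.1 →ₗ[ℝ] ℝ) :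
    GSym.contract (W := fun k => W.fib k x.1) k φ (GSym.bicoeff p 0 (Φ.app hV x f)) = 0 := by
  cases p with
  | zero => rw [Φ.bicoeff_zero, Algebra.algebraMap_eq_smul_one]; simp
  | succ p =>
    rw [GSym.bicoeff_apply, ← GSym.comp_contract]
    induction f using deg_induction with
    | h0 => simp
    | hj j f hf => rw [GSym.contract_eq_zero_of_bideg (Φ.bideg_coeff hV hf x 0) hk, map_zero]
    | ha a b h h' => simp only [map_add, h, h', add_zero]

namespace QStructure

open GradedSpace

variable {O : GradedManifold.{u, v} d M} (D : QStructure O)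

theorem Q_mem_Ipow {V : Opens M} {p : ℕ} {f : O.obj V} (hf : f ∈ O.Ipow V (p + 1)) :
    D.Q V f ∈ O.Ipow V p := by
  induction p generalizing f with
  | zero => trivial
  | succ p ih =>
    refine Submodule.mul_induction_on (C := fun f => D.Q V f ∈ O.Ipow V (p + 1)) hf
      (fun a ha b hb => ?_) fun a b h h' => ?_
    · refine I_induction (P := fun a => D.Q V (a * b) ∈ O.Ipow V (p + 1)) (by simp)
        (fun j a hj ha => ?_) (fun a a' h h' => ?_) ha
      · rw [D.leibniz V j a hj]
        exact Submodule.add_mem _ (Ipow_mul_left _ hb)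
          (Submodule.smul_mem _ _ (mul_mem_Ipow_succ ha (ih hb)))
      · rw [add_mul, map_add]; exact Submodule.add_mem _ h h'
    · rw [map_add]; exact Submodule.add_mem _ h h'

/-- The pairing with the curvature at `x`. -/
noncomputable def evalκ (x : M) : O.dualFamily.fib ⟨1, one_ne_zero⟩ x →ₗ[ℝ] ℝ :=
  Module.Dual.eval ℝ (O.E 1 x) (D.curvature x)

variable {N : Opens M} {Φ : O.Iso N O.dualFamily} (hΦ : Φ.Adapted)

include hΦ in
-- In degree `-1` this is the definition of `κ`, read through the class modulo `I²`. In every other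
-- bidegree both sides vanish for degree reasons.
theorem bicoeff_zero_Q {V : Opens M} (hV : V ≤ N) {f : O.obj V} (hf : f ∈ O.I V) (x : V) (m : ℕ) :
    GSym.bicoeff 0 m (Φ.app hV x (D.Q V f)) =
      GSym.contract (W := fun k => O.dualFamily.fib k x.1) ⟨1, one_ne_zero⟩ (D.evalκ x.1)
        (GSym.bicoeff 1 (m + 1) (Φ.app hV x f)) := by
  refine I_induction (P := fun f => GSym.bicoeff 0 m (Φ.app hV x (D.Q V f)) =
      GSym.contract (W := fun k => O.dualFamily.fib k x.1) ⟨1, one_ne_zero⟩ (D.evalκ x.1)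
        (GSym.bicoeff 1 (m + 1) (Φ.app hV x f))) (by simp) (fun j f hj _ => ?_)
        (fun a b h h' => by simp only [map_add, h, h']) hf
  rw [Φ.bicoeff_zero]
  by_cases h : j = -1 ∧ m = 0
  · obtain ⟨rfl, rfl⟩ := h
    rw [if_pos rfl]
    have h1 := hΦ.lin hV ⟨1, one_ne_zero⟩ f hj x
    refine Eq.trans ?_ (congrArg (GSym.contract (W := fun k => O.dualFamily.fib k x.1)
      ⟨1, one_ne_zero⟩ (D.evalκ x.1)) h1.symm)
    exact ((GSym.contract_ι (W := fun k => O.dualFamily.fib k x.1) ⟨1, one_ne_zero⟩ (D.evalκ x.1)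
      ⟨1, one_ne_zero⟩ (O.cls f 1 x)).trans (congrArg _ (LinearMap.congr_fun
        (GSym.extend_same _ _) _))).symm
  · have h1 : (if m = 0 then O.body V (D.Q V f) x else 0) = 0 := by
      split_ifs with hm
      · rw [O.body_deg V (j + 1) (by omega) _ (D.deg V j f hj)]
        rfl
      · rfl
    rw [h1, map_zero]
    rcases GSym.comp_one_of_bideg (Φ.bideg_coeff hV hj x (m + 1)) with h2 | ⟨k, w, h2, h3, h4⟩
    · rw [GSym.bicoeff_apply, h2, map_zero]
    · rw [GSym.bicoeff_apply, h4, GSym.contract_ι, GSym.extend_ne, LinearMap.zero_apply, map_zero]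
      rintro rfl
      refine h ⟨h2, ?_⟩
      simpa using h3

include hΦ in
/-- The symbol of `Q` is the contraction with the curvature. -/
theorem bicoeff_Q {V : Opens M} (hV : V ≤ N) {p : ℕ} {f : O.obj V} (hf : f ∈ O.Ipow V (p + 1))
    (x : V) (m : ℕ) : GSym.bicoeff p m (Φ.app hV x (D.Q V f)) =
      GSym.contract (W := fun k => O.dualFamily.fib k x.1) ⟨1, one_ne_zero⟩ (D.evalκ x.1)
        (GSym.bicoeff (p + 1) (m + 1) (Φ.app hV x f)) := by
  induction p generalizing f m with
  | zero =>
    refine D.bicoeff_zero_Q hΦ hV ?_ x m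
    exact Submodule.mul_le.2 (fun a ha b _ => mul_mem_I_right b ha) hf
  | succ p ih =>
    refine Submodule.mul_induction_on (C := fun f => GSym.bicoeff (p + 1) m (Φ.app hV x (D.Q V f)) =
      GSym.contract (W := fun k => O.dualFamily.fib k x.1) ⟨1, one_ne_zero⟩ (D.evalκ x.1)
        (GSym.bicoeff (p + 1 + 1) (m + 1) (Φ.app hV x f))) hf
      (fun a ha b hb => ?_) fun a b h h' => by simp only [map_add, h, h']
    refine I_induction (P := fun a => GSym.bicoeff (p + 1) m (Φ.app hV x (D.Q V (a * b))) =
      GSym.contract (W := fun k => O.dualFamily.fib k x.1) ⟨1, one_ne_zero⟩ (D.evalκ x.1)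
        (GSym.bicoeff (p + 1 + 1) (m + 1) (Φ.app hV x (a * b)))) (by simp) (fun j a hj ha => ?_)
        (fun a a' h h' => by simp only [add_mul, map_add, h, h']) ha
    -- The linear part of `a` is a generator of index `-j` or zero, so the Koszul sign of the
    -- contraction matches the sign `(-1)^j` in the Leibniz rule of `Q`.
    have hc : ∀ i (B : O.dualFamily.Sym x.1),
        GSym.contract (W := fun k => O.dualFamily.fib k x.1) ⟨1, one_ne_zero⟩ (D.evalκ x.1)
          (GSym.bicoeff 1 i (Φ.app hV x a) * B) =
        GSym.contract (W := fun k => O.dualFamily.fib k x.1) ⟨1, one_ne_zero⟩ (D.evalκ x.1)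
          (GSym.bicoeff 1 i (Φ.app hV x a)) * B +
        (-1 : ℝ) ^ j • (GSym.bicoeff 1 i (Φ.app hV x a) *
          GSym.contract (W := fun k => O.dualFamily.fib k x.1) ⟨1, one_ne_zero⟩ (D.evalκ x.1) B) := by
      intro i B
      rcases GSym.comp_one_of_bideg (Φ.bideg_coeff hV hj x i) with h2 | ⟨k, w, h2, h3, h4⟩
      · rw [GSym.bicoeff_apply, h2]; simp
      · rw [GSym.bicoeff_apply, h4, GSym.contract_ι_mul, GSym.contract_ι,
          Algebra.algebraMap_eq_smul_one, smul_mul_assoc, one_mul, h2, one_mul, zpow_neg,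
          ← inv_zpow, inv_neg, inv_one]
    rw [D.leibniz V j a hj, map_add, map_smul, map_add, map_smul, map_mul (Φ.app hV x),
      map_mul (Φ.app hV x), map_mul (Φ.app hV x)]
    have e1 := (GSym.vanish_zero_left (m + 1) (Φ.app hV x (D.Q V a))).bicoeff_mul
      (Φ.vanish_of_mem_Ipow hV hb (m + 1) x) m.lt_succ_self
    have e2 := (Φ.vanish_one hV ha x (m + 1)).bicoeff_mul
      (Φ.vanish_of_mem_Ipow hV (D.Q_mem_Ipow hb) (m + 1) x) m.lt_succ_self
    have e3 := (Φ.vanish_one hV ha x (m + 1 + 1)).bicoeff_mul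
      (Φ.vanish_of_mem_Ipow hV hb (m + 1 + 1) x) (m + 1).lt_succ_self
    rw [zero_add] at e1
    rw [add_comm 1] at e2 e3
    rw [e1, e2, e3, map_sum]
    simp only [hc]
    rw [Finset.sum_add_distrib, Finset.smul_sum]
    congr 1
    -- The contraction lowers the negative degree by one, so its sum runs over one more pair. In the
    -- extra pair the contracted factor has negative degree zero and contributes nothing.
    · rw [Finset.Nat.sum_antidiagonal_succ, Φ.contract_bicoeff_zero hV a x 1 one_pos, zero_mul,
        zero_add]
      exact Finset.sum_congr rfl fun i _ => by rw [D.bicoeff_zero_Q hΦ hV ha]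
    · rw [Finset.Nat.sum_antidiagonal_succ', Φ.contract_bicoeff_zero hV b x (p + 1) one_pos,
        mul_zero, smul_zero, zero_add]
      exact Finset.sum_congr rfl fun i _ => by rw [ih hb]

include hΦ in
theorem bicoeff_Q' {V : Opens M} (hV : V ≤ N) {p n : ℕ} {f : O.obj V}
    (hf : f ∈ O.Ipow V (p + 1) ⊔ O.F V (n + 1)) (x : V) {m : ℕ} (hm : m < n) :
    GSym.bicoeff p m (Φ.app hV x (D.Q V f)) =
      GSym.contract (W := fun k => O.dualFamily.fib k x.1) ⟨1, one_ne_zero⟩ (D.evalκ x.1)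
        (GSym.bicoeff (p + 1) (m + 1) (Φ.app hV x f)) := by
  obtain ⟨a, ha, b, hb, rfl⟩ := Submodule.mem_sup.1 hf
  simp only [map_add]
  rw [D.bicoeff_Q hΦ hV ha, Φ.vanish_of_mem_F hV (D.filt V n b hb) (p + 1) x p p.lt_succ_self m hm,
    Φ.vanish_of_mem_F hV hb (p + 2) x (p + 1) (by omega) (m + 1) (by omega), map_zero]

variable {U : Opens M} {A : O.SplittingAtlas U} (ε : EulerField A)

section

variable (hε : ∀ {V : Opens M} (hV : V ≤ U) (f : O.obj V),
    D.Q V (ε.op V hV f) = ε.op V hV (D.Q V f) + D.Q V f)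

include hε

/-- From `Qε = (ε+1)Q` one gets `Q binom(ε, p+1) = binom(ε+1, p+1) Q`, and Pascal's rule expands the
right side. -/
theorem Q_binom {V : Opens M} (hV : V ≤ U) (p : ℕ) (f : O.obj V) :
    D.Q V (ε.binom V hV (p + 1) f) =
      ε.binom V hV (p + 1) (D.Q V f) + ε.binom V hV p (D.Q V f) := by
  have key : ∀ p, ((p + 1 : ℕ) : ℝ) • D.Q V (ε.binom V hV (p + 1) f) =
      ε.op V hV (D.Q V (ε.binom V hV p f)) + D.Q V (ε.binom V hV p f) -
        (p : ℝ) • D.Q V (ε.binom V hV p f) := by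
    intro p
    rw [← map_smul, ε.binom_succ, map_sub, hε, map_smul]
  induction p with
  | zero =>
    have h := key 0
    have h' := ε.binom_succ hV 0 (D.Q V f)
    simp only [ε.binom_zero, zero_add, Nat.cast_one, one_smul, Nat.cast_zero, zero_smul,
      sub_zero] at h h' ⊢
    rw [h, h']
  | succ p ih =>
    have h : ((p + 1 + 1 : ℕ) : ℝ) ≠ 0 := by positivity
    refine smul_right_injective _ h ?_
    have h1 := ε.binom_succ hV (p + 1) (D.Q V f)
    have h2 := ε.binom_succ hV p (D.Q V f)
    simp only
    rw [key, ih, map_add, sub_eq_iff_eq_add.1 h1.symm, sub_eq_iff_eq_add.1 h2.symm]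
    push_cast
    module

/-- By `Q_binom`, `binom(ε, p) Q f` is `Q binom(ε, p+1) f` minus an element of `I^(p+1)`, which has
no symbol of order `p`. The symbol of `Q` is the contraction. -/
theorem glob_Q {V : Opens M} (hV : V ≤ U) (f : O.obj V) (x : V) :
    ε.glob hV x (D.Q V f) = GSym.contractSeries (W := fun k => O.dualFamily.fib k x.1)
      ⟨1, one_ne_zero⟩ (D.evalκ x.1) (ε.glob hV x f) := by
  refine GSym.ext_bicoeff fun p n => ?_
  rw [GSym.bicoeff_contractSeries]
  set z : U := ⟨x.1, hV x.2⟩ with hz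
  set N := A.dom z ⊓ V with hN
  have hx : x.1 ∈ N := ⟨A.mem z, x.2⟩
  have hNV : N ≤ V := inf_le_right
  have hNz : N ≤ A.dom z := inf_le_left
  have e1 := (ε.bicoeff_glob hV x (D.Q V f) p n).trans
    (ε.symb_eq hV hNV z hNz ⟨x.1, hx⟩ p n (D.Q V f))
  have e2 := (ε.bicoeff_glob hV x f (p + 1) (n + 1)).trans
    (ε.symb_eq hV hNV z hNz ⟨x.1, hx⟩ (p + 1) (n + 1) f)
  refine e1.trans (Eq.trans ?_ (congrArg (GSym.contract (W := fun k => O.dualFamily.fib k x.1)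
      ⟨1, one_ne_zero⟩ (D.evalκ x.1)) e2).symm)
  rw [← D.res hNV]
  have h1 := D.Q_binom ε hε (hNV.trans hV) p (O.res hNV f)
  rw [eq_sub_of_add_eq' h1.symm, map_sub, map_sub,
    (A.iso z).vanish_of_mem hNz (ε.binom_mem _ hNz (p + 1) (n + 1) _) _ p p.lt_succ_self n
      n.lt_succ_self, sub_zero]
  -- Filtration level `n + 2`: one step is lost to `Q`, and coefficient `n` is controlled by
  -- `F^(n+1)`.
  exact D.bicoeff_Q' (A.adapted z) hNz (ε.binom_mem _ hNz (p + 1) (n + 2) _) ⟨x.1, hx⟩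
    n.lt_succ_self

theorem Q_eq_contraction {V : Opens M} (hV : V ≤ U) :
    D.Q V = ε.splitting.contraction hV ⟨1, one_ne_zero⟩ (D.curvatureSec V) := by
  refine LinearMap.ext fun f => (ε.globEquiv hV).injective (Subtype.ext (funext fun x => ?_))
  refine (D.glob_Q ε hε hV f x).trans ?_
  have h := (ε.globEquiv hV).apply_symm_apply
    ⟨O.dualFamily.contract ⟨1, one_ne_zero⟩
      (fun x => Module.Dual.eval ℝ (O.E 1 x.1) ((D.curvatureSec V).val x)) (ε.globEquiv hV f).1,
      contract_mem ⟨1, one_ne_zero⟩ (D.curvatureSec V) (ε.globEquiv hV f).2⟩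
  exact (congrFun (congrArg Subtype.val h) x).symm

end

/-! ### The brackets -/

variable (Ψ : O.Splitting U) {V : Opens M} (hV : V ≤ U)

theorem contraction_contraction (k l : ZStar) (e : O.SecE V k.1) (e' : O.SecE V l.1) :
    Ψ.contraction hV k e ∘ₗ Ψ.contraction hV l e' =
      (-1 : ℝ) ^ (k.1 * l.1) • (Ψ.contraction hV l e' ∘ₗ Ψ.contraction hV k e) := by
  refine LinearMap.ext fun f => (Ψ.equiv V hV).injective (Subtype.ext (funext fun x => ?_))
  simp only [LinearMap.smul_apply, LinearMap.comp_apply, Iso.contraction, map_smul,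
    AlgEquiv.toLinearMap_apply, AlgEquiv.apply_symm_apply]
  exact GSym.contractSeries_contractSeries k l _ _ _

/-- Already the first commutator `[i_κ, i_e]` vanishes. -/
theorem commutator_of_ne_nil
    (h : D.Q V = Ψ.contraction hV ⟨1, one_ne_zero⟩ (D.curvatureSec V))
    {es : List (Σ k : ZStar, O.SecE V k.1)} (hes : es ≠ []) :
    (D.commutator Ψ hV es).2 = 0 := by
  -- A zero operator stays zero under further commutators, whatever degree is recorded next to it.
  have h0 : ∀ (es : List (Σ k : ZStar, O.SecE V k.1)) (P : ℤ × (O.obj V →ₗ[ℝ] O.obj V)),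
      P.2 = 0 → (es.foldl (fun P e => (P.1 + e.1.1, P.2 ∘ₗ Ψ.contraction hV e.1 e.2 -
        (-1 : ℝ) ^ (P.1 * e.1.1) • (Ψ.contraction hV e.1 e.2 ∘ₗ P.2))) P).2 = 0 := by
    intro es
    induction es with
    | nil => exact fun P h => h
    | cons e es ih =>
      intro P hP
      rw [List.foldl_cons]
      exact ih _ (by simp [hP])
  cases es with
  | nil => exact absurd rfl hes
  | cons e es =>
    rw [commutator, List.foldl_cons]
    refine h0 _ _ ?_
    simp only
    rw [h, contraction_contraction, sub_self]

theorem conclusion (h : ∀ (V : Opens M) (hV : V ≤ U),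
      D.Q V = Ψ.contraction hV ⟨1, one_ne_zero⟩ (D.curvatureSec V)) :
    (∀ (V : Opens M) (hV : V ≤ U), D.Q V = Ψ.contraction hV ⟨1, one_ne_zero⟩ (D.curvatureSec V)) ∧
      (∀ (V : Opens M) (hV : V ≤ U) (α : O.SecDual V 1) (x : V),
        D.bracket Ψ hV [] ⟨1, one_ne_zero⟩ α x = α.val x (D.curvature x.1)) ∧
      (∀ (V : Opens M) (hV : V ≤ U) (es : List (Σ k : ZStar, O.SecE V k.1)), es ≠ [] →
        (∀ (k : ZStar) (α : O.SecDual V k.1), D.bracket Ψ hV es k α = 0) ∧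
        (∀ f, D.anchor Ψ hV es f = 0)) := by
  refine ⟨h, fun V hV α x => ?_, fun V hV es hes => ⟨fun k α => ?_, fun f => ?_⟩⟩
  -- The body of `Q` of a function is by definition its class evaluated on `κ`, and a splitting
  -- sends `α` to a function of class `α`.
  · have h1 := LinearMap.congr_fun (Ψ.cls_lin V hV ⟨1, one_ne_zero⟩ α x) (D.curvature x.1)
    exact h1
  · rw [bracket, D.commutator_of_ne_nil Ψ hV (h V hV) hes]
    simp
  · rw [anchor, D.commutator_of_ne_nil Ψ hV (h V hV) hes]
    simp

end QStructure
end GradedQ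

/-! ### Frames, and expansion of sections in words with smooth coefficients. -/

namespace GradedQ

universe u v v'
variable {d : ℕ} {M : Type u} [TopologicalSpace M] [ChartedSpace (EuclideanSpace ℝ (Fin d)) M]

/-- Lists of indices of generators of total degree `j` and negative degree `n`. -/
def indexLists (r : ZStar → ℕ) (j : ℤ) (n : ℕ) : Set (List (Σ k, Fin (r k))) :=
  {l | (l.map fun p => -p.1.1).sum = j ∧ (l.map fun p => p.1.1.toNat).sum = n}

theorem natAbs_le_of_mem {r : ZStar → ℕ} (l : List (Σ k, Fin (r k))) :
    (l.length : ℤ) ≤ (l.map fun p => -p.1.1).sum + 2 * ((l.map fun p => p.1.1.toNat).sum : ℕ) ∧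
    ∀ p ∈ l, |p.1.1| ≤ (l.map fun p => -p.1.1).sum + 2 * ((l.map fun p => p.1.1.toNat).sum : ℕ) := by
  induction l with
  | nil => simp
  | cons w l ih =>
    simp only [List.length_cons, List.map_cons, List.sum_cons, List.mem_cons]
    have := w.1.2
    obtain ⟨h1, h2⟩ := ih
    rw [Nat.cast_add, Nat.cast_add]
    refine ⟨by omega, ?_⟩
    rintro p (rfl | hp)
    · rw [abs_le]; omega
    · have := h2 p hp
      omega

/-- The bidegree bounds the length of a word and the size of its indices, and each rank is finite.
The total rank may well be infinite. -/
theorem finite_indexLists (r : ZStar → ℕ) (j : ℤ) (n : ℕ) : (indexLists r j n).Finite := by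
  have hB : {p : Σ k, Fin (r k) | |p.1.1| ≤ j + 2 * n}.Finite := by
    have hK : {k : ZStar | |k.1| ≤ j + 2 * n}.Finite := by
      refine Set.Finite.of_injOn (f := Subtype.val) (t := Set.Icc (-(j + 2 * n)) (j + 2 * n))
        (fun k hk => ?_) Subtype.val_injective.injOn (Set.finite_Icc _ _)
      exact abs_le.1 hk
    refine (hK.biUnion fun k _ => Set.finite_range fun a : Fin (r k) =>
      (⟨k, a⟩ : Σ k, Fin (r k))).subset fun p hp => ?_
    exact Set.mem_biUnion (x := p.1) hp ⟨p.2, rfl⟩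
  have := hB.to_subtype
  refine ((List.finite_length_le {p : Σ k, Fin (r k) | |p.1.1| ≤ j + 2 * n}
    (j + 2 * n).toNat).image (List.map Subtype.val)).subset fun l hl => ?_
  obtain ⟨h1, h2⟩ := natAbs_le_of_mem l
  rw [hl.1, hl.2] at h1 h2
  refine ⟨l.pmap Subtype.mk h2, ?_, ?_⟩
  · change (l.pmap Subtype.mk h2).length ≤ _
    rw [List.length_pmap]
    omega
  · rw [List.map_pmap]
    simp

noncomputable instance (r : ZStar → ℕ) (j : ℤ) (n : ℕ) : Fintype (indexLists r j n) :=
  (finite_indexLists r j n).fintype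

namespace GradedFamily

/-- A frame of a family of bundles of finite rank. -/
structure Frame (W : GradedFamily.{u, v} d M) (r : ZStar → ℕ) where
  coord : ∀ k y, W.fib k y ≃ₗ[ℝ] (Fin (r k) → ℝ)
  smooth_iff : ∀ k w x, W.smoothAt k w x ↔
    ContMDiffAt (𝓡 d) 𝓘(ℝ, Fin (r k) → ℝ) ∞ (fun y => coord k y (w y)) x

variable (d M) in
/-- The canonical frame of a family of trivial bundles. -/
def trivialFrame (r : ZStar → ℕ) : (trivialFamily d M r).Frame r where
  coord k _ := LinearEquiv.refl ℝ (Fin (r k) → ℝ)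
  smooth_iff _ _ _ := Iff.rfl

namespace Frame

variable {W : GradedFamily.{u, v} d M} {r : ZStar → ℕ} (B : W.Frame r)

/-- The section of `W k` with constant coordinates `v`. -/
noncomputable def const (k : ZStar) (v : Fin (r k) → ℝ) (y : M) : W.fib k y := (B.coord k y).symm v

theorem smoothAt_const (k : ZStar) (v : Fin (r k) → ℝ) (x : M) :
    W.smoothAt k (B.const k v) x := by
  rw [B.smooth_iff]
  simpa [const] using contMDiffAt_const

include B in
theorem smoothAt_zero (k : ZStar) (x : M) : W.smoothAt k (fun _ => 0) x := by
  rw [B.smooth_iff]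
  simpa using contMDiffAt_const

/-- The product of the elements of the frame in a list. -/
noncomputable def word (l : List (Σ k, Fin (r k))) (y : M) : W.Sym y :=
  GSym.prodι (l.map fun p => (⟨p.1, B.const p.1 (Pi.single p.2 1) y⟩ : Σ k, W.fib k y))

theorem sum_const (k : ZStar) (y : M) (w : W.fib k y) :
    w = ∑ a, B.coord k y w a • B.const k (Pi.single a 1) y := by
  refine (B.coord k y).injective ?_
  rw [map_sum]
  simp only [map_smul, const, LinearEquiv.apply_symm_apply]
  ext a
  simp [Finset.sum_apply, Pi.single_apply]

/-- Sections which are combinations of words with smooth coefficients. -/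
noncomputable def expandable (V : Opens M) (j : ℤ) (n : ℕ) : Submodule ℝ (∀ y, W.Sym y) where
  carrier := {t | ∃ c : indexLists r j n → M → ℝ,
    (∀ l, ∀ y ∈ V, ContMDiffAt (𝓡 d) 𝓘(ℝ, ℝ) ∞ (c l) y) ∧
    ∀ y, t y = ∑ l, c l y • B.word l.1 y}
  zero_mem' := ⟨fun _ _ => 0, fun _ _ _ => contMDiffAt_const, by simp⟩
  add_mem' := by
    rintro _ _ ⟨c, hc, h⟩ ⟨c', hc', h'⟩
    exact ⟨fun l y => c l y + c' l y, fun l y hy => (hc l y hy).add (hc' l y hy),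
      fun y => by simp [h, h', add_smul, Finset.sum_add_distrib]⟩
  smul_mem' := by
    rintro a _ ⟨c, hc, h⟩
    exact ⟨fun l y => a * c l y, fun l y hy => contMDiffAt_const.mul (hc l y hy),
      fun y => by simp [h, Finset.smul_sum, smul_smul]⟩

theorem smul_word_mem {V : Opens M} {j : ℤ} {n : ℕ} {c : M → ℝ}
    (hc : ∀ y ∈ V, ContMDiffAt (𝓡 d) 𝓘(ℝ, ℝ) ∞ c y) (l : List (Σ k, Fin (r k)))
    (hl : l ∈ indexLists r j n) : (fun y => c y • B.word l y) ∈ B.expandable V j n := by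
  classical
  refine ⟨fun l' y => if l' = ⟨l, hl⟩ then c y else 0, fun l' y hy => ?_, fun y => ?_⟩
  · by_cases h : l' = ⟨l, hl⟩
    · simpa [h] using hc y hy
    · simpa [h] using contMDiffAt_const
  · rw [Finset.sum_eq_single ⟨l, hl⟩]
    · simp
    · intro l' _ h
      simp [h]
    · simp

theorem smul_mem_expandable {V : Opens M} {j : ℤ} {n : ℕ} {c : M → ℝ}
    (hc : ∀ y ∈ V, ContMDiffAt (𝓡 d) 𝓘(ℝ, ℝ) ∞ c y) {t : ∀ y, W.Sym y}
    (ht : t ∈ B.expandable V j n) : (fun y => c y • t y) ∈ B.expandable V j n := by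
  obtain ⟨c', hc', h⟩ := ht
  exact ⟨fun l y => c y * c' l y, fun l y hy => (hc y hy).mul (hc' l y hy),
    fun y => by simp [h, Finset.smul_sum, smul_smul]⟩

theorem ι_mul_mem_expandable {V : Opens M} {j : ℤ} {n : ℕ} {k : ZStar} {w : ∀ y, W.fib k y}
    (hw : ∀ y ∈ V, W.smoothAt k w y) {t : ∀ y, W.Sym y} (ht : t ∈ B.expandable V j n) :
    (fun y => GSym.ι (fun k => W.fib k y) k (w y) * t y) ∈
      B.expandable V (-k.1 + j) (k.1.toNat + n) := by
  obtain ⟨c, hc, h⟩ := ht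
  have e : (fun y => GSym.ι (fun k => W.fib k y) k (w y) * t y) =
      ∑ a, ∑ l : indexLists r j n, fun y =>
        (B.coord k y (w y) a * c l y) • B.word (⟨k, a⟩ :: l.1) y := by
    funext y
    rw [Finset.sum_apply, h, Finset.mul_sum]
    simp only [Finset.sum_apply]
    rw [Finset.sum_comm]
    refine Finset.sum_congr rfl fun l _ => ?_
    conv_lhs => rw [B.sum_const k y (w y)]
    rw [map_sum, Finset.sum_mul]
    refine Finset.sum_congr rfl fun a _ => ?_
    rw [map_smul, smul_mul_smul_comm]
    simp [word]
  rw [e]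
  refine Submodule.sum_mem _ fun a _ => Submodule.sum_mem _ fun l _ => ?_
  refine B.smul_word_mem (fun y hy => ContMDiffAt.mul ?_ (hc l y hy)) _ ?_
  · exact contMDiffAt_pi_space.1 ((B.smooth_iff k w y).1 (hw y hy)) a
  · exact ⟨by simp [l.2.1], by simp [l.2.2]⟩

/-- Each section in a monomial is expanded in the frame, and the coordinates are absorbed into the
coefficient. -/
theorem span_monomials_le (V : Opens M) (j : ℤ) (n : ℕ) :
    Submodule.span ℝ (W.monomials V j n) ≤ B.expandable V j n := by
  rw [Submodule.span_le]
  intro t ht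
  obtain ⟨c, l, h1, h2, rfl, rfl, h5⟩ := W.monomial_eq V j n ht
  obtain rfl := funext h5
  refine B.smul_mem_expandable h1 ?_
  clear h5 ht
  induction l with
  | nil =>
    have := B.smul_word_mem (V := V) (j := 0) (n := 0) (c := fun _ => 1)
      (fun _ _ => contMDiffAt_const) [] ⟨rfl, rfl⟩
    simpa [word] using this
  | cons w l ih =>
    have := B.ι_mul_mem_expandable (h2 w List.mem_cons_self)
      (ih fun w hw => h2 w (List.mem_cons_of_mem _ hw))
    simpa using this

/-- The component in `W k` of an element of the symmetric algebra. -/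
noncomputable def linPart (k : ZStar) (y : M) : W.Sym y →ₗ[ℝ] W.fib k y :=
  (B.coord k y).symm.toLinearMap ∘ₗ LinearMap.pi fun a =>
    GSym.aug.toLinearMap ∘ₗ GSym.contract k (LinearMap.proj a ∘ₗ (B.coord k y).toLinearMap)

theorem coord_linPart (k : ZStar) (y : M) (a : W.Sym y) (i : Fin (r k)) :
    B.coord k y (B.linPart k y a) i =
      GSym.aug (GSym.contract k (LinearMap.proj i ∘ₗ (B.coord k y).toLinearMap) a) := by
  simp [linPart]

theorem linPart_ι (k : ZStar) (y : M) (w : W.fib k y) :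
    B.linPart k y (GSym.ι (fun k => W.fib k y) k w) = w := by
  refine (B.coord k y).injective (funext fun i => ?_)
  rw [coord_linPart, GSym.contract_ι, GSym.extend_same]
  simp [Algebra.algebraMap_eq_smul_one]

/-- The linear part is a derivation at the augmentation, being defined by contractions followed by
`aug`. -/
theorem linPart_mul (k : ZStar) (y : M) (a b : W.Sym y) :
    B.linPart k y (a * b) = GSym.aug b • B.linPart k y a + GSym.aug a • B.linPart k y b := by
  refine (B.coord k y).injective (funext fun i => ?_)
  rw [coord_linPart, GSym.aug_contract_mul, map_add, map_smul, map_smul, Pi.add_apply,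
    Pi.smul_apply, Pi.smul_apply, coord_linPart, coord_linPart, smul_eq_mul, smul_eq_mul]
  ring

theorem linPart_one (k : ZStar) (y : M) : B.linPart k y 1 = 0 := by
  refine (B.coord k y).injective (funext fun i => ?_)
  rw [coord_linPart]
  simp

theorem linPart_ι_ne {k l : ZStar} (h : k ≠ l) (y : M) (w : W.fib l y) :
    B.linPart k y (GSym.ι (fun k => W.fib k y) l w) = 0 := by
  refine (B.coord k y).injective (funext fun i => ?_)
  rw [coord_linPart, GSym.contract_ι, GSym.extend_ne _ h]
  simp

theorem linPart_prodι (k : ZStar) (y : M) (l : List (Σ k, W.fib k y)) (hl : l.length ≠ 1) :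
    B.linPart k y (GSym.prodι l) = 0 := by
  match l with
  | [] => exact B.linPart_one k y
  | [w] => simp at hl
  | w :: w' :: l =>
    rw [GSym.prodι_cons, linPart_mul, GSym.aug_prodι, GSym.aug_ι]
    simp

theorem linPart_of_bideg {k : ZStar} {y : M} {j : ℤ} (hj : j ≠ -k.1) {n : ℕ} {a : W.Sym y}
    (ha : a ∈ GSym.bideg (fun k => W.fib k y) j n) : B.linPart k y a = 0 := by
  refine GSym.bideg_induction (P := fun a => B.linPart k y a = 0) (map_zero _)
    (fun l h1 _ => ?_) (fun c a h => by rw [map_smul, h, smul_zero])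
    (fun a b h h' => by rw [map_add, h, h', add_zero])
    ha
  match l with
  | [w] =>
    rw [GSym.prodι_cons, GSym.prodι_nil, mul_one]
    refine B.linPart_ι_ne (fun h => hj ?_) y w.2
    rw [h, ← h1]
    simp
  | [] => exact B.linPart_prodι k y _ (by simp)
  | w :: w' :: l => exact B.linPart_prodι k y _ (by simp)

theorem contMDiffAt_linPart {V : Opens M} {j : ℤ} {n : ℕ} {t : ∀ y, W.Sym y}
    (ht : t ∈ Submodule.span ℝ (W.monomials V j n)) (k : ZStar) {x : M} (hx : x ∈ V) :
    W.smoothAt k (fun y => B.linPart k y (t y)) x := by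
  induction ht using Submodule.span_induction with
  | mem t ht =>
    obtain ⟨c, l, h1, h2, -, -, h5⟩ := W.monomial_eq V j n ht
    simp only [h5, map_smul]
    have h0 : l.length ≠ 1 ∨ (∃ w, l = [w] ∧ w.1 ≠ k) ∨ ∃ w, l = [⟨k, w⟩] := by
      match l with
      | [] => simp
      | [w] =>
        right
        obtain ⟨k', w⟩ := w
        by_cases h : k' = k
        · subst h; exact Or.inr ⟨w, rfl⟩
        · exact Or.inl ⟨_, rfl, h⟩
      | w :: w' :: l => simp
    rcases h0 with h | ⟨w, rfl, h⟩ | ⟨w, rfl⟩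
    · have : ∀ y, B.linPart k y (GSym.prodι
          (l.map fun w => (⟨w.1, w.2 y⟩ : Σ k, W.fib k y))) = 0 :=
        fun y => B.linPart_prodι k y _ (by simpa using h)
      simp only [this, smul_zero]
      exact B.smoothAt_zero k x
    · have : ∀ y, B.linPart k y (GSym.prodι
          ([w].map fun w => (⟨w.1, w.2 y⟩ : Σ k, W.fib k y))) = 0 := fun y => by
        simpa using B.linPart_ι_ne (Ne.symm h) y (w.2 y)
      simp only [this, smul_zero]
      exact B.smoothAt_zero k x
    · have : ∀ y, B.linPart k y (GSym.prodι
          ([(⟨k, w⟩ : Σ k : ZStar, ∀ y, W.fib k y)].map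
            fun w => (⟨w.1, w.2 y⟩ : Σ k, W.fib k y))) = w y := fun y => by
        simpa using B.linPart_ι k y (w y)
      simp only [this]
      rw [B.smooth_iff]
      simp only [map_smul]
      exact (h1 x hx).smul ((B.smooth_iff k w x).1 (h2 ⟨k, w⟩ (by simp) x hx))
  | zero => simpa using B.smoothAt_zero k x
  | add s t _ _ h h' =>
    rw [B.smooth_iff] at *
    simp only [Pi.add_apply, map_add]
    exact h.add h'
  | smul c t _ h =>
    rw [B.smooth_iff] at *
    simp only [Pi.smul_apply, map_smul]
    exact (contMDiffAt_const : ContMDiffAt (𝓡 d) 𝓘(ℝ, ℝ) ∞ (fun _ : M => c) x).smul h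

/-- A section is a combination of words with globally defined smooth coefficients. -/
theorem exists_coeff [T2Space M] [SecondCountableTopology M] [IsManifold (𝓡 d) ∞ M]
    {V : Opens M} {j : ℤ} {n : ℕ} {s : ∀ x : V, W.Sym x.1} (hs : s ∈ W.symSections V j n) :
    ∃ c : indexLists r j n → C^∞⟮𝓡 d, V; 𝓘(ℝ, ℝ), ℝ⟯,
      ∀ x : V, s x = ∑ l, c l x • B.word l.1 x.1 := by
  have : LocallyCompactSpace M := ChartedSpace.locallyCompactSpace (EuclideanSpace ℝ (Fin d)) M
  have : LocallyCompactSpace V := V.isOpen.locallyCompactSpace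
  -- Words that are reorderings of each other are proportional, so coefficients are not unique. The
  -- admissible ones form an affine, hence convex, set, which suffices to patch local smooth choices
  -- over all of `V`.
  have hc : ∀ x : V, Convex ℝ {c : indexLists r j n → ℝ | s x = ∑ l, c l • B.word l.1 x.1} := by
    intro x c hc c' hc' a b _ _ hab
    change s x = _
    simp only [Pi.add_apply, Pi.smul_apply, add_smul, smul_assoc, Finset.sum_add_distrib,
      ← Finset.smul_sum]
    rw [← hc, ← hc', ← add_smul, hab, one_smul]
  have hloc : ∀ x : V, ∃ U ∈ nhds x, ∃ g : V → indexLists r j n → ℝ,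
      ContMDiffOn (𝓡 d) 𝓘(ℝ, indexLists r j n → ℝ) ∞ g U ∧
      ∀ y ∈ U, g y ∈ {c : indexLists r j n → ℝ | s y = ∑ l, c l • B.word l.1 y.1} := by
    intro x
    obtain ⟨V', hx, t, ht, h⟩ := hs x
    obtain ⟨c, hc, hct⟩ := B.span_monomials_le V' j n ht
    refine ⟨{y : V | y.1 ∈ V'}, (V'.isOpen.preimage continuous_subtype_val).mem_nhds hx,
      fun y l => c l y.1, fun y hy => ?_, fun y hy => (h y hy).trans (hct y.1)⟩
    refine ContMDiffAt.contMDiffWithinAt (contMDiffAt_pi_space.2 fun l => ?_)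
    exact (contMDiffAt_subtype_iff (x := y)).2 (hc l y.1 hy)
  obtain ⟨g, hg⟩ := exists_contMDiffMap_forall_mem_convex_of_local (𝓡 d) (n := ⊤) hc hloc
  exact ⟨fun l => ⟨fun x => g x l, contMDiff_pi_space.1 g.contMDiff l⟩, hg⟩

end Frame
end GradedFamily
end GradedQ

/-! ### Local isomorphisms with finite-rank families: transport, generators and linear parts. -/

namespace GradedQ

universe u v v' v''
variable {d : ℕ} {M : Type u} [TopologicalSpace M] [ChartedSpace (EuclideanSpace ℝ (Fin d)) M]

namespace GradedFamily.Frame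

variable {W : GradedFamily.{u, v} d M} {r : ZStar → ℕ} (B : W.Frame r)

theorem linPart_comp (k : ZStar) (y : M) (a : W.Sym y) :
    B.linPart k y (GSym.comp 1 a) = B.linPart k y a := by
  induction a using GSym.induction_prodι with
  | hl l =>
    rw [GSym.comp_prodι]
    split_ifs with h
    · rfl
    · rw [map_zero, B.linPart_prodι k y l (Ne.symm h)]
  | hs c a h => simp only [map_smul, h]
  | ha a b h h' => simp only [map_add, h, h']

end GradedFamily.Frame

namespace GradedSpace

variable {O : GradedSpace.{u, v} d M}

theorem res_mem_Isq {U V : Opens M} (h : V ≤ U) {f : O.obj U} (hf : f ∈ O.Isq U) :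
    O.res h f ∈ O.Isq V := by
  refine (Submodule.mem_iInf _).2 fun n => ?_
  obtain ⟨a, ha, b, hb, rfl⟩ := Submodule.mem_sup.1 ((Submodule.mem_iInf _).1 hf n)
  rw [map_add]
  refine Submodule.add_mem_sup ?_ (O.res_F h n b hb)
  refine Submodule.mul_induction_on (C := fun a => O.res h a ∈ O.I V * O.I V) ha
    (fun f hf g hg => ?_) fun a b ha hb => ?_
  · rw [map_mul]
    exact Submodule.mul_mem_mul (res_mem_I h hf) (res_mem_I h hg)
  · rw [map_add]
    exact Submodule.add_mem _ ha hb

theorem mem_Isq_of_forall {V : Opens M} {f : O.obj V} (hf : ∀ n, f ∈ O.Ipow V 2 ⊔ O.F V n) :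
    f ∈ O.Isq V := by
  refine (Submodule.mem_iInf _).2 fun n => ?_
  obtain ⟨a, ha, b, hb, rfl⟩ := Submodule.mem_sup.1 (hf n)
  refine Submodule.add_mem_sup ?_ hb
  refine Submodule.mul_le.2 (fun g hg h hh => Submodule.mul_mem_mul hg ?_) ha
  exact Submodule.mul_induction_on (C := fun h => h ∈ O.I V) hh
    (fun a ha b _ => mul_mem_I_right b ha) fun a b ha hb => Submodule.add_mem _ ha hb

namespace Iso

/-! ### Change of the family of bundles -/

section Congr

variable {N : Opens M} {W : GradedFamily.{u, v'} d M} {W' : GradedFamily.{u, v''} d M}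

theorem mapSeries_mem_sections {V : Opens M} (L : ∀ y k, W.fib k y →ₗ[ℝ] W'.fib k y)
    (hL : ∀ V' ≤ V, ∀ k w, (∀ y ∈ V', W.smoothAt k w y) →
      ∀ y ∈ V', W'.smoothAt k (fun y => L y k (w y)) y)
    {s : ∀ x : V, W.CSym x.1} (hs : s ∈ W.sections V) :
    (fun x : V => (GSym.mapSeries (L x.1) (s x) : W'.CSym x.1)) ∈ W'.sections V := by
  let T : (∀ x : V, W.CSym x.1) →ₗ[ℝ] (∀ x : V, W'.CSym x.1) :=
    LinearMap.pi fun x => (GSym.mapSeries (L x.1)).toLinearMap ∘ₗ LinearMap.proj x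
  suffices h : (⨆ j, W.homSections V j : Submodule ℝ (∀ x : V, W.CSym x.1)) ≤
      (Subalgebra.toSubmodule (W'.sections V)).comap T from h hs
  exact iSup_le fun j s hs => W'.homSections_le V j (GradedFamily.mapSeries_mem_homSections L hL hs)

variable (Φ : O.Iso N W) (L : ∀ y k, W.fib k y →ₗ[ℝ] W'.fib k y)
  (L' : ∀ y k, W'.fib k y →ₗ[ℝ] W.fib k y)
  (hL : ∀ V ≤ N, ∀ k w, (∀ y ∈ V, W.smoothAt k w y) →
      ∀ y ∈ V, W'.smoothAt k (fun y => L y k (w y)) y)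
  (hL' : ∀ V ≤ N, ∀ k w, (∀ y ∈ V, W'.smoothAt k w y) →
      ∀ y ∈ V, W.smoothAt k (fun y => L' y k (w y)) y)
  (h : ∀ y ∈ N, ∀ k w, L' y k (L y k w) = w) (h' : ∀ y ∈ N, ∀ k w, L y k (L' y k w) = w)

/-- The isomorphism induced by an isomorphism of families of bundles. -/
noncomputable def congr : O.Iso N W' where
  equiv V hV := (Φ.equiv V hV).trans
    { toFun := fun s => ⟨fun x => GSym.mapSeries (L x.1) (s.1 x),
        mapSeries_mem_sections L (fun V' hV' => hL V' (hV'.trans hV)) s.2⟩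
      invFun := fun s => ⟨fun x => GSym.mapSeries (L' x.1) (s.1 x),
        mapSeries_mem_sections L' (fun V' hV' => hL' V' (hV'.trans hV)) s.2⟩
      left_inv := fun s => Subtype.ext (funext fun x =>
        GSym.mapSeries_mapSeries (h x.1 (hV x.2)) (s.1 x))
      right_inv := fun s => Subtype.ext (funext fun x =>
        GSym.mapSeries_mapSeries (h' x.1 (hV x.2)) (s.1 x))
      map_mul' := fun s t => Subtype.ext (funext fun x =>
        map_mul (GSym.mapSeries (L x.1)) (s.1 x) (t.1 x))
      map_add' := fun s t => Subtype.ext (funext fun x =>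
        map_add (GSym.mapSeries (L x.1)) (s.1 x) (t.1 x))
      commutes' := fun c => Subtype.ext (funext fun x =>
        AlgHom.commutes (GSym.mapSeries (L x.1)) c) }
  natural V V' hV hV' f x := congrArg (GSym.mapSeries (L x.1)) (Φ.natural V V' hV hV' f x)
  deg V hV j f := by
    refine (Φ.deg V hV j f).trans ⟨fun hf => GradedFamily.mapSeries_mem_homSections L
      (fun V' hV' => hL V' (hV'.trans hV)) hf, fun hf => ?_⟩
    have := GradedFamily.mapSeries_mem_homSections L' (fun V' hV' => hL' V' (hV'.trans hV)) hf
    convert this using 1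
    exact funext fun x => (GSym.mapSeries_mapSeries (h x.1 (hV x.2)) _).symm
  filt V hV n f := by
    refine (Φ.filt V hV n f).trans (forall_congr' fun x => forall₂_congr fun m _ => ?_)
    change _ ↔ PowerSeries.coeff m (GSym.mapSeries (L x.1) ((Φ.equiv V hV f).1 x)) = 0
    rw [GSym.coeff_mapSeries]
    refine ⟨fun h0 => by rw [h0, map_zero], fun h0 => ?_⟩
    rw [← GSym.map_map_of_leftInverse (h x.1 (hV x.2)) (PowerSeries.coeff m _), h0, map_zero]
  body V hV f x := by
    refine (Φ.body V hV f x).trans ?_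
    change _ = GSym.aug (PowerSeries.coeff 0 (GSym.mapSeries (L x.1) ((Φ.equiv V hV f).1 x)))
    rw [GSym.coeff_mapSeries, GSym.aug_map]

end Congr

/-! ### Isomorphisms with the symmetric algebra of a family of bundles of finite rank -/

section Frame

variable {N : Opens M} {W : GradedFamily.{u, v'} d M} {r : ZStar → ℕ} (Φ : O.Iso N W)
  (B : W.Frame r)

theorem exists_gen (k : ZStar) (v : Fin (r k) → ℝ) : ∃ f ∈ O.deg N (-k.1), ∀ x,
    Φ.app le_rfl x f =
      PowerSeries.monomial k.1.toNat (GSym.ι (fun k => W.fib k x.1) k (B.const k v x.1)) :=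
  Φ.exists_app_eq le_rfl (W.genSec_mem k (fun x : N => B.const k v x.1) fun x =>
    ⟨N, B.const k v, x.2, fun y _ => B.smoothAt_const k v y, fun _ _ => rfl⟩)

/-- The function of polynomial degree `1` with constant coordinates `v`. -/
noncomputable def gen (k : ZStar) : (Fin (r k) → ℝ) →ₗ[ℝ] O.obj N where
  toFun v := (Φ.exists_gen B k v).choose
  map_add' v w := Φ.app_ext le_rfl fun x => by
    rw [map_add, (Φ.exists_gen B k _).choose_spec.2, (Φ.exists_gen B k _).choose_spec.2,
      (Φ.exists_gen B k _).choose_spec.2]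
    simp [GradedFamily.Frame.const]
  map_smul' c v := Φ.app_ext le_rfl fun x => by
    rw [map_smul, (Φ.exists_gen B k _).choose_spec.2, (Φ.exists_gen B k _).choose_spec.2]
    ext n
    simp [GradedFamily.Frame.const, PowerSeries.coeff_monomial]

theorem gen_mem (k : ZStar) (v : Fin (r k) → ℝ) : Φ.gen B k v ∈ O.deg N (-k.1) :=
  (Φ.exists_gen B k v).choose_spec.1

theorem app_gen {V : Opens M} (hV : V ≤ N) (x : V) (k : ZStar) (v : Fin (r k) → ℝ) :
    Φ.app hV x (O.res hV (Φ.gen B k v)) =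
      PowerSeries.monomial k.1.toNat (GSym.ι (fun k => W.fib k x.1) k (B.const k v x.1)) :=
  (Φ.app_res le_rfl hV _ x).trans ((Φ.exists_gen B k v).choose_spec.2 ⟨x.1, hV x.2⟩)

theorem gen_mem_I {V : Opens M} (hV : V ≤ N) (k : ZStar) (v : Fin (r k) → ℝ) :
    O.res hV (Φ.gen B k v) ∈ O.I V :=
  res_mem_I hV (O.body_deg N _ (neg_ne_zero.2 k.2) _ (Φ.gen_mem B k v))

theorem exists_word {V : Opens M} (hV : V ≤ N) (l : List (Σ k, Fin (r k))) :
    ∃ f ∈ O.Ipow V l.length, ∀ x : V, Φ.app hV x f =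
      PowerSeries.monomial (l.map fun p => p.1.1.toNat).sum (B.word l x.1) := by
  induction l with
  | nil => exact ⟨1, trivial, fun x => (map_one (Φ.app hV x)).trans (by
    simp [GradedFamily.Frame.word])⟩
  | cons p l ih =>
    obtain ⟨f, hf, h⟩ := ih
    refine ⟨O.res hV (Φ.gen B p.1 (Pi.single p.2 1)) * f,
      mul_mem_Ipow_succ (Φ.gen_mem_I B hV _ _) hf, fun x => ?_⟩
    rw [map_mul, h, app_gen, PowerSeries.monomial_mul_monomial]
    rfl

-- Each coefficient below `n` is expanded in words with coefficients smooth on all of `V`. Words of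
-- length at least `p` are products of `p` or more elements of `I`, and what remains lies in `F^n`.
-- Global coefficients are essential, since `I^p` is an algebraic power over `V`.
include B in
theorem mem_sup_of_vanish [T2Space M] [SecondCountableTopology M] [IsManifold (𝓡 d) ∞ M]
    {V : Opens M} (hV : V ≤ N) (j : ℤ) (p n : ℕ) (f : O.obj V) (hf : f ∈ O.deg V j)
    (h : ∀ x, GSym.Vanish p n (Φ.app hV x f)) : f ∈ O.Ipow V p ⊔ O.F V n := by
  classical
  suffices H : ∀ m < n, ∃ g ∈ O.Ipow V p, ∀ x, Φ.app hV x g =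
      PowerSeries.monomial m (PowerSeries.coeff m (Φ.app hV x f)) by
    choose! g hg hgx using H
    have h1 : f - ∑ m ∈ Finset.range n, g m ∈ O.F V n := by
      refine (Φ.mem_F_iff hV).2 fun x m hm => ?_
      rw [map_sub, map_sum, map_sub, map_sum, sub_eq_zero,
        Finset.sum_eq_single_of_mem m (Finset.mem_range.2 hm), hgx m hm]
      · simp
      · intro i hi him
        rw [hgx i (Finset.mem_range.1 hi), PowerSeries.coeff_monomial, if_neg (Ne.symm him)]
    rw [← add_sub_cancel (∑ m ∈ Finset.range n, g m) f]
    exact Submodule.add_mem_sup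
      (Submodule.sum_mem _ fun m hm => hg m (Finset.mem_range.1 hm)) h1
  intro m hm
  obtain ⟨c, hc⟩ := B.exists_coeff ((Φ.mem_deg_iff hV).1 hf m)
  choose w hw hwx using Φ.exists_word B hV
  choose a _ hax _ using Φ.exists_const hV
  refine ⟨∑ l : indexLists r j m, if p ≤ l.1.length then a (c l) * w l.1 else 0,
    Submodule.sum_mem _ fun l _ => ?_, fun x => ?_⟩
  · split_ifs with hl
    · exact Ipow_mul_left _ (Ipow_antitone V hl (hw l.1))
    · exact Submodule.zero_mem _
  -- The words shorter than `p` sum to the components of polynomial degree below `p`, which vanish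
  -- by hypothesis, so they may be dropped.
  · have h2 : PowerSeries.coeff m (Φ.app hV x f) =
        ∑ l : indexLists r j m, if p ≤ l.1.length then c l x • B.word l.1 x.1 else 0 := by
      have hlen : ∀ l : List (Σ k, Fin (r k)), (l.map fun p =>
          (⟨p.1, B.const p.1 (Pi.single p.2 1) x.1⟩ : Σ k, W.fib k x.1)).length = l.length :=
        fun l => List.length_map _
      refine GSym.ext_comp fun q => ?_
      by_cases hq : q < p
      · refine ((h x q hq m hm).trans ?_)
        rw [map_sum]
        refine (Finset.sum_eq_zero fun l _ => ?_).symm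
        split_ifs with hl
        · rw [map_smul, GradedFamily.Frame.word, GSym.comp_prodι, hlen, if_neg (by omega),
            smul_zero]
        · exact map_zero _
      · rw [hc x, map_sum, map_sum]
        refine Finset.sum_congr rfl fun l _ => ?_
        split_ifs with hl
        · rfl
        · rw [map_smul, GradedFamily.Frame.word, GSym.comp_prodι, hlen, if_neg (by omega),
            smul_zero, map_zero]
    rw [h2, map_sum, map_sum]
    refine Finset.sum_congr rfl fun l _ => ?_
    split_ifs with hl
    · rw [map_mul, hax, hwx, l.2.2]
      ext i
      simp [Algebra.algebraMap_eq_smul_one, PowerSeries.coeff_monomial]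
    · simp

/-- The linear part in `W k` of a function at `x`. -/
noncomputable def linCoord {V : Opens M} (hV : V ≤ N) (k : ZStar) (x : V) :
    O.obj V →ₗ[ℝ] W.fib k x.1 :=
  B.linPart k x.1 ∘ₗ (PowerSeries.coeff (R := W.Sym x.1) k.1.toNat).restrictScalars ℝ ∘ₗ
    (Φ.app hV x).toLinearMap

theorem linCoord_apply {V : Opens M} (hV : V ≤ N) (k : ZStar) (x : V) (f : O.obj V) :
    Φ.linCoord B hV k x f = B.linPart k x.1 (PowerSeries.coeff k.1.toNat (Φ.app hV x f)) := rfl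

theorem linCoord_res {V V' : Opens M} (hV : V ≤ N) (h : V' ≤ V) (k : ZStar) (x : V')
    (f : O.obj V) : Φ.linCoord B (h.trans hV) k x (O.res h f) =
      Φ.linCoord B hV k ⟨x.1, h x.2⟩ f := by
  rw [linCoord_apply, app_res]
  rfl

theorem linCoord_gen {V : Opens M} (hV : V ≤ N) (k : ZStar) (x : V) (v : Fin (r k) → ℝ) :
    Φ.linCoord B hV k x (O.res hV (Φ.gen B k v)) = B.const k v x.1 := by
  rw [linCoord_apply, app_gen, PowerSeries.coeff_monomial_same, B.linPart_ι]

theorem linCoord_mul {V : Opens M} (hV : V ≤ N) (k : ZStar) (x : V) (f g : O.obj V) :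
    Φ.linCoord B hV k x (f * g) =
      O.body V g x • Φ.linCoord B hV k x f + O.body V f x • Φ.linCoord B hV k x g := by
  rw [linCoord_apply, map_mul, PowerSeries.coeff_mul, map_sum]
  simp only [B.linPart_mul, aug_coeff, Finset.sum_add_distrib]
  congr 1
  · rw [Finset.sum_eq_single (k.1.toNat, 0)]
    · rw [if_pos rfl]; rfl
    · intro i hi hne
      have := Finset.HasAntidiagonal.mem_antidiagonal.1 hi
      rw [if_neg fun h0 => hne (Prod.ext (by simp only; omega) h0), zero_smul]
    · intro hn
      exact absurd (Finset.HasAntidiagonal.mem_antidiagonal.2 (by simp)) hn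
  · rw [Finset.sum_eq_single (0, k.1.toNat)]
    · rw [if_pos rfl]; rfl
    · intro i hi hne
      have := Finset.HasAntidiagonal.mem_antidiagonal.1 hi
      rw [if_neg fun h0 => hne (Prod.ext h0 (by simp only; omega)), zero_smul]
    · intro hn
      exact absurd (Finset.HasAntidiagonal.mem_antidiagonal.2 (by simp)) hn

theorem linCoord_of_deg {V : Opens M} (hV : V ≤ N) {k : ZStar} {j : ℤ} (hj : j ≠ -k.1) (x : V)
    {f : O.obj V} (hf : f ∈ O.deg V j) : Φ.linCoord B hV k x f = 0 :=
  B.linPart_of_bideg hj (Φ.bideg_coeff hV hf x _)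

/-- A product of two elements of `I` has no linear part. The filtration level `max(k, 0) + 1` is
chosen so that the remainder does not reach the coefficient where `W k` sits. -/
theorem linCoord_of_mem_Isq {V : Opens M} (hV : V ≤ N) (k : ZStar) (x : V)
    {f : O.obj V} (hf : f ∈ O.Isq V) : Φ.linCoord B hV k x f = 0 := by
  obtain ⟨a, ha, b, hb, rfl⟩ :=
    Submodule.mem_sup.1 ((Submodule.mem_iInf _).1 hf (k.1.toNat + 1))
  rw [map_add]
  have h1 : Φ.linCoord B hV k x a = 0 := by
    refine Submodule.mul_induction_on (C := fun a => Φ.linCoord B hV k x a = 0) ha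
      (fun g hg h hh => ?_) (fun g h hg hh => by rw [map_add, hg, hh, add_zero])
    have hg : O.body V g = 0 := hg
    have hh : O.body V h = 0 := hh
    rw [linCoord_mul, hg, hh]
    simp
  rw [h1, linCoord_apply, (Φ.mem_F_iff hV).1 hb x _ (Nat.lt_succ_self _), map_zero, zero_add]

theorem bicoeff_one {V : Opens M} (hV : V ≤ N) (k : ZStar) {f : O.obj V}
    (hf : f ∈ O.deg V (-k.1)) (x : V) : GSym.bicoeff 1 k.1.toNat (Φ.app hV x f) =
      GSym.ι (fun k => W.fib k x.1) k (Φ.linCoord B hV k x f) := by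
  rw [linCoord_apply, ← B.linPart_comp, GSym.bicoeff_apply]
  rcases GSym.comp_one_of_bideg (Φ.bideg_coeff hV hf x k.1.toNat) with h | ⟨l, w, h, -, hw⟩
  · rw [h, map_zero, map_zero]
  · obtain rfl : k = l := Subtype.ext (neg_injective h)
    rw [hw, B.linPart_ι]

theorem smoothAt_linCoord {V : Opens M} (hV : V ≤ N) (k : ZStar) {j : ℤ} {f : O.obj V}
    (hf : f ∈ O.deg V j) (w : ∀ y, W.fib k y) (hw : ∀ y : V, w y.1 = Φ.linCoord B hV k y f)
    (x : V) : W.smoothAt k w x.1 := by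
  obtain ⟨V', hx, t, ht, h⟩ := (Φ.mem_deg_iff hV).1 hf k.1.toNat x
  have h1 := B.contMDiffAt_linPart ht k hx
  rw [B.smooth_iff] at *
  refine h1.congr_of_eventuallyEq ?_
  filter_upwards [V'.isOpen.mem_nhds hx, V.isOpen.mem_nhds x.2] with y hy hyV
  rw [hw ⟨y, hyV⟩, linCoord_apply]
  exact congrArg (fun a => B.coord k y (B.linPart k y a)) (h ⟨y, hyV⟩ hy)

/-- The element of the fibre of `E_k` defined by a functional on `W k`. -/
noncomputable def toE (k : ZStar) (x : N) (φ : Module.Dual ℝ (W.fib k x.1)) : O.E k.1 x.1 :=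
  ⟨fun U => φ ∘ₗ Φ.linCoord B (inf_le_right : U.1 ⊓ N ≤ N) k ⟨x.1, U.2, x.2⟩ ∘ₗ
      (O.res (inf_le_left : U.1 ⊓ N ≤ U.1)).toLinearMap, by
    refine ⟨fun U V h f => ?_, fun U j hj f hf => ?_, fun U g hg f => ?_, fun U f hf => ?_⟩
    · simp only [LinearMap.comp_apply, AlgHom.toLinearMap_apply]
      have h1 := Φ.linCoord_res B (inf_le_right : U.1 ⊓ N ≤ N) (inf_le_inf_right N h) k
        ⟨x.1, V.2, x.2⟩ (O.res inf_le_left f)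
      rw [O.res_res] at h1 ⊢
      rw [h1]
    · simp only [LinearMap.comp_apply, AlgHom.toLinearMap_apply]
      rw [Φ.linCoord_of_deg B _ hj _ (O.res_deg _ _ _ hf), map_zero]
    · simp only [LinearMap.comp_apply, AlgHom.toLinearMap_apply]
      have h0 : (0 : ℤ) ≠ -k.1 := fun h => k.2 (by omega)
      rw [map_mul, linCoord_mul, Φ.linCoord_of_deg B _ h0 _ (O.res_deg _ _ _ hg), smul_zero,
        zero_add, map_smul, O.body_res, smul_eq_mul]
    · simp only [LinearMap.comp_apply, AlgHom.toLinearMap_apply]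
      rw [Φ.linCoord_of_mem_Isq B, map_zero]
      exact res_mem_Isq _ hf⟩

theorem toE_apply {V : Opens M} (hV : V ≤ N) (k : ZStar) (x : V)
    (φ : Module.Dual ℝ (W.fib k x.1)) (f : O.obj V) :
    (Φ.toE B k ⟨x.1, hV x.2⟩ φ).1 ⟨V, x.2⟩ f = φ (Φ.linCoord B hV k x f) :=
  congrArg φ (Φ.linCoord_res B hV (inf_le_left : V ⊓ N ≤ V) k ⟨x.1, x.2, hV x.2⟩ f)

end Frame
end Iso
end GradedSpace
end GradedQ

/-! ### Duality between the model bundles and the canonical bundles. -/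

namespace GradedQ

universe u v v'
variable {d : ℕ} {M : Type u} [TopologicalSpace M] [ChartedSpace (EuclideanSpace ℝ (Fin d)) M]

namespace GradedSpace

variable {O : GradedSpace.{u, v} d M}

namespace Iso

variable {N : Opens M} {W : GradedFamily.{u, v'} d M} {r : ZStar → ℕ} (Φ : O.Iso N W)
  (B : W.Frame r)

section Duality

/-- The pairing of `W k` with the fibre of `E_k`. -/
noncomputable def pairing (k : ZStar) (x : N) : W.fib k x.1 →ₗ[ℝ] Module.Dual ℝ (O.E k.1 x.1) where
  toFun w := O.cls (Φ.gen B k (B.coord k x.1 w)) k.1 x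
  map_add' w w' := by
    rw [map_add, map_add]
    ext e
    exact map_add (e.1 ⟨N, x.2⟩) _ _
  map_smul' c w := by
    rw [map_smul, map_smul]
    ext e
    exact map_smul (e.1 ⟨N, x.2⟩) _ _

theorem pairing_apply (k : ZStar) (x : N) (w : W.fib k x.1) (e : O.E k.1 x.1) :
    Φ.pairing B k x w e = e.1 ⟨N, x.2⟩ (Φ.gen B k (B.coord k x.1 w)) := rfl

theorem pairing_toE (k : ZStar) (x : N) (w : W.fib k x.1) (φ : Module.Dual ℝ (W.fib k x.1)) :
    Φ.pairing B k x w (Φ.toE B k x φ) = φ w := by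
  rw [pairing_apply, Φ.toE_apply B le_rfl k x φ]
  have := Φ.linCoord_gen B le_rfl k x (B.coord k x.1 w)
  rw [O.res_refl] at this
  rw [this]
  simp [GradedFamily.Frame.const]

variable [T2Space M] [SecondCountableTopology M] [IsManifold (𝓡 d) ∞ M]

/-- Modulo `I²`, a function of degree `-k` is a combination of the generators with smooth
coefficients. An element of `E_k` kills `I²` and sees the coefficients through their values at `x`.
-/
theorem apply_eq_gen {V : Opens M} (hV : V ≤ N) (k : ZStar) (x : V) (e : O.E k.1 x.1)
    {f : O.obj V} (hf : f ∈ O.deg V (-k.1)) : e.1 ⟨V, x.2⟩ f =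
      e.1 ⟨N, hV x.2⟩ (Φ.gen B k (B.coord k x.1 (Φ.linCoord B hV k x f))) := by
  classical
  have hsm : ∀ a : Fin (r k), ContMDiff (𝓡 d) 𝓘(ℝ, ℝ) ∞
      fun y : V => B.coord k y.1 (Φ.linCoord B hV k y f) a := by
    intro a y
    let w : ∀ y, W.fib k y := fun y => if hy : y ∈ V then Φ.linCoord B hV k ⟨y, hy⟩ f else 0
    have hw : ∀ y : V, w y.1 = Φ.linCoord B hV k y f := fun y => dif_pos y.2
    have h1 := (B.smooth_iff k w y.1).1 (Φ.smoothAt_linCoord B hV k hf w hw y)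
    have h2 := (contMDiffAt_subtype_iff (x := y)).2 (contMDiffAt_pi_space.1 h1 a)
    refine h2.congr_of_eventuallyEq (Filter.Eventually.of_forall fun z => ?_)
    simp only [hw]
  choose c hc hcx hcb using fun a => Φ.exists_const hV ⟨_, hsm a⟩
  -- The difference has no constant or linear part in any negative degree, so density puts it in `I²
  -- + F^n` for every `n`, that is, in the closed square.
  have key : f - ∑ a, c a * O.res hV (Φ.gen B k (Pi.single a 1)) ∈ O.Isq V := by
    have hd : f - ∑ a, c a * O.res hV (Φ.gen B k (Pi.single a 1)) ∈ O.deg V (-k.1) := by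
      refine Submodule.sub_mem _ hf (Submodule.sum_mem _ fun a _ => ?_)
      simpa using mul_mem_deg (hc a) (O.res_deg hV _ _ (Φ.gen_mem B k (Pi.single a 1)))
    refine mem_Isq_of_forall fun n => Φ.mem_sup_of_vanish B hV _ 2 n _ hd fun y q hq m _ => ?_
    have hI := Φ.vanish_one hV (O.body_deg V _ (neg_ne_zero.2 k.2) _ hd) y (m + 1)
    interval_cases q
    · exact hI 0 one_pos m m.lt_succ_self
    · by_cases hm : m = k.1.toNat
      · subst hm
        rw [Φ.bicoeff_one B hV k hd]
        have : Φ.linCoord B hV k y (f - ∑ a, c a * O.res hV (Φ.gen B k (Pi.single a 1))) = 0 := by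
          rw [map_sub, map_sum, sub_eq_zero]
          conv_lhs => rw [B.sum_const k y.1 (Φ.linCoord B hV k y f)]
          refine Finset.sum_congr rfl fun a _ => ?_
          rw [linCoord_mul, linCoord_gen, hcb,
            Φ.linCoord_of_deg B hV (fun h => k.2 (by omega)) y (hc a), smul_zero, zero_add]
          rfl
        rw [this, map_zero]
      · rcases GSym.comp_one_of_bideg (Φ.bideg_coeff hV hd y m) with h | ⟨l, w, h, h', -⟩
        · exact h
        · obtain rfl : k = l := Subtype.ext (neg_injective h)
          exact absurd h' hm
  have h0 := e.2.2.2.2 ⟨V, x.2⟩ _ key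
  rw [map_sub, map_sum, sub_eq_zero] at h0
  rw [h0]
  conv_rhs => rw [← Finset.univ_sum_single (B.coord k x.1 (Φ.linCoord B hV k x f))]
  rw [map_sum, map_sum]
  refine Finset.sum_congr rfl fun a _ => ?_
  rw [e.2.2.2.1 ⟨V, x.2⟩ _ (hc a), hcb, e.2.1 ⟨N, hV x.2⟩ ⟨V, x.2⟩ hV]
  have h1 : ∀ t : ℝ, (Pi.single a t : Fin (r k) → ℝ) = t • Pi.single a 1 := fun t => by
    ext i
    simp [Pi.single_apply]
  rw [h1 (B.coord k x.1 _ a), map_smul, map_smul]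
  rfl

theorem cls_eq_pairing {V : Opens M} (hV : V ≤ N) (k : ZStar) (x : V) {f : O.obj V}
    (hf : f ∈ O.deg V (-k.1)) :
    O.cls f k.1 x = Φ.pairing B k ⟨x.1, hV x.2⟩ (Φ.linCoord B hV k x f) := by
  ext e
  exact Φ.apply_eq_gen B hV k x e hf

/-- By `apply_eq_gen` an element of `E_k` is determined by its values on the generators, and these
define the functional. -/
theorem exists_toE (k : ZStar) (x : N) (e : O.E k.1 x.1) : ∃ φ, Φ.toE B k x φ = e := by
  refine ⟨LinearMap.flip (Φ.pairing B k x) e, Subtype.ext (funext fun U => ?_)⟩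
  refine LinearMap.ext fun f => ?_
  induction f using deg_induction with
  | h0 => simp
  | hj j f hf =>
    by_cases hj : j = -k.1
    · subst hj
      set V := U.1 ⊓ N with hV
      have hx : x.1 ∈ V := ⟨U.2, x.2⟩
      rw [← e.2.1 U ⟨V, hx⟩ inf_le_left, ← (Φ.toE B k x _).2.1 U ⟨V, hx⟩ inf_le_left]
      rw [Φ.apply_eq_gen B inf_le_right k ⟨x.1, hx⟩ e (O.res_deg _ _ _ hf)]
      exact Φ.toE_apply B (inf_le_right : V ≤ N) k ⟨x.1, hx⟩ _ _
    · rw [(Φ.toE B k x _).2.2.1 U j hj f hf, e.2.2.1 U j hj f hf]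
  | ha a b h h' => rw [map_add, map_add, h, h']

/-- The functionals on `W k` exhaust `E_k` and are separated by it, so the claim is reflexivity of
the finite-dimensional fibre. -/
theorem bijective_pairing (k : ZStar) (x : N) : Function.Bijective (Φ.pairing B k x) := by
  have : FiniteDimensional ℝ (W.fib k x.1) := Module.Finite.equiv (B.coord k x.1).symm
  constructor
  · refine (injective_iff_map_eq_zero _).2 fun w hw => ?_
    refine (Module.forall_dual_apply_eq_zero_iff ℝ w).1 fun φ => ?_
    rw [← Φ.pairing_toE B k x w φ, hw]
    rfl
  · intro ξ
    let T : Module.Dual ℝ (W.fib k x.1) →ₗ[ℝ] O.E k.1 x.1 :=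
      { toFun := Φ.toE B k x
        map_add' := fun _ _ => rfl
        map_smul' := fun _ _ => rfl }
    obtain ⟨w, hw⟩ := (Module.evalEquiv ℝ (W.fib k x.1)).surjective (ξ ∘ₗ T)
    refine ⟨w, LinearMap.ext fun e => ?_⟩
    obtain ⟨φ, rfl⟩ := Φ.exists_toE B k x e
    rw [pairing_toE]
    exact LinearMap.congr_fun hw φ

/-- The identification of `W k` with `(E_k)*`. -/
noncomputable def pairingEquiv (k : ZStar) (x : N) : W.fib k x.1 ≃ₗ[ℝ] O.dualFamily.fib k x.1 :=
  LinearEquiv.ofBijective (Φ.pairing B k x) (Φ.bijective_pairing B k x)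

open Classical in
/-- The identification of `W k` with `(E_k)*` over `N`, extended by zero. -/
noncomputable def toDual (y : M) (k : ZStar) : W.fib k y →ₗ[ℝ] O.dualFamily.fib k y :=
  if hy : y ∈ N then (Φ.pairingEquiv B k ⟨y, hy⟩).toLinearMap else 0

open Classical in
/-- The inverse of `toDual`. -/
noncomputable def ofDual (y : M) (k : ZStar) : O.dualFamily.fib k y →ₗ[ℝ] W.fib k y :=
  if hy : y ∈ N then (Φ.pairingEquiv B k ⟨y, hy⟩).symm.toLinearMap else 0

theorem toDual_eq (x : N) (k : ZStar) (w : W.fib k x.1) :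
    Φ.toDual B x.1 k w = Φ.pairingEquiv B k x w := by
  rw [toDual, dif_pos x.2]
  rfl

theorem ofDual_eq (x : N) (k : ZStar) (w : O.dualFamily.fib k x.1) :
    Φ.ofDual B x.1 k w = (Φ.pairingEquiv B k x).symm w := by
  rw [ofDual, dif_pos x.2]
  rfl

theorem toDual_linCoord {V : Opens M} (hV : V ≤ N) (k : ZStar) (x : V) {f : O.obj V}
    (hf : f ∈ O.deg V (-k.1)) : Φ.toDual B x.1 k (Φ.linCoord B hV k x f) = O.cls f k.1 x :=
  (Φ.toDual_eq B ⟨x.1, hV x.2⟩ k _).trans (Φ.cls_eq_pairing B hV k x hf).symm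

theorem ofDual_toDual (y : M) (hy : y ∈ N) (k : ZStar) (w : W.fib k y) :
    Φ.ofDual B y k (Φ.toDual B y k w) = w := by
  rw [Φ.ofDual_eq B ⟨y, hy⟩, Φ.toDual_eq B ⟨y, hy⟩]
  exact LinearEquiv.symm_apply_apply _ w

theorem toDual_ofDual (y : M) (hy : y ∈ N) (k : ZStar) (w : O.dualFamily.fib k y) :
    Φ.toDual B y k (Φ.ofDual B y k w) = w := by
  rw [Φ.ofDual_eq B ⟨y, hy⟩, Φ.toDual_eq B ⟨y, hy⟩]
  exact LinearEquiv.apply_symm_apply _ w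

/-- A smooth section of `W k` is the linear part of a function, and smoothness in `(E_k)*` means
being the class of a function. -/
theorem smoothAt_toDual (V : Opens M) (hV : V ≤ N) (k : ZStar) (w : ∀ y, W.fib k y)
    (hw : ∀ y ∈ V, W.smoothAt k w y) (y : M) (hy : y ∈ V) :
    O.dualFamily.smoothAt k (fun y => Φ.toDual B y k (w y)) y := by
  obtain ⟨f, hf, hfx⟩ := Φ.exists_app_eq hV (W.genSec_mem k (fun x : V => w x.1) fun x =>
    ⟨V, w, x.2, hw, fun _ _ => rfl⟩)
  refine ⟨V, hy, f, hf, fun z => Eq.trans ?_ (Φ.toDual_linCoord B hV k z hf)⟩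
  have : Φ.linCoord B hV k z f = w z.1 := by
    rw [linCoord_apply, hfx, GradedFamily.genSec, PowerSeries.coeff_monomial_same, B.linPart_ι]
  rw [this]

theorem smoothAt_ofDual (V : Opens M) (hV : V ≤ N) (k : ZStar) (w : ∀ y, O.dualFamily.fib k y)
    (hw : ∀ y ∈ V, O.dualFamily.smoothAt k w y) (y : M) (hy : y ∈ V) :
    W.smoothAt k (fun y => Φ.ofDual B y k (w y)) y := by
  obtain ⟨V', hyV, f, hf, h⟩ := hw y hy
  refine Φ.smoothAt_linCoord B (inf_le_right.trans hV : V' ⊓ V ≤ N) k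
    (O.res_deg inf_le_left _ f hf) _ (fun z => ?_) ⟨y, hyV, hy⟩
  have h1 := Φ.toDual_linCoord B (inf_le_right.trans hV : V' ⊓ V ≤ N) k z
    (O.res_deg inf_le_left _ f hf)
  rw [cls_res] at h1
  rw [h ⟨z.1, z.2.1⟩]
  refine (congrArg (Φ.ofDual B z.1 k) h1.symm).trans ?_
  exact Φ.ofDual_toDual B z.1 (hV z.2.2) k _

/-- The isomorphism with the symmetric algebra of the canonical bundles induced by `Φ`. -/
noncomputable def canonical : O.Iso N O.dualFamily :=
  Φ.congr (Φ.toDual B) (Φ.ofDual B) (Φ.smoothAt_toDual B) (Φ.smoothAt_ofDual B)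
    (Φ.ofDual_toDual B) (Φ.toDual_ofDual B)

theorem app_canonical {V : Opens M} (hV : V ≤ N) (x : V) (f : O.obj V) :
    (Φ.canonical B).app hV x f = GSym.mapSeries (Φ.toDual B x.1) (Φ.app hV x f) := rfl

theorem adapted_canonical : (Φ.canonical B).Adapted where
  lin hV k f hf x := by
    rw [app_canonical, GSym.bicoeff_mapSeries, Φ.bicoeff_one B hV k hf, GSym.map_ι]
    exact congrArg (GSym.ι (fun k => O.dualFamily.fib k x.1) k) (Φ.toDual_linCoord B hV k x hf)
  dense hV j p n f hf h := by
    refine Φ.mem_sup_of_vanish B hV j p n f hf fun x q hq m hm => ?_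
    have h1 := h x q hq m hm
    rw [app_canonical, GSym.bicoeff_mapSeries] at h1
    have h2 := congrArg (GSym.map (Φ.ofDual B x.1)) h1
    rwa [GSym.map_map_of_leftInverse (fun k w => Φ.ofDual_toDual B x.1 (hV x.2) k w),
      map_zero] at h2

end Duality

/-- The restriction of an isomorphism to a smaller open set. -/
noncomputable def restrict {N' : Opens M} (h : N' ≤ N) : O.Iso N' W where
  equiv V hV := Φ.equiv V (hV.trans h)
  natural V V' hV := Φ.natural V V' (hV.trans h)
  deg V hV := Φ.deg V (hV.trans h)
  filt V hV := Φ.filt V (hV.trans h)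
  body V hV := Φ.body V (hV.trans h)

theorem Adapted.restrict {Φ : O.Iso N O.dualFamily} (hΦ : Φ.Adapted) {N' : Opens M}
    (h : N' ≤ N) : (Φ.restrict h).Adapted where
  lin hV := hΦ.lin (hV.trans h)
  dense hV := hΦ.dense (hV.trans h)

end Iso

end GradedSpace

namespace GradedManifold

variable (O : GradedManifold.{u, v} d M)
variable [T2Space M] [SecondCountableTopology M] [IsManifold (𝓡 d) ∞ M]

/-- Locally, a graded manifold splits. -/
theorem exists_adapted (x : M) :
    ∃ (N : Opens M) (Φ : O.Iso N O.dualFamily), x ∈ N ∧ Φ.Adapted := by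
  obtain ⟨N, hx, r, ⟨Φ⟩⟩ := O.locally_split x
  exact ⟨N, Φ.canonical (GradedFamily.trivialFrame d M r), hx,
    Φ.adapted_canonical (GradedFamily.trivialFrame d M r)⟩

end GradedManifold
end GradedQ

/-! ### Local existence of a compatible Euler vector field. -/

namespace GradedQ

universe u v v'
variable {d : ℕ} {M : Type u} [TopologicalSpace M] [ChartedSpace (EuclideanSpace ℝ (Fin d)) M]

namespace GradedSpace

variable {O : GradedSpace.{u, v} d M}

namespace Iso

section
variable {N : Opens M} {W : GradedFamily.{u, v'} d M} (Φ : O.Iso N W) {V : Opens M} (hV : V ≤ N)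

theorem exists_euler (f : O.obj V) : ∃ g, (∀ x, Φ.app hV x g = GSym.eulerSeries (Φ.app hV x f)) ∧
    ∀ j, f ∈ O.deg V j → g ∈ O.deg V j := by
  suffices h : ∃ g, ∀ x, Φ.app hV x g = GSym.eulerSeries (Φ.app hV x f) by
    obtain ⟨g, hg⟩ := h
    refine ⟨g, hg, fun j hf => (Φ.mem_deg_iff hV).2 ?_⟩
    simp only [hg]
    exact GradedFamily.euler_mem_homSections ((Φ.mem_deg_iff hV).1 hf)
  induction f using deg_induction with
  | h0 => exact ⟨0, by simp⟩
  | hj j f hf =>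
    obtain ⟨g, -, hg⟩ := Φ.exists_app_eq hV
      (GradedFamily.euler_mem_homSections ((Φ.mem_deg_iff hV).1 hf))
    exact ⟨g, hg⟩
  | ha a b h h' =>
    obtain ⟨g, hg⟩ := h
    obtain ⟨g', hg'⟩ := h'
    exact ⟨g + g', fun x => by rw [map_add, map_add, map_add, hg, hg']⟩

/-- The Euler vector field of a trivialization. -/
noncomputable def euler : O.obj V →ₗ[ℝ] O.obj V where
  toFun f := (Φ.exists_euler hV f).choose
  map_add' f g := Φ.app_ext hV fun x => by
    rw [map_add, (Φ.exists_euler hV _).choose_spec.1, (Φ.exists_euler hV _).choose_spec.1,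
      (Φ.exists_euler hV _).choose_spec.1, map_add, map_add]
  map_smul' c f := Φ.app_ext hV fun x => by
    rw [RingHom.id_apply, map_smul, (Φ.exists_euler hV _).choose_spec.1,
      (Φ.exists_euler hV _).choose_spec.1, map_smul, map_smul]

theorem app_euler (f : O.obj V) (x : V) :
    Φ.app hV x (Φ.euler hV f) = GSym.eulerSeries (Φ.app hV x f) :=
  (Φ.exists_euler hV f).choose_spec.1 x

theorem euler_mem_deg {j : ℤ} {f : O.obj V} (hf : f ∈ O.deg V j) : Φ.euler hV f ∈ O.deg V j :=
  (Φ.exists_euler hV f).choose_spec.2 j hf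

-- This makes multiplication by a primitive `θ` raise the filtration by one, offsetting the step
-- lost to `Q`.
include Φ hV in
theorem mem_F_one_of_deg {f : O.obj V} (hf : f ∈ O.deg V (-1)) : f ∈ O.F V 1 := by
  refine (Φ.mem_F_iff hV).2 fun x m hm => ?_
  exact GSym.eq_zero_of_bideg (Φ.bideg_coeff hV hf x m) (by omega)

end

variable {N : Opens M} {Φ : O.Iso N O.dualFamily} (hΦ : Φ.Adapted)

/-- The atlas consisting of one adapted isomorphism. -/
noncomputable def Adapted.atlas : O.SplittingAtlas N :=
  ⟨fun _ => N, fun x => x.2, fun _ => Φ, fun _ => hΦ⟩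

/-- The Euler vector field of an adapted isomorphism. -/
noncomputable def Adapted.eulerField : EulerField hΦ.atlas where
  op _ hV := Φ.euler hV
  res hV h f := Φ.app_ext (h.trans hV) fun x => by
    rw [app_euler, Φ.app_res hV h, Φ.app_res hV h, app_euler]
  deg hV _ _ hf := Φ.euler_mem_deg hV hf
  leibniz hV f g := Φ.app_ext hV fun x => by
    rw [app_euler, map_mul, GSym.eulerSeries_mul, map_add, map_mul (Φ.app hV x),
      map_mul (Φ.app hV x), app_euler, app_euler]
  filt hV n f hf := (Φ.mem_F_iff hV).2 fun x m hm => by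
    have h := (Φ.mem_F_iff hV).1 hf x m hm
    rw [app_euler]
    simp [GSym.eulerSeries, h]
  body hV f := (Φ.mem_I_iff hV).2 fun x => by
    rw [app_euler, GSym.bicoeff_eulerSeries]
    simp
  near _ V hV _ f hf n := by
    refine I_induction (P := fun f => Φ.euler hV f - f ∈ O.Ipow V 2 ⊔ O.F V n) (by simp)
      (fun j f hj hf => ?_) (fun a b h h' => ?_) hf
    · refine hΦ.dense hV j 2 n _ (Submodule.sub_mem _ (Φ.euler_mem_deg hV hj) hj)
        fun x q hq m _ => ?_
      have h0 := Φ.vanish_one hV hf x (m + 1) 0 one_pos m m.lt_succ_self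
      rw [map_sub, map_sub, app_euler, GSym.bicoeff_eulerSeries]
      interval_cases q
      · simp [h0]
      · simp
    · rw [map_add, add_sub_add_comm]
      exact Submodule.add_mem _ h h'

end Iso
end GradedSpace

namespace QStructure

open GradedSpace

variable {O : GradedManifold.{u, v} d M} (D : QStructure O)

theorem Q_one (V : Opens M) : D.Q V 1 = 0 := by
  have := D.leibniz V 0 1 (one_mem_deg V) 1
  simpa using this

theorem body_Q_of_mem {V : Opens M} {f : O.obj V} (hf : f ∈ O.Ipow V 2 ⊔ O.F V 2) :
    D.Q V f ∈ O.I V := by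
  obtain ⟨a, ha, b, hb, rfl⟩ := Submodule.mem_sup.1 hf
  rw [map_add]
  refine Submodule.add_mem _ ?_ (O.body_F (D.filt V 1 b hb))
  exact Submodule.mul_le.2 (fun a ha b _ => mul_mem_I_right b ha) (D.Q_mem_Ipow ha)

/-- Applying `Q` to `Q f * g = 1` gives `Q f * Q g = 0`, and `Q f` is invertible. -/
theorem Q_Q_mul_inverse {V : Opens M} {f g : O.obj V}
    (h : D.Q V f * g = 1) (hf : f ∈ O.deg V (-1)) : D.Q V g = 0 := by
  have hQ : D.Q V f ∈ O.deg V 0 := by simpa using D.deg V _ f hf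
  have h1 := D.leibniz V 0 _ hQ g
  rw [h, D.Q_one, D.square, zero_mul, zero_add, zpow_zero, one_smul] at h1
  rw [← one_mul (D.Q V g), ← h, commute_of_mem_deg_zero hQ, mul_assoc, ← h1, mul_zero]

theorem exists_body_ne_zero {x : M} (hκ : D.curvature x ≠ 0) :
    ∃ (V : Opens M) (hx : x ∈ V), ∃ f ∈ O.deg V (-1), O.body V (D.Q V f) ⟨x, hx⟩ ≠ 0 := by
  by_contra! h
  refine hκ (Subtype.ext (funext fun V => LinearMap.ext fun f => ?_))
  change O.body V.1 (D.Q V.1 f) ⟨x, V.2⟩ = 0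
  induction f using deg_induction with
  | h0 => simp
  | hj j f hf =>
    by_cases hj : j = -1
    · subst hj
      exact h V.1 V.2 f hf
    · rw [O.body_deg V.1 (j + 1) (by omega) _ (D.deg V.1 j f hf)]
      rfl
  | ha a b h h' =>
    rw [map_add, map_add]
    exact (congrArg₂ (· + ·) h h').trans (add_zero 0)

/-- Near a point where the curvature does not vanish, there is an adapted isomorphism and a function
of degree `-1` with `Q θ = 1`. -/
theorem exists_primitive [T2Space M] [SecondCountableTopology M] [IsManifold (𝓡 d) ∞ M] {x : M}
    (hκ : D.curvature x ≠ 0) (U : Opens M) (hxU : x ∈ U) :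
    ∃ (N : Opens M) (Φ : O.Iso N O.dualFamily), x ∈ N ∧ N ≤ U ∧ Φ.Adapted ∧
      ∃ θ ∈ O.deg N (-1), D.Q N θ = 1 := by
  obtain ⟨N₀, Φ, hx₀, hΦ⟩ := O.exists_adapted x
  obtain ⟨V, hxV, f, hf, hne⟩ := D.exists_body_ne_zero hκ
  -- The locus where the body of `Q f` does not vanish: there `Q f` becomes invertible.
  let S : Opens M := ⟨Subtype.val '' {y : V | O.body V (D.Q V f) y ≠ 0},
    V.isOpen.isOpenMap_subtype_val _
      (isOpen_ne_fun (O.body V (D.Q V f)).contMDiff.continuous continuous_const)⟩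
  have hSV : S ≤ V := by
    rintro _ ⟨y, -, rfl⟩
    exact y.2
  let N : Opens M := (N₀ ⊓ S) ⊓ U
  have hN₀ : N ≤ N₀ := inf_le_left.trans inf_le_left
  have hNV : N ≤ V := (inf_le_left.trans inf_le_right).trans hSV
  have hfN : O.res hNV f ∈ O.deg N (-1) := O.res_deg hNV _ f hf
  have hQ : D.Q N (O.res hNV f) ∈ O.deg N 0 := by simpa using D.deg N _ _ hfN
  obtain ⟨g, hg, hfg⟩ := Φ.exists_inverse hN₀ hQ fun y => by
    rw [D.res hNV, O.body_res]
    obtain ⟨z, hz, hzy⟩ := y.2.1.2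
    have : (⟨y.1, hNV y.2⟩ : V) = z := Subtype.ext hzy.symm
    rw [this]
    exact hz
  -- The primitive is `θ = f g` with `g` the inverse of `Q f`; as `g` is closed, `Q θ = Q f * g =
  -- 1`.
  refine ⟨N, Φ.restrict hN₀, ⟨⟨hx₀, ⟨x, hxV⟩, hne, rfl⟩, hxU⟩, inf_le_right, hΦ.restrict hN₀,
    O.res hNV f * g, by simpa using mul_mem_deg hfN hg, ?_⟩
  rw [D.leibniz N _ _ hfN, D.Q_Q_mul_inverse hfg hfN, mul_zero, smul_zero, add_zero, hfg]

section Correction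

variable {N : Opens M} {Φ : O.Iso N O.dualFamily} {hΦ : Φ.Adapted} (ε : EulerField hΦ.atlas)

/-- The defect `[Q, ε] - Q`. -/
noncomputable def defect {V : Opens M} (hV : V ≤ N) : O.obj V →ₗ[ℝ] O.obj V :=
  D.Q V ∘ₗ ε.op V hV - ε.op V hV ∘ₗ D.Q V - D.Q V

theorem defect_apply {V : Opens M} (hV : V ≤ N) (f : O.obj V) :
    D.defect ε hV f = D.Q V (ε.op V hV f) - ε.op V hV (D.Q V f) - D.Q V f := rfl

theorem defect_mem_deg {V : Opens M} (hV : V ≤ N) {j : ℤ} {f : O.obj V} (hf : f ∈ O.deg V j) :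
    D.defect ε hV f ∈ O.deg V (j + 1) :=
  Submodule.sub_mem _ (Submodule.sub_mem _ (D.deg V j _ (ε.deg hV j f hf))
    (ε.deg hV _ _ (D.deg V j f hf))) (D.deg V j f hf)

theorem defect_mul {V : Opens M} (hV : V ≤ N) {j : ℤ} {f : O.obj V} (hf : f ∈ O.deg V j)
    (g : O.obj V) : D.defect ε hV (f * g) =
      D.defect ε hV f * g + (-1 : ℝ) ^ j • (f * D.defect ε hV g) := by
  simp only [defect_apply]
  rw [ε.leibniz, map_add, D.leibniz V j _ (ε.deg hV j f hf), D.leibniz V j f hf,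
    D.leibniz V j f hf, map_add, map_smul, ε.leibniz, ε.leibniz]
  simp only [sub_mul, mul_sub, smul_add, smul_sub]
  abel

/-- This is `[Q, [Q, ε] - Q] = 0`, a consequence of `Q² = 0`. -/
theorem defect_Q {V : Opens M} (hV : V ≤ N) (f : O.obj V) :
    D.Q V (D.defect ε hV f) = -D.defect ε hV (D.Q V f) := by
  simp only [defect_apply, map_sub, D.square, map_zero]
  abel

theorem defect_res {V V' : Opens M} (hV : V ≤ N) (h : V' ≤ V) (f : O.obj V) :
    D.defect ε (h.trans hV) (O.res h f) = O.res h (D.defect ε hV f) := by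
  simp only [defect_apply, map_sub, D.res h, ε.res hV h]

/-- On `I`, `ε f - f` has order two, so `Q` sends it into `I`, and `ε Q f` lies in `I` always. Hence
subtracting `θ δ` changes `ε` on `I` only by elements of `I²`. -/
theorem defect_mem_I {V : Opens M} (x : N) (hV : V ≤ N) {f : O.obj V} (hf : f ∈ O.I V) :
    D.defect ε hV f ∈ O.I V := by
  have h1 := D.body_Q_of_mem (ε.near x hV hV f hf 2)
  have h2 := ε.body hV (D.Q V f)
  have h3 := Submodule.sub_mem _ h1 h2
  rw [map_sub] at h3
  rw [defect_apply]
  convert h3 using 1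
  abel

theorem defect_mem_F {V : Opens M} (hV : V ≤ N) {n : ℕ} {f : O.obj V} (hf : f ∈ O.F V (n + 1)) :
    D.defect ε hV f ∈ O.F V n :=
  Submodule.sub_mem _ (Submodule.sub_mem _ (D.filt V n _ (ε.filt hV _ f hf))
    (ε.filt hV _ _ (D.filt V n f hf))) (D.filt V n f hf)

variable {θ : O.obj N} (hθ : θ ∈ O.deg N (-1)) (hQ : D.Q N θ = 1)

/-- The correction of an Euler vector field `ε` by a primitive `θ` of `1`. -/
noncomputable def corrected : EulerField hΦ.atlas where
  op V hV := ε.op V hV - LinearMap.mulLeft ℝ (O.res hV θ) ∘ₗ D.defect ε hV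
  res hV h f := by
    simp only [LinearMap.sub_apply, LinearMap.comp_apply, LinearMap.mulLeft_apply, map_sub,
      map_mul, ε.res hV h, D.defect_res ε hV h, O.res_res]
  deg {V} hV j f hf := by
    refine Submodule.sub_mem _ (ε.deg hV j f hf) ?_
    have := mul_mem_deg (O.res_deg hV _ θ hθ) (D.defect_mem_deg ε hV hf)
    rwa [neg_add_cancel_comm_assoc] at this
  leibniz {V} hV f g := by
    simp only [LinearMap.sub_apply, LinearMap.comp_apply, LinearMap.mulLeft_apply]
    induction f using deg_induction with
    | h0 => simp
    | hj j f hf =>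
      have h1 := O.gcomm V _ _ _ (O.res_deg hV _ θ hθ) f hf
      -- The sign from moving `θ` past `f` cancels the sign in the Leibniz rule of the defect, so `θ
      -- δ` is an even derivation.
      have h2 : (-1 : ℝ) ^ j * (-1 : ℝ) ^ (-1 * j) = 1 := by
        rw [← zpow_add₀ (by norm_num)]
        simp
      rw [D.defect_mul ε hV hf, ε.leibniz, mul_add, mul_smul_comm, ← mul_assoc, ← mul_assoc, h1,
        smul_mul_assoc, smul_smul, h2, one_smul, sub_mul, mul_sub, mul_assoc f]
      abel
    | ha a b h h' =>
      simp only [add_mul, map_add, mul_add] at h h' ⊢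
      rw [add_sub_add_comm, h, h']
      simp only [add_mul, sub_mul]
      abel
  filt {V} hV n f hf := by
    refine Submodule.sub_mem _ (ε.filt hV n f hf) ?_
    cases n with
    | zero => exact Φ.mem_F_zero hV _
    | succ n =>
      have := Φ.mul_mem_F hV (Φ.mem_F_one_of_deg hV (O.res_deg hV _ θ hθ)) (D.defect_mem_F ε hV hf)
      rwa [add_comm] at this
  body {V} hV f := Submodule.sub_mem _ (ε.body hV f)
    (mul_mem_I_right _ (res_mem_I hV (O.body_deg N _ (by norm_num) θ hθ)))
  near x {V} hV hx f hf n := by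
    have h1 : O.res hV θ * D.defect ε hV f ∈ O.Ipow V 2 :=
      mul_mem_Ipow_succ (res_mem_I hV (O.body_deg N _ (by norm_num) θ hθ))
        (mem_Ipow_one (D.defect_mem_I ε x hV hf))
    have h2 := Submodule.sub_mem _ (ε.near x hV hx f hf n) (Submodule.mem_sup_left h1)
    convert h2 using 1
    simp only [LinearMap.sub_apply, LinearMap.comp_apply, LinearMap.mulLeft_apply]
    abel

-- `Q(θ δ f) = δ f - θ Q δ f = δ f + θ δ Q f`, so subtracting `θ δ` cancels the defect exactly.
include hQ in
theorem Q_corrected {V : Opens M} (hV : V ≤ N) (f : O.obj V) :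
    D.Q V ((D.corrected ε hθ).op V hV f) = (D.corrected ε hθ).op V hV (D.Q V f) + D.Q V f := by
  simp only [corrected, LinearMap.sub_apply, LinearMap.comp_apply, LinearMap.mulLeft_apply]
  rw [map_sub, D.leibniz V _ _ (O.res_deg hV _ θ hθ), D.res, hQ, map_one, one_mul, D.defect_Q]
  have h1 : D.Q V (ε.op V hV f) = D.defect ε hV f + ε.op V hV (D.Q V f) + D.Q V f := by
    rw [defect_apply]
    abel
  rw [h1]
  simp only [zpow_neg, zpow_one, mul_neg, smul_neg]
  norm_num
  abel

end Correction
end QStructure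
end GradedQ

/-! ### Gluing Euler vector fields, and closed lifts of a partition of unity. -/

namespace GradedQ

universe u v v'
variable {d : ℕ} {M : Type u} [TopologicalSpace M] [ChartedSpace (EuclideanSpace ℝ (Fin d)) M]

namespace GradedSpace

variable {O : GradedSpace.{u, v} d M}

section Glue

variable {U : Opens M} {A : O.SplittingAtlas U} (e : ∀ x, EulerField (A.adapted x).atlas)

/-- The function `g` agrees locally with the image of `f` under the Euler vector fields `e x`. -/
def IsGlued {V : Opens M} (f g : O.obj V) : Prop :=
  ∀ (x : U) (V' : Opens M) (h : V' ≤ V) (hx : V' ≤ A.dom x),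
    O.res h g = (e x).op V' hx (O.res h f)

variable {e}

theorem IsGlued.unique {V : Opens M} (hV : V ≤ U) {f g g' : O.obj V} (h : IsGlued e f g)
    (h' : IsGlued e f g') : g = g' := by
  refine eq_of_local fun x hx => ⟨A.dom ⟨x, hV hx⟩ ⊓ V, inf_le_right, ⟨A.mem ⟨x, hV hx⟩, hx⟩, ?_⟩
  rw [h ⟨x, hV hx⟩ _ inf_le_right inf_le_left, h' ⟨x, hV hx⟩ _ inf_le_right inf_le_left]

theorem IsGlued.add {V : Opens M} {f f' g g' : O.obj V} (h : IsGlued e f g)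
    (h' : IsGlued e f' g') : IsGlued e (f + f') (g + g') := fun x V' hV hx => by
  rw [map_add, map_add, map_add, h x V' hV hx, h' x V' hV hx]

theorem IsGlued.smul {V : Opens M} {f g : O.obj V} (h : IsGlued e f g) (c : ℝ) :
    IsGlued e (c • f) (c • g) := fun x V' hV hx => by
  rw [map_smul, map_smul, map_smul, h x V' hV hx]

theorem isGlued_zero (V : Opens M) : IsGlued e (0 : O.obj V) 0 := fun x V' hV hx => by
  rw [map_zero, map_zero]

variable (hc : ∀ (x y : U) (V : Opens M) (hx : V ≤ A.dom x) (hy : V ≤ A.dom y) (f : O.obj V),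
  (e x).op V hx f = (e y).op V hy f)

include hc

/-- Images under the local fields agree on overlaps by `hc`. The argument stays in one degree
because only there gluing is available. -/
theorem exists_isGlued_of_deg {V : Opens M} (hV : V ≤ U) {j : ℤ} {f : O.obj V}
    (hf : f ∈ O.deg V j) : ∃ g ∈ O.deg V j, IsGlued e f g := by
  obtain ⟨g, hg, h⟩ := exists_glue (V := V) j (fun x => A.dom ⟨x.1, hV x.2⟩ ⊓ V)
    (fun x => inf_le_right) (fun x => ⟨A.mem ⟨x.1, hV x.2⟩, x.2⟩)
    (fun x => (e ⟨x.1, hV x.2⟩).op _ inf_le_left (O.res inf_le_right f))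
    (fun x => (e _).deg _ _ _ (O.res_deg _ _ _ hf)) (fun x y => by
      rw [← (e ⟨x.1, hV x.2⟩).res inf_le_left, ← (e ⟨y.1, hV y.2⟩).res inf_le_left, O.res_res,
        O.res_res]
      exact hc _ _ _ _ _ _)
  refine ⟨g, hg, fun x V' hV' hx => eq_of_local fun y hy => ?_⟩
  set z : V := ⟨y, hV' hy⟩ with hz
  set z' : U := ⟨y, hV z.2⟩ with hz'
  have h1 : V' ⊓ A.dom z' ≤ A.dom z' ⊓ V := le_inf inf_le_right (inf_le_left.trans hV')
  refine ⟨V' ⊓ A.dom z', inf_le_left, ⟨hy, A.mem z'⟩, ?_⟩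
  have h2 := congrArg (O.res h1) (h z)
  rw [O.res_res] at h2
  rw [O.res_res, h2, ← (e x).res hx, O.res_res]
  refine ((e z').res inf_le_left h1 _).symm.trans ?_
  rw [O.res_res]
  exact hc _ _ _ _ _ _

theorem exists_isGlued {V : Opens M} (hV : V ≤ U) (f : O.obj V) : ∃ g, IsGlued e f g := by
  induction f using deg_induction with
  | h0 => exact ⟨0, isGlued_zero V⟩
  | hj j f hf =>
    obtain ⟨g, -, hg⟩ := exists_isGlued_of_deg hc hV hf
    exact ⟨g, hg⟩
  | ha a b h h' =>
    obtain ⟨g, hg⟩ := h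
    obtain ⟨g', hg'⟩ := h'
    exact ⟨g + g', hg.add hg'⟩

/-- The operator obtained by gluing Euler vector fields. -/
noncomputable def glueOp (V : Opens M) (hV : V ≤ U) : O.obj V →ₗ[ℝ] O.obj V where
  toFun f := (exists_isGlued hc hV f).choose
  map_add' f g := (exists_isGlued hc hV _).choose_spec.unique hV
    ((exists_isGlued hc hV f).choose_spec.add (exists_isGlued hc hV g).choose_spec)
  map_smul' c f := (exists_isGlued hc hV _).choose_spec.unique hV
    ((exists_isGlued hc hV f).choose_spec.smul c)

theorem isGlued_glueOp {V : Opens M} (hV : V ≤ U) (f : O.obj V) :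
    IsGlued e f (glueOp hc V hV f) := (exists_isGlued hc hV f).choose_spec

/-- The Euler vector field obtained by gluing Euler vector fields which agree on overlaps. -/
noncomputable def EulerField.glue : EulerField A where
  op := glueOp hc
  res {V V'} hV h f := by
    refine (isGlued_glueOp hc (h.trans hV) (O.res h f)).unique (h.trans hV) fun x V'' h' hx => ?_
    rw [O.res_res, O.res_res]
    exact isGlued_glueOp hc hV f x V'' _ hx
  deg hV j f hf := by
    obtain ⟨g, hg, h⟩ := exists_isGlued_of_deg hc hV hf
    rwa [(isGlued_glueOp hc hV f).unique hV h]
  leibniz hV f g := by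
    refine (isGlued_glueOp hc hV (f * g)).unique hV fun x V' h hx => ?_
    rw [map_add, map_mul, map_mul, map_mul, isGlued_glueOp hc hV f x V' h hx,
      isGlued_glueOp hc hV g x V' h hx, (e x).leibniz]
  filt {V} hV n f hf := by
    refine O.F_local V n _ fun x hx =>
      ⟨A.dom ⟨x, hV hx⟩ ⊓ V, inf_le_right, ⟨A.mem ⟨x, hV hx⟩, hx⟩, ?_⟩
    rw [isGlued_glueOp hc hV f ⟨x, hV hx⟩ _ inf_le_right inf_le_left]
    exact (e _).filt _ n _ (O.res_F _ n f hf)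
  body {V} hV f := by
    rw [mem_I]
    ext x
    have h1 := isGlued_glueOp hc hV f ⟨x.1, hV x.2⟩ _ inf_le_right inf_le_left
    have h2 := O.body_res (inf_le_right : A.dom ⟨x.1, hV x.2⟩ ⊓ V ≤ V) (glueOp hc V hV f)
      ⟨x.1, A.mem ⟨x.1, hV x.2⟩, x.2⟩
    rw [← h2, h1, mem_I.1 ((e ⟨x.1, hV x.2⟩).body _ _)]
    rfl
  near x V hV hx f hf n := by
    have h1 := isGlued_glueOp hc hV f x V le_rfl hx
    rw [O.res_refl, O.res_refl] at h1
    rw [h1]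
    by_cases hne : Nonempty (A.dom x)
    · exact (e x).near hne.some hx hx f hf n
    · exact absurd ⟨x.1, A.mem x⟩ hne

end Glue
end GradedSpace

namespace QStructure

open GradedSpace

variable {O : GradedManifold.{u, v} d M} (D : QStructure O)

theorem Q_glue {U : Opens M} {A : O.SplittingAtlas U} {e : ∀ x, EulerField (A.adapted x).atlas}
    (hc : ∀ (x y : U) (V : Opens M) (hx : V ≤ A.dom x) (hy : V ≤ A.dom y) (f : O.obj V),
      (e x).op V hx f = (e y).op V hy f)
    (he : ∀ (x : U) (V : Opens M) (hx : V ≤ A.dom x) (f : O.obj V),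
      D.Q V ((e x).op V hx f) = (e x).op V hx (D.Q V f) + D.Q V f)
    {V : Opens M} (hV : V ≤ U) (f : O.obj V) :
    D.Q V ((EulerField.glue hc).op V hV f) =
      (EulerField.glue hc).op V hV (D.Q V f) + D.Q V f := by
  refine eq_of_local fun x hx =>
    ⟨A.dom ⟨x, hV hx⟩ ⊓ V, inf_le_right, ⟨A.mem ⟨x, hV hx⟩, hx⟩, ?_⟩
  have h1 : ∀ f, O.res inf_le_right ((EulerField.glue hc).op V hV f) = _ :=
    fun f => isGlued_glueOp hc hV f ⟨x, hV hx⟩ _ inf_le_right inf_le_left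
  rw [← D.res, h1, he, map_add, h1, D.res]

/-- A closed lift of a smooth function, in the presence of a primitive of `1`. -/
theorem exists_closed_lift {N : Opens M} {W : GradedFamily.{u, v'} d M} (Φ : O.Iso N W)
    {θ : O.obj N} (hθ : θ ∈ O.deg N (-1)) (hQ : D.Q N θ = 1) (χ : C^∞⟮𝓡 d, N; 𝓘(ℝ, ℝ), ℝ⟯) :
    ∃ X ∈ O.deg N 0, D.Q N X = 0 ∧ O.body N X = χ ∧ ∀ (V : Opens M) (h : V ≤ N),
      (∀ y : V, χ ⟨y.1, h y.2⟩ = 0) → O.res h X = 0 := by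
  obtain ⟨c, hc, hcx, hcb⟩ := Φ.exists_const le_rfl χ
  -- Since `Q θ = 1`, `Q(θ Q c) = Q c`, so the correction makes `c` closed. It has zero body and
  -- vanishes wherever `c` does locally.
  refine ⟨c - θ * D.Q N c, Submodule.sub_mem _ hc ?_, ?_, ?_, fun V h h0 => ?_⟩
  · simpa using mul_mem_deg hθ (D.deg N 0 c hc)
  · rw [map_sub, D.leibniz N _ θ hθ, hQ, D.square]
    simp
  · rw [map_sub, map_mul, O.body_deg N _ (by norm_num) θ hθ, hcb, zero_mul, sub_zero]
  · have h1 : O.res h c = 0 := Φ.app_ext h fun y => by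
      rw [Φ.app_res le_rfl h, hcx, h0 y, map_zero, map_zero]
    rw [map_sub, map_mul, ← D.res, h1, map_zero, mul_zero, sub_zero]

/-- Euler vector fields `ε` with `[Q, ε] = Q` on an open cover of `U`, and closed lifts of a
subordinate partition of unity. -/
structure EulerCover (U : Opens M) where
  dom : U → Opens M
  mem : ∀ i, i.1 ∈ dom i
  iso : ∀ i, O.Iso (dom i) O.dualFamily
  adapted : ∀ i, (iso i).Adapted
  field : ∀ i, EulerField (adapted i).atlas
  Q_op : ∀ (i : U) (V : Opens M) (hV : V ≤ dom i) (f : O.obj V),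
    D.Q V ((field i).op V hV f) = (field i).op V hV (D.Q V f) + D.Q V f
  ρ : SmoothPartitionOfUnity U (𝓡 d) U
  subordinate : ρ.IsSubordinate fun i => {y | y.1 ∈ dom i}
  lift : ∀ i, O.obj (dom i)
  lift_deg : ∀ i, lift i ∈ O.deg (dom i) 0
  Q_lift : ∀ i, D.Q _ (lift i) = 0
  body_lift : ∀ (i y : U) (hy : y.1 ∈ dom i), O.body _ (lift i) ⟨y.1, hy⟩ = ρ i y
  res_lift : ∀ (i : U) (V : Opens M) (h : V ≤ dom i),
    (∀ y : U, y.1 ∈ V → ρ i y = 0) → O.res h (lift i) = 0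

theorem exists_eulerCover [T2Space M] [SecondCountableTopology M] [IsManifold (𝓡 d) ∞ M]
    {U : Opens M} (hκ : ∀ x ∈ U, D.curvature x ≠ 0) : Nonempty (D.EulerCover U) := by
  choose N Φ hx hU hΦ θ hθ hQ using fun x : U => D.exists_primitive (hκ x.1 x.2) U x.2
  have : LocallyCompactSpace M := ChartedSpace.locallyCompactSpace (EuclideanSpace ℝ (Fin d)) M
  have : LocallyCompactSpace U := U.isOpen.locallyCompactSpace
  obtain ⟨ρ, hρ⟩ := SmoothPartitionOfUnity.exists_isSubordinate (M := U) (𝓡 d) isClosed_univ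
    (fun i => {y : U | y.1 ∈ N i}) (fun i => (N i).isOpen.preimage continuous_subtype_val)
    (fun x _ => Set.mem_iUnion.2 ⟨x, hx x⟩)
  choose X hX hQX hbX hrX using fun i => D.exists_closed_lift (Φ i) (hθ i) (hQ i)
    ⟨fun y => ρ i ⟨y.1, hU i y.2⟩, (ρ i).contMDiff.comp (contMDiff_inclusion (hU i))⟩
  exact ⟨{
    dom := N
    mem := hx
    iso := Φ
    adapted := hΦ
    field := fun i => D.corrected (hΦ i).eulerField (hθ i)
    Q_op := fun i V hV f => D.Q_corrected _ (hθ i) (hQ i) hV f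
    ρ := ρ
    subordinate := hρ
    lift := X
    lift_deg := hX
    Q_lift := hQX
    body_lift := fun i y hy => by rw [hbX]; rfl
    res_lift := fun i V h h0 => hrX i V h fun y => h0 ⟨y.1, hU i (h y.2)⟩ y.2 }⟩

end QStructure
end GradedQ

/-! ### Averaging the local Euler vector fields. -/

namespace GradedQ

universe u v v'
variable {d : ℕ} {M : Type u} [TopologicalSpace M] [ChartedSpace (EuclideanSpace ℝ (Fin d)) M]

namespace QStructure

open GradedSpace

variable {O : GradedManifold.{u, v} d M} {D : QStructure O}

namespace EulerCover

variable {U : Opens M} (C : D.EulerCover U)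

/-- On `V`, only the functions of the partition of unity with index in `T` matter. -/
structure Small (T : Finset U) (V : Opens M) : Prop where
  le : ∀ i ∈ T, V ≤ C.dom i
  eq_zero : ∀ i ∉ T, ∀ y : U, y.1 ∈ V → C.ρ i y = 0

variable {C} in
theorem Small.mono {T : Finset U} {V V' : Opens M} (h : C.Small T V) (hV : V' ≤ V) :
    C.Small T V' :=
  ⟨fun i hi => hV.trans (h.le i hi), fun i hi y hy => h.eq_zero i hi y (hV hy)⟩

open Classical in
/-- The closed lift of a function of the partition of unity on `V`. -/
noncomputable def coef (V : Opens M) (i : U) : O.obj V :=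
  if h : V ≤ C.dom i then O.res h (C.lift i) else 0

open Classical in
/-- The Euler vector fields of the cover on `V`. -/
noncomputable def term (V : Opens M) (i : U) : O.obj V →ₗ[ℝ] O.obj V :=
  if h : V ≤ C.dom i then (C.field i).op V h else 0

theorem coef_eq {V : Opens M} {i : U} (h : V ≤ C.dom i) : C.coef V i = O.res h (C.lift i) :=
  dif_pos h

theorem term_eq {V : Opens M} {i : U} (h : V ≤ C.dom i) : C.term V i = (C.field i).op V h :=
  dif_pos h

theorem coef_eq_zero {T : Finset U} {V : Opens M} (hT : C.Small T V) {i : U} (hi : i ∉ T) :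
    C.coef V i = 0 := by
  rw [coef]
  split_ifs with h
  · exact C.res_lift i V h (hT.eq_zero i hi)
  · rfl

theorem coef_mem (V : Opens M) (i : U) : C.coef V i ∈ O.deg V 0 := by
  rw [coef]
  split_ifs with h
  · exact O.res_deg h 0 _ (C.lift_deg i)
  · exact Submodule.zero_mem _

theorem Q_coef (V : Opens M) (i : U) : D.Q V (C.coef V i) = 0 := by
  rw [coef]
  split_ifs with h
  · rw [D.res, C.Q_lift, map_zero]
  · exact map_zero _

/-- The sum of the closed lifts with index in `T`. -/
noncomputable def total (T : Finset U) (V : Opens M) : O.obj V := ∑ i ∈ T, C.coef V i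

/-- The combination of the Euler vector fields with index in `T`. -/
noncomputable def combination (T : Finset U) (V : Opens M) : O.obj V →ₗ[ℝ] O.obj V :=
  ∑ i ∈ T, LinearMap.mulLeft ℝ (C.coef V i) ∘ₗ C.term V i

theorem combination_apply (T : Finset U) (V : Opens M) (f : O.obj V) :
    C.combination T V f = ∑ i ∈ T, C.coef V i * C.term V i f := by
  simp [combination]

theorem total_mem (T : Finset U) (V : Opens M) : C.total T V ∈ O.deg V 0 :=
  Submodule.sum_mem _ fun i _ => C.coef_mem V i

theorem Q_total (T : Finset U) (V : Opens M) : D.Q V (C.total T V) = 0 := by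
  rw [total, map_sum]
  exact Finset.sum_eq_zero fun i _ => C.Q_coef V i

section Small

variable {C} {T : Finset U} {V : Opens M} (hT : C.Small T V)
include hT

theorem total_res {V' : Opens M} (h : V' ≤ V) : C.total T V' = O.res h (C.total T V) := by
  rw [total, total, map_sum]
  refine Finset.sum_congr rfl fun i hi => ?_
  rw [C.coef_eq (hT.le i hi), C.coef_eq (h.trans (hT.le i hi)), O.res_res]

theorem combination_res {V' : Opens M} (h : V' ≤ V) (f : O.obj V) :
    C.combination T V' (O.res h f) = O.res h (C.combination T V f) := by
  rw [combination_apply, combination_apply, map_sum]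
  refine Finset.sum_congr rfl fun i hi => ?_
  rw [C.coef_eq (hT.le i hi), C.coef_eq (h.trans (hT.le i hi)), C.term_eq (hT.le i hi),
    C.term_eq (h.trans (hT.le i hi)), map_mul, O.res_res, (C.field i).res (hT.le i hi) h]

/-- Both sums equal the sum over the union, since a lift vanishes wherever its function of the
partition of unity does. -/
theorem total_eq_of_small {T' : Finset U} (hT' : C.Small T' V) : C.total T V = C.total T' V := by
  classical
  have h1 : C.total T V = C.total (T ∪ T') V :=
    Finset.sum_subset Finset.subset_union_left fun i _ hi => C.coef_eq_zero hT hi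
  have h2 : C.total T' V = C.total (T ∪ T') V :=
    Finset.sum_subset Finset.subset_union_right fun i _ hi => C.coef_eq_zero hT' hi
  rw [h1, h2]

theorem combination_eq_of_small {T' : Finset U} (hT' : C.Small T' V) (f : O.obj V) :
    C.combination T V f = C.combination T' V f := by
  classical
  rw [combination_apply, combination_apply]
  have h1 := Finset.sum_subset (f := fun i => C.coef V i * C.term V i f)
    (Finset.subset_union_left (s₁ := T) (s₂ := T'))
    fun i _ hi => by rw [C.coef_eq_zero hT hi, zero_mul]
  have h2 := Finset.sum_subset (f := fun i => C.coef V i * C.term V i f)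
    (Finset.subset_union_right (s₁ := T) (s₂ := T'))
    fun i _ hi => by rw [C.coef_eq_zero hT' hi, zero_mul]
  exact h1.trans h2.symm

/-- The bodies add up to one, but the lifts themselves need not. Invertibility is all that survives,
hence the later division. -/
theorem body_total (hV : V ≤ U) : O.body V (C.total T V) = 1 := by
  ext y
  have h1 : ∀ i ∈ T, O.body V (C.coef V i) y = C.ρ i ⟨y.1, hV y.2⟩ := fun i hi => by
    rw [C.coef_eq (hT.le i hi), O.body_res]
    exact C.body_lift i ⟨y.1, hV y.2⟩ _
  have h2 := C.ρ.sum_eq_one (Set.mem_univ (⟨y.1, hV y.2⟩ : U))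
  rw [finsum_eq_sum_of_support_subset (s := T)] at h2
  · rw [total, map_sum]
    refine Eq.trans ?_ h2
    have h3 : ∀ g : U → C^∞⟮𝓡 d, V; 𝓘(ℝ, ℝ), ℝ⟯, (∑ i ∈ T, g i) y = ∑ i ∈ T, g i y :=
      fun g => map_sum (ContMDiffMap.evalRingHom y) g T
    rw [h3]
    exact Finset.sum_congr rfl h1
  · intro i hi
    by_contra h
    exact hi (hT.eq_zero i h _ y.2)

theorem combination_deg {j : ℤ} {f : O.obj V} (hf : f ∈ O.deg V j) :
    C.combination T V f ∈ O.deg V j := by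
  rw [combination_apply]
  refine Submodule.sum_mem _ fun i hi => ?_
  rw [C.term_eq (hT.le i hi)]
  simpa using mul_mem_deg (C.coef_mem V i) ((C.field i).deg (hT.le i hi) j f hf)

theorem combination_mul (f g : O.obj V) : C.combination T V (f * g) =
    C.combination T V f * g + f * C.combination T V g := by
  rw [combination_apply, combination_apply, combination_apply, Finset.sum_mul, Finset.mul_sum,
    ← Finset.sum_add_distrib]
  refine Finset.sum_congr rfl fun i hi => ?_
  rw [C.term_eq (hT.le i hi), (C.field i).leibniz, mul_add, ← mul_assoc, ← mul_assoc,
    ← mul_assoc, commute_of_mem_deg_zero (C.coef_mem V i) f]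

theorem combination_filt {N : Opens M} {W : GradedFamily.{u, v'} d M} (Φ : O.Iso N W)
    (hV : V ≤ N) {n : ℕ} {f : O.obj V} (hf : f ∈ O.F V n) : C.combination T V f ∈ O.F V n := by
  rw [combination_apply]
  refine Submodule.sum_mem _ fun i hi => Φ.mul_mem_F_left hV _ ?_
  rw [C.term_eq (hT.le i hi)]
  exact (C.field i).filt (hT.le i hi) n f hf

theorem combination_mem_I (f : O.obj V) : C.combination T V f ∈ O.I V := by
  rw [combination_apply]
  refine Submodule.sum_mem _ fun i hi => mul_mem_I_left _ ?_
  rw [C.term_eq (hT.le i hi)]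
  exact (C.field i).body (hT.le i hi) f

/-- Each field is the identity on `I / I²`, so the combination multiplies by the sum of the weights.
-/
theorem combination_sub_mem {N : Opens M} {W : GradedFamily.{u, v'} d M} (Φ : O.Iso N W)
    (hV : V ≤ N) {f : O.obj V} (hf : f ∈ O.I V) (n : ℕ) :
    C.combination T V f - C.total T V * f ∈ O.Ipow V 2 ⊔ O.F V n := by
  rw [combination_apply, total, Finset.sum_mul, ← Finset.sum_sub_distrib]
  refine Submodule.sum_mem _ fun i hi => ?_
  rw [← mul_sub, C.term_eq (hT.le i hi)]
  exact Φ.mul_mem_sup_left hV _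
    ((C.field i).near ⟨i.1, C.mem i⟩ (hT.le i hi) (hT.le i hi) f hf n)

/-- The weights are closed of degree zero, so `Q` passes through them and only the relation for each
field contributes. -/
theorem Q_combination (f : O.obj V) : D.Q V (C.combination T V f) =
    C.combination T V (D.Q V f) + C.total T V * D.Q V f := by
  rw [combination_apply, combination_apply, total, Finset.sum_mul, ← Finset.sum_add_distrib,
    map_sum]
  refine Finset.sum_congr rfl fun i hi => ?_
  rw [D.leibniz V 0 _ (C.coef_mem V i), C.Q_coef, C.term_eq (hT.le i hi), C.Q_op, zero_mul,
    zero_add, zpow_zero, one_smul, mul_add]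

end Small

/-- Each point has a neighbourhood on which finitely many indices matter. -/
theorem exists_small (x : U) : ∃ (T : Finset U) (V : Opens M), x.1 ∈ V ∧ V ≤ U ∧
    V ≤ C.dom x ∧ C.Small T V := by
  have h1 := C.ρ.eventually_fintsupport_subset x
  have h2 : ∀ᶠ y in nhds x, y.1 ∈ C.dom x ∧ ∀ i ∈ C.ρ.fintsupport x, y.1 ∈ C.dom i := by
    have h3 : ∀ i : U, x.1 ∈ C.dom i → ∀ᶠ y : U in nhds x, y.1 ∈ C.dom i := fun i hi =>
      ((C.dom i).isOpen.preimage continuous_subtype_val).mem_nhds hi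
    refine (h3 x (C.mem x)).and ((Finset.eventually_all _).2 fun i hi => h3 i ?_)
    exact C.subordinate i ((C.ρ.mem_fintsupport_iff x i).1 hi)
  obtain ⟨S, hS, hSo, hxS⟩ := mem_nhds_iff.1 (h1.and h2)
  refine ⟨C.ρ.fintsupport x, ⟨Subtype.val '' S, U.isOpen.isOpenMap_subtype_val _ hSo⟩,
    ⟨x, hxS, rfl⟩, ?_, ?_, ?_, ?_⟩
  · rintro _ ⟨y, -, rfl⟩
    exact y.2
  · rintro _ ⟨y, hy, rfl⟩
    exact (hS hy).2.1
  · rintro i hi _ ⟨y, hy, rfl⟩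
    exact (hS hy).2.2 i hi
  · rintro i hi y ⟨y', hy, h⟩
    obtain rfl : y' = y := Subtype.ext h
    by_contra hne
    exact hi ((hS hy).1 ((C.ρ.mem_fintsupport_iff _ i).2 (subset_tsupport _ hne)))

section Average

variable {C} {T : Finset U} {N : Opens M} (hT : C.Small T N)
  {Φ : O.Iso N O.dualFamily} (hΦ : Φ.Adapted) {z : O.obj N} (hz : z ∈ O.deg N 0)
  (hz1 : C.total T N * z = 1)

include hT hz hz1 in
theorem res_mul_total {V : Opens M} (hV : V ≤ N) : O.res hV z * C.total T V = 1 := by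
  rw [commute_of_mem_deg_zero (O.res_deg hV 0 z hz), total_res hT hV, ← map_mul, hz1, map_one]

/-- The average of the Euler vector fields of the cover near a point. -/
noncomputable def average : EulerField hΦ.atlas where
  op V hV := LinearMap.mulLeft ℝ (O.res hV z) ∘ₗ C.combination T V
  res {V V'} hV h f := by
    simp only [LinearMap.comp_apply, LinearMap.mulLeft_apply]
    rw [combination_res (hT.mono hV) h, map_mul, O.res_res]
  deg {V} hV j f hf := by
    have := mul_mem_deg (O.res_deg hV 0 z hz) (combination_deg (hT.mono hV) hf)
    rwa [zero_add] at this
  leibniz {V} hV f g := by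
    simp only [LinearMap.comp_apply, LinearMap.mulLeft_apply]
    rw [combination_mul (hT.mono hV), mul_add, ← mul_assoc, ← mul_assoc, ← mul_assoc,
      commute_of_mem_deg_zero (O.res_deg hV 0 z hz) f]
  filt {V} hV n f hf := Φ.mul_mem_F_left hV _ (combination_filt (hT.mono hV) Φ hV hf)
  body {V} hV f := mul_mem_I_left _ (combination_mem_I (hT.mono hV) f)
  near x {V} hV _ f hf n := by
    have h1 := Φ.mul_mem_sup_left hV (O.res hV z)
      (combination_sub_mem (hT.mono hV) Φ hV hf n)
    rw [mul_sub, ← mul_assoc, res_mul_total hT hz hz1 hV, one_mul] at h1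
    exact h1

theorem average_apply {V : Opens M} (hV : V ≤ N) (f : O.obj V) :
    (average hT hΦ hz hz1).op V hV f = O.res hV z * C.combination T V f := rfl

theorem Q_average {V : Opens M} (hV : V ≤ N) (f : O.obj V) :
    D.Q V ((average hT hΦ hz hz1).op V hV f) =
      (average hT hΦ hz hz1).op V hV (D.Q V f) + D.Q V f := by
  have h1 := res_mul_total hT hz hz1 hV
  -- The inverse of a closed function of degree zero is closed.
  have h2 : D.Q N z = 0 := by
    have h := D.leibniz N 0 _ (C.total_mem T N) z
    rw [hz1, D.Q_one, Q_total, zero_mul, zero_add, zpow_zero, one_smul] at h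
    rw [← one_mul (D.Q N z), ← hz1, commute_of_mem_deg_zero (C.total_mem T N), mul_assoc, ← h,
      mul_zero]
  rw [average_apply, average_apply, D.leibniz V 0 _ (O.res_deg hV 0 z hz), D.res, h2, map_zero,
    zero_mul, zero_add, zpow_zero, one_smul, Q_combination (hT.mono hV), mul_add, ← mul_assoc, h1,
    one_mul]

end Average

include C in
/-- There is an Euler vector field `ε` over `U` with `[Q, ε] = Q`. -/
theorem exists_eulerField : ∃ (A : O.SplittingAtlas U) (ε : EulerField A),
    ∀ {V : Opens M} (hV : V ≤ U) (f : O.obj V),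
      D.Q V (ε.op V hV f) = ε.op V hV (D.Q V f) + D.Q V f := by
  choose T N hx hU hdom hT using C.exists_small
  have hΦ : ∀ x, ((C.iso x).restrict (hdom x)).Adapted := fun x => (C.adapted x).restrict (hdom x)
  choose z hz hz1 using fun x => (C.iso x).exists_inverse (hdom x) (C.total_mem (T x) (N x))
    fun y => by
      rw [body_total (hT x) (hU x)]
      exact one_ne_zero
  let A : O.SplittingAtlas U := ⟨N, hx, _, hΦ⟩
  let e : ∀ x, EulerField (A.adapted x).atlas := fun x => average (hT x) (hΦ x) (hz x) (hz1 x)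
  -- On overlaps the weighted sums coincide although the finite index sets differ, and inverses are
  -- unique, so the averages agree and glue.
  have hc : ∀ (x y : U) (V : Opens M) (hx : V ≤ A.dom x) (hy : V ≤ A.dom y) (f : O.obj V),
      (e x).op V hx f = (e y).op V hy f := by
    intro x y V hx hy f
    have h1 : C.total (T x) V = C.total (T y) V :=
      total_eq_of_small ((hT x).mono hx) ((hT y).mono hy)
    have h2 : C.total (T x) V * O.res hx (z x) = 1 := by
      rw [total_res (hT x) hx, ← map_mul, hz1, map_one]
    have h3 : C.total (T x) V * O.res hy (z y) = 1 := by
      rw [h1, total_res (hT y) hy, ← map_mul, hz1, map_one]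
    have h4 : O.res hx (z x) = O.res hy (z y) := by
      rw [← one_mul (O.res hx (z x)), ← h3, mul_assoc,
        commute_of_mem_deg_zero (O.res_deg hy 0 _ (hz y)), ← mul_assoc, h2, one_mul]
    refine (average_apply (hT x) (hΦ x) (hz x) (hz1 x) hx f).trans
      (Eq.trans ?_ (average_apply (hT y) (hΦ y) (hz y) (hz1 y) hy f).symm)
    rw [h4, combination_eq_of_small ((hT x).mono hx) ((hT y).mono hy)]
  exact ⟨A, EulerField.glue hc, fun hV f => D.Q_glue hc
    (fun x V hx f => Q_average (hT x) (hΦ x) (hz x) (hz1 x) hx f) hV f⟩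

end EulerCover
end QStructure
end GradedQ

/-! ### The theorem. -/

theorem mainTheorem3 {d : ℕ} {M : Type*} [TopologicalSpace M] [T2Space M]
    [SecondCountableTopology M] [ChartedSpace (EuclideanSpace ℝ (Fin d)) M] [IsManifold (𝓡 d) ∞ M]
    (O : GradedQ.GradedManifold d M) (D : GradedQ.QStructure O) (U : TopologicalSpace.Opens M)
    (hκ : ∀ x ∈ U, D.curvature x ≠ 0) :
    ∃ Φ : O.Splitting U,
      (∀ (V : TopologicalSpace.Opens M) (hV : V ≤ U),
        D.Q V = Φ.contraction hV ⟨1, one_ne_zero⟩ (D.curvatureSec V)) ∧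
      (∀ (V : TopologicalSpace.Opens M) (hV : V ≤ U) (α : O.SecDual V 1) (x : V),
        D.bracket Φ hV [] ⟨1, one_ne_zero⟩ α x = α.val x (D.curvature x.1)) ∧
      (∀ (V : TopologicalSpace.Opens M) (hV : V ≤ U)
        (es : List (Σ k : GradedQ.ZStar, O.SecE V k.1)), es ≠ [] →
        (∀ (k : GradedQ.ZStar) (α : O.SecDual V k.1), D.bracket Φ hV es k α = 0) ∧
        (∀ f, D.anchor Φ hV es f = 0)) := by
  obtain ⟨C⟩ := D.exists_eulerCover hκ
  obtain ⟨A, ε, hε⟩ := C.exists_eulerField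
  exact ⟨ε.splitting, D.conclusion _ fun V hV => D.Q_eq_contraction ε hε hV⟩
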